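/- Let $f_\varepsilon(x,y)\in\mathbb R^2$ ($x,y\in\mathbb R^2$, $\varepsilon\in\mathbb R$ near $0$) and $r(x)\in\mathbb R$ be given, and consider the delay equations $$(1)\quad \dot y(t)=f_\varepsilon\big(y(t),\,y(t-\varepsilon r(y(t)))\big),\qquad\qquad (2)\quad \dot y(t)=f_\varepsilon\big(y(t),\,\varepsilon\, y(t-r(y(t)))\big).$$ For $\varepsilon=0$ they are the planar ODEs $\dot y=f_0(y,y)$ and $\dot y=f_0(y,0)$, respectively. Assume that the unperturbed ODE has a limit cycle with a parameterization of a neighbourhood as follows: there are $\delta>0$, real numbers $\omega_0\ne0$, $\lambda_0\neq 0$ and an injective $C^\infty$ immersion $W_0:\mathbb T\times(-\delta,\delta)\to\mathbb R^2$, $\mathbb T=\mathbb R/\mathbb Z$, such that $t\mapsto W_0(\theta_0+\omega_0t,\,s_0e^{\lambda_0t})$ solves the unperturbed ODE for all $\theta_0,s_0$ and all $t$ with $|s_0e^{\lambda_0t}|<\delta$ (the limit cycle is $s=0$). Write $W_0^{(p)}(\theta)=\frac1{p!}\partial_s^pW_0(\theta,0)$. Assume that $(\varepsilon,x,y)\mapsto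 f_\varepsilon(x,y)$ is $C^\infty$ (resp. real-analytic) at the points $(0,W_0(\theta,0),W_0(\theta,0))$ in case (1), $(0,W_0(\theta,0),0)$ in case (2), that $r$ is $C^\infty$ (resp. real-analytic) at the points of the cycle and, in the analytic case, that $W_0$ is real-analytic. Then there are Lindstedt series $$W=\sum_{n\ge0}\varepsilon^n\sum_{p\ge0}s^pW_n^{(p)}(\theta),\qquad \omega=\sum_{n\ge0}\varepsilon^n\omega_n,\qquad \lambda=\sum_{n\ge0}\varepsilon^n\lambda_n ,$$ starting with the given $W_0^{(p)},\omega_0,\lambda_0$ and with $C^\infty$ coefficients $W_n^{(p)}:\mathbb T\to\mathbb R^2$, which solve to all orders, as formal power series in $\varepsilon$ and $s$, the invariance equation $$(\omega\partial_\theta+s\lambda\partial_s)W(\theta,s)=f_\varepsilon\big(W(\theta,s),\,W(\theta-\varepsilon\omega r(W(\theta,s)),\,s e^{-\varepsilon\lambda r(W(\theta,s))})\big)$$ in case (1), and $$(\omega\partial_\theta+s\lambda\partial_s)W(\theta,s)=f_\varepsilon\big(W(\theta,s),\,\varepsilon W(\theta-\omega r(W(\theta,s)),\,s e^{-\lambda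 r(W(\theta,s))})\big)$$ in case (2). That is, for all $N,P$ the truncation of the series at order $N$ in $\varepsilon$ and $P$ in $s$ satisfies the equation up to an error $O(|\varepsilon|^{N+1}+|s|^{P+1})$, uniformly in $\theta$, for $\varepsilon,s$ near $0$. The coefficients are obtained from linear equations with constant coefficients. For $n\ge0$, let $\varepsilon^{n+1}E(\theta,s)$, $E=\sum_ps^pE^{(p)}(\theta)$, be the leading term (modulo $\varepsilon^{n+2}$, to all orders in $s$) of the error, left side minus right side, of the series truncated at order $n$ in $\varepsilon$. Then, as formal power series in $s$, $\sum_ps^pW_{n+1}^{(p)}=DW_0A$ and $E=DW_0\tilde E$ with $A=(A_1,A_2)$, $\tilde E=(\tilde E_1,\tilde E_2)$, where $A$ has $C^\infty$ coefficients on $\mathbb T$ and $$(\omega_0\partial_\theta+\lambda_0s\partial_s)A_1+\omega_{n+1}=-\tilde E_1,\qquad (\omega_0\partial_\theta+\lambda_0s\partial_s-\lambda_0)A_2+\lambda_{n+1}s=-\tilde E_2 .$$ In the analytic case the coefficients are moreover analytic on complex neighbourhoods $\mathbb T_\xi=\{\theta\in\mathbb C/\mathbb Z:|\mathrm{Im}\,\theta|<\xi\}$.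 In case (1) all $W_n^{(p)}$ are analytic in one common $\mathbb T_\xi$, $\xi>0$; more precisely, they are analytic in $\mathbb T_\xi$ (hence in $\mathbb T_{\xi'}$, $\xi'<\xi$) for every $\xi>0$ such that all $W_0^{(p)}$ are analytic in $\mathbb T_\xi$ and $f$, $r$ extend analytically to neighbourhoods of the points $(0,W_0^{(0)}(z),W_0^{(0)}(z))$, resp. $W_0^{(0)}(z)$, $z\in\mathbb T_\xi$. In case (2), for every $n$ there is $\xi_n>0$ such that all $W_n^{(p)}$, $p\ge0$, are analytic in $\mathbb T_{\xi_n}$. -/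

import Mathlib

open Filter Topology
open scoped ContDiff

/-- The phase space `ℝ²`. -/
abbrev Plane := EuclideanSpace ℝ (Fin 2)

/-- The complexified phase space `ℂ²`. -/
abbrev CPlane := EuclideanSpace ℂ (Fin 2)

/-- The inclusion of `ℝ²` in `ℂ²`. -/
noncomputable def complexify (x : Plane) : CPlane := WithLp.toLp 2 fun i => (x i : ℂ)

/-- The two families of delay equations, for `f (ε, x, y) = f_ε(x, y)`:
* `shortDelay`: `y'(t) = f_ε (y(t), y(t - ε r(y(t))))`,
* `weakDelay`: `y'(t) = f_ε (y(t), ε y(t - r(y(t))))`. -/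
inductive DelayKind
  | shortDelay
  | weakDelay

/-- The second argument of `f_0` in the unperturbed equation: `y' = f_0 (y, y)` for the first
family and `y' = f_0 (y, 0)` for the second one. -/
noncomputable def DelayKind.base : DelayKind → Plane → Plane
  | .shortDelay, x => x
  | .weakDelay, _ => 0

/-- The delayed argument of `f_ε` in the invariance equation at `(θ, s)`:
`W(θ - ε ω r(W(θ,s)), s e^{- ε λ r(W(θ,s))})`, respectively
`ε W(θ - ω r(W(θ,s)), s e^{- λ r(W(θ,s))})`. -/
noncomputable def delayedArg (k : DelayKind) (r : Plane → ℝ) (ε om lam : ℝ)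
    (W : ℝ → ℝ → Plane) (θ s : ℝ) : Plane :=
  match k with
  | .shortDelay => W (θ - ε * om * r (W θ s)) (s * Real.exp (-(ε * lam * r (W θ s))))
  | .weakDelay => ε • W (θ - om * r (W θ s)) (s * Real.exp (-(lam * r (W θ s))))

/-- Left-hand side minus right-hand side of the invariance equation
`(ω ∂_θ + s λ ∂_s) W = f_ε (W, delayed argument)` at `(θ, s)`. -/
noncomputable def invarianceError (k : DelayKind) (f : ℝ × Plane × Plane → Plane)
    (r : Plane → ℝ) (ε om lam : ℝ) (W : ℝ → ℝ → Plane) (θ s : ℝ) : Plane :=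
  om • deriv (fun t => W t s) θ + (s * lam) • deriv (fun u => W θ u) s
    - f (ε, W θ s, delayedArg k r ε om lam W θ s)

/-- `W₀ : 𝕋 × (-δ, δ) → ℝ²` parameterizes a limit cycle (`s = 0`) of the unperturbed equation and
the orbits asymptotic to it: it is an injective immersion, `1`-periodic in `θ`, and
`t ↦ W₀(θ₀ + ω₀ t, s₀ e^{λ₀ t})` solves the unperturbed equation. -/
structure IsLimitCycleParam (k : DelayKind) (f : ℝ × Plane × Plane → Plane)
    (δ om₀ lam₀ : ℝ) (W₀ : ℝ → ℝ → Plane) : Prop where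
  delta_pos : 0 < δ
  om_ne : om₀ ≠ 0
  lam_ne : lam₀ ≠ 0
  smooth : ContDiffOn ℝ ∞ (Function.uncurry W₀) (Set.univ ×ˢ Set.Ioo (-δ) δ)
  periodic : ∀ θ s, |s| < δ → W₀ (θ + 1) s = W₀ θ s
  injective : ∀ θ θ' s s', |s| < δ → |s'| < δ → W₀ θ s = W₀ θ' s' →
    s = s' ∧ ∃ m : ℤ, θ' = θ + m
  immersion : ∀ θ s, |s| < δ →
    LinearIndependent ℝ ![deriv (fun t => W₀ t s) θ, deriv (fun u => W₀ θ u) s]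
  solution : ∀ θ₀ s₀ t, |s₀ * Real.exp (lam₀ * t)| < δ →
    HasDerivAt (fun τ => W₀ (θ₀ + om₀ * τ) (s₀ * Real.exp (lam₀ * τ)))
      (f (0, W₀ (θ₀ + om₀ * t) (s₀ * Real.exp (lam₀ * t)),
        k.base (W₀ (θ₀ + om₀ * t) (s₀ * Real.exp (lam₀ * t))))) t

/-- The Taylor coefficients `W₀^{(p)}(θ)` of `W₀(θ, s)` in `s`. -/
noncomputable def sCoeff (W₀ : ℝ → ℝ → Plane) (p : ℕ) (θ : ℝ) : Plane :=
  (1 / (p.factorial : ℝ)) • iteratedDeriv p (fun s => W₀ θ s) 0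

/-- `∑_{n ≤ N} εⁿ aₙ`. -/
noncomputable def truncScalar (a : ℕ → ℝ) (N : ℕ) (ε : ℝ) : ℝ :=
  ∑ n ∈ Finset.range (N + 1), ε ^ n * a n

/-- `∑_{n ≤ N} εⁿ ∑_{p ≤ P} sᵖ Wₙ^{(p)}(θ)`. -/
noncomputable def truncSeries (W : ℕ → ℕ → ℝ → Plane) (N P : ℕ) (ε θ s : ℝ) : Plane :=
  ∑ n ∈ Finset.range (N + 1), ε ^ n • ∑ p ∈ Finset.range (P + 1), s ^ p • W n p θ

/-- The error in the invariance equation of the series truncated at order `N` in `ε` and at order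
`P` in `s`. -/
noncomputable def truncError (k : DelayKind) (f : ℝ × Plane × Plane → Plane) (r : Plane → ℝ)
    (om lam : ℕ → ℝ) (W : ℕ → ℕ → ℝ → Plane) (N P : ℕ) (ε θ s : ℝ) : Plane :=
  invarianceError k f r ε (truncScalar om N ε) (truncScalar lam N ε)
    (truncSeries W N P ε) θ s

/-- The series solve the invariance equation to all orders (in the formal variables `ε`, `s`):
every truncation solves it with an error `O(|ε|^{N+1} + |s|^{P+1})`, uniformly in `θ`. -/
def SolvesToAllOrders (k : DelayKind) (f : ℝ × Plane × Plane → Plane) (r : Plane → ℝ)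
    (om lam : ℕ → ℝ) (W : ℕ → ℕ → ℝ → Plane) : Prop :=
  ∀ N P : ℕ, ∃ C : ℝ, ∃ η : ℝ, 0 < η ∧ ∀ ε θ s : ℝ, |ε| < η → |s| < η →
    ‖truncError k f r om lam W N P ε θ s‖ ≤ C * (|ε| ^ (N + 1) + |s| ^ (P + 1))

/-- `E = ∑_p sᵖ E^{(p)}(θ)` is the leading term of the error of the solution truncated at order
`n` in `ε`: that error is `ε^{n+1} E + O(ε^{n+2})`, to all orders in `s`. -/
def IsLeadingError (k : DelayKind) (f : ℝ × Plane × Plane → Plane) (r : Plane → ℝ)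
    (om lam : ℕ → ℝ) (W : ℕ → ℕ → ℝ → Plane) (n : ℕ) (E : ℕ → ℝ → Plane) : Prop :=
  ∀ P : ℕ, ∃ C : ℝ, ∃ η : ℝ, 0 < η ∧ ∀ ε θ s : ℝ, |ε| < η → |s| < η →
    ‖truncError k f r om lam W n P ε θ s
        - ε ^ (n + 1) • ∑ p ∈ Finset.range (P + 1), s ^ p • E p θ‖
      ≤ C * (|ε| ^ (n + 2) + |s| ^ (P + 1))

/-- The coefficients in `s` of `DW A = A₁ ∂_θ W + A₂ ∂_s W`, for series `W = ∑ sᵖ w^{(p)}(θ)` and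
`A_h = ∑ sᵖ A_h^{(p)}(θ)`. -/
noncomputable def frameMul (w : ℕ → ℝ → Plane) (A₁ A₂ : ℕ → ℝ → ℝ) (p : ℕ) (θ : ℝ) : Plane :=
  ∑ i ∈ Finset.range (p + 1),
    (A₁ (p - i) θ • deriv (w i) θ + (((i : ℝ) + 1) * A₂ (p - i) θ) • w (i + 1) θ)

/-- The correction `(V, α, β)` of `(W, ω, λ)` is obtained from the error `E` through the linear
equations with constant coefficients
`(ω₀ ∂_θ + λ₀ s ∂_s) A₁ + α = -Ẽ₁`, `(ω₀ ∂_θ + λ₀ s ∂_s - λ₀) A₂ + β s = -Ẽ₂`,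
where `V = DW₀ A` and `E = DW₀ Ẽ` as series in `s`. -/
def IsCorrection (om₀ lam₀ : ℝ) (w : ℕ → ℝ → Plane) (E V : ℕ → ℝ → Plane) (α β : ℝ) : Prop :=
  ∃ A₁ A₂ E₁ E₂ : ℕ → ℝ → ℝ,
    (∀ p, ContDiff ℝ ∞ (A₁ p) ∧ Function.Periodic (A₁ p) 1) ∧
    (∀ p, ContDiff ℝ ∞ (A₂ p) ∧ Function.Periodic (A₂ p) 1) ∧
    (∀ p θ, V p θ = frameMul w A₁ A₂ p θ) ∧
    (∀ p θ, E p θ = frameMul w E₁ E₂ p θ) ∧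
    (∀ p θ, om₀ * deriv (A₁ p) θ + lam₀ * p * A₁ p θ + (if p = 0 then α else 0) = -E₁ p θ) ∧
    (∀ p θ, om₀ * deriv (A₂ p) θ + lam₀ * ((p : ℝ) - 1) * A₂ p θ
      + (if p = 1 then β else 0) = -E₂ p θ)

/-- Lindstedt series issuing from the unperturbed parameterization `(W₀, ω₀, λ₀)`, with `C^∞`
coefficients `Wₙ^{(p)} : 𝕋 → ℝ²`. -/
structure IsLindstedtSeries (k : DelayKind) (f : ℝ × Plane × Plane → Plane) (r : Plane → ℝ)
    (om₀ lam₀ : ℝ) (W₀ : ℝ → ℝ → Plane)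
    (om lam : ℕ → ℝ) (W : ℕ → ℕ → ℝ → Plane) : Prop where
  om_zero : om 0 = om₀
  lam_zero : lam 0 = lam₀
  W_zero : ∀ p θ, W 0 p θ = sCoeff W₀ p θ
  smooth : ∀ n p, ContDiff ℝ ∞ (W n p)
  periodic : ∀ n p, Function.Periodic (W n p) 1
  solves : SolvesToAllOrders k f r om lam W
  correction : ∀ n, ∃ E : ℕ → ℝ → Plane, IsLeadingError k f r om lam W n E ∧
    IsCorrection om₀ lam₀ (W 0) E (W (n + 1)) (om (n + 1)) (lam (n + 1))

/-- The complex strip `|Im z| < ξ`, which covers the complexified torus `𝕋_ξ`. -/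
def strip (ξ : ℝ) : Set ℂ := {z | |z.im| < ξ}

/-- `G` is the analytic extension of `g : 𝕋 → ℝ²` to the complexified torus `𝕋_ξ`. -/
structure IsStripExtension (ξ : ℝ) (g : ℝ → Plane) (G : ℂ → CPlane) : Prop where
  holomorphic : DifferentiableOn ℂ G (strip ξ)
  periodic : ∀ z ∈ strip ξ, G (z + 1) = G z
  extends_real : ∀ θ : ℝ, G θ = complexify (g θ)

/-- `g : 𝕋 → ℝ²` is analytic in `𝕋_ξ`. -/
def AnalyticOnStrip (ξ : ℝ) (g : ℝ → Plane) : Prop := ∃ G, IsStripExtension ξ g G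

/-- The data are analytic over `𝕋_ξ` (first family of equations): the coefficients `w p` of the
unperturbed parameterization are analytic in `𝕋_ξ`, and `f` and `r` extend analytically to the
points `(0, w₀(z), w₀(z))` and `w₀(z)`, `z ∈ 𝕋_ξ`. -/
def DataAnalyticOnStrip (f : ℝ × Plane × Plane → Plane) (r : Plane → ℝ) (w : ℕ → ℝ → Plane)
    (ξ : ℝ) : Prop :=
  ∃ (w' : ℕ → ℂ → CPlane) (F : ℂ × CPlane × CPlane → CPlane) (R : CPlane → ℂ),
    (∀ p, IsStripExtension ξ (w p) (w' p)) ∧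
    (∀ z ∈ strip ξ, AnalyticAt ℂ F (0, w' 0 z, w' 0 z) ∧ AnalyticAt ℂ R (w' 0 z)) ∧
    (∀ θ : ℝ, ∀ᶠ v : ℝ × Plane × Plane in 𝓝 (0, w 0 θ, w 0 θ),
      F ((v.1 : ℂ), complexify v.2.1, complexify v.2.2) = complexify (f v)) ∧
    (∀ θ : ℝ, ∀ᶠ x in 𝓝 (w 0 θ), R (complexify x) = (r x : ℂ))

/-- Analyticity of the coefficients of the series over complexified tori. For the first family all
of them are analytic in a common `𝕋_ξ`, and in `𝕋_ξ` for every `ξ` such that the data are; for the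
second family the width of the strip may depend on the order in `ε`. -/
def AnalyticCoefficients (k : DelayKind) (f : ℝ × Plane × Plane → Plane) (r : Plane → ℝ)
    (W : ℕ → ℕ → ℝ → Plane) : Prop :=
  match k with
  | .shortDelay =>
      (∃ ξ : ℝ, 0 < ξ ∧ ∀ n p, AnalyticOnStrip ξ (W n p)) ∧
      ∀ ξ : ℝ, 0 < ξ → DataAnalyticOnStrip f r (W 0) ξ → ∀ n p, AnalyticOnStrip ξ (W n p)
  | .weakDelay => ∀ n, ∃ ξ : ℝ, 0 < ξ ∧ ∀ p, AnalyticOnStrip ξ (W n p)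

/-! Solving the invariance equation as formal series in `ε` and `s` means that the error of each
truncation, as a function of `(ε, θ, s)`, has vanishing mixed derivatives `∂_s^p ∂_ε^m` at the
points `(0, θ, 0)`; this is `JetVanishes`. A Taylor formula whose remainder is uniform in the
transversal variables (`taylor_dir_isBigO`) translates between such vanishing and bounds by `|ε|^N +
|s|^P` near each point of the cycle, and periodicity in `θ` makes the bounds uniform
(`exists_uniform_bound_of_isBigO`).

The series is built by induction on the order in `ε`. At `ε = 0` the delay is invisible
(`delayedArg_zero`). Hence order `0` is the invariance equation `(ω₀ ∂_θ + λ₀ s ∂_s) W₀ = X(W₀)` of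
the unperturbed field `X`, and adding the terms of order `n + 1` changes the error by `ε^{n+1}`
times the linearization of this undelayed equation at `W₀`, up to `O(ε^{n+2})`. Differentiating the
invariance equation in `θ` and in `s` shows that `∂_θ W₀` solves the linearized equation and that
`∂_s W₀` does so up to the term `λ₀ ∂_s W₀`. In the frame `DW₀` the linearized operator therefore
has constant coefficients and is diagonal: `ω₀ ∂_θ + λ₀ s ∂_s` on `A₁`, the same minus `λ₀` on `A₂`
(`UnperturbedExpansion.linearized_frame`). The immersion property makes the frame invertible at `s =
0`, so a power series can be divided by `DW₀` order by order (`frameMul_frameInv`). For each power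
`s^p` there remains a scalar equation `ω₀ u' + b u = h` on the circle, with `b = λ₀ p` or `b = λ₀ (p
- 1)`. It is solvable unless `b = 0`, that is `p = 0`, respectively `p = 1`, and there `ω_{n+1}`,
respectively `λ_{n+1}`, absorbs the mean value (`exists_correction`). `SolvesToOrder.succ` closes
the induction.

For analyticity, the scalar equations are solved by averages `∫₀¹ κ(t) h(θ + t) dt` over real
shifts, so the solution is analytic in every strip where `h` is. Division by `DW₀` costs nothing
either: its determinant on the cycle satisfies a scalar linear differential equation, which persists
in the complex strip by the identity theorem, so it has no zero there
(`extendsToStrip_inv_frameDet`). The only possible loss comes from the error, whose jet at `ε = 0`,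
`s = 0` involves the previous coefficients at `z - σ ω₀ r(W₀(z))`, with `σ = 0` in the first family
and `σ = 1` in the second (`analyticAt_complexError`). In the first family nothing is shifted and
the full strip is kept. In the second the shift is complex off the real line, and the strip is
narrowed at each order in `ε` (`ComplexData.exists_shift`), but equally for all `p`, since the shift
does not depend on `p`. The complex extensions of real-analytic data are glued from power series on
balls (`exists_complex_extension`). -/

/-- The derivative of `g` in the direction `e`. -/
noncomputable def dirDeriv (𝕜 : Type*) {X E : Type*} [NontriviallyNormedField 𝕜]
    [NormedAddCommGroup X] [NormedSpace 𝕜 X] [NormedAddCommGroup E] [NormedSpace 𝕜 E]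
    (e : X) (g : X → E) : X → E := fun v => fderiv 𝕜 g v e

/-! ### Taylor expansion and order of vanishing in one direction. -/

section DirDeriv

variable {X E : Type*} [NormedAddCommGroup X] [NormedSpace ℝ X] [NormedAddCommGroup E]
  [NormedSpace ℝ E]

theorem ContDiffAt.dirDeriv {n m : ℕ∞ω} {g : X → E} {v : X} (hg : ContDiffAt ℝ n g v) (e : X)
    (hmn : m + 1 ≤ n) : ContDiffAt ℝ m (dirDeriv ℝ e g) v :=
  (hg.fderiv_right hmn).clm_apply contDiffAt_const

theorem ContDiffAt.dirDeriv_infty {g : X → E} {v : X} (hg : ContDiffAt ℝ ∞ g v) (e : X) :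
    ContDiffAt ℝ ∞ (_root_.dirDeriv ℝ e g) v :=
  hg.dirDeriv e (by simp)

theorem ContDiffAt.iterate_dirDeriv_infty {g : X → E} {v : X} (hg : ContDiffAt ℝ ∞ g v) (e : X)
    (m : ℕ) : ContDiffAt ℝ ∞ ((_root_.dirDeriv ℝ e)^[m] g) v := by
  induction m generalizing g with
  | zero => exact hg
  | succ m ih => exact ih (hg.dirDeriv_infty e)

theorem Filter.EventuallyEq.dirDeriv {g h : X → E} {v : X} (hgh : g =ᶠ[𝓝 v] h) (e : X) :
    _root_.dirDeriv ℝ e g =ᶠ[𝓝 v] _root_.dirDeriv ℝ e h := by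
  filter_upwards [hgh.fderiv (𝕜 := ℝ)] with w hw
  simp [_root_.dirDeriv, hw]

theorem Filter.EventuallyEq.iterate_dirDeriv {g h : X → E} {v : X} (hgh : g =ᶠ[𝓝 v] h) (e : X)
    (m : ℕ) : (_root_.dirDeriv ℝ e)^[m] g =ᶠ[𝓝 v] (_root_.dirDeriv ℝ e)^[m] h := by
  induction m generalizing g h with
  | zero => exact hgh
  | succ m ih => exact ih (hgh.dirDeriv e)

/-- Symmetry of the second derivative, stated as an equality of germs so that it can be
differentiated again and iterated. -/
theorem dirDeriv_comm {g : X → E} {v : X} (hg : ContDiffAt ℝ ∞ g v) (a b : X) :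
    dirDeriv ℝ a (dirDeriv ℝ b g) =ᶠ[𝓝 v] dirDeriv ℝ b (dirDeriv ℝ a g) := by
  have h2 : ContDiffAt ℝ 2 g v := by
    simpa using contDiffAt_infty.1 hg 2
  filter_upwards [h2.eventually (by simp)] with w hw
  have hs : IsSymmSndFDerivAt ℝ g w := hw.isSymmSndFDerivAt (by simp)
  have hd : DifferentiableAt ℝ (fderiv ℝ g) w :=
    (hw.fderiv_right (m := 1) (by norm_num)).differentiableAt (by simp)
  have key : ∀ a b : X, dirDeriv ℝ a (dirDeriv ℝ b g) w = fderiv ℝ (fderiv ℝ g) w a b := by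
    intro a b
    unfold dirDeriv
    rw [fderiv_clm_apply hd (differentiableAt_const b)]
    simp
  rw [key, key, hs.eq]

theorem iterate_dirDeriv_comm {g : X → E} {v : X} (hg : ContDiffAt ℝ ∞ g v) (a b : X) (m : ℕ) :
    (dirDeriv ℝ a)^[m] (dirDeriv ℝ b g) =ᶠ[𝓝 v] dirDeriv ℝ b ((dirDeriv ℝ a)^[m] g) := by
  induction m generalizing g with
  | zero => rfl
  | succ m ih =>
    exact ((dirDeriv_comm hg a b).iterate_dirDeriv a m).trans (ih (hg.dirDeriv_infty a))

theorem iterate_dirDeriv_comm_iterate {g : X → E} {v : X} (hg : ContDiffAt ℝ ∞ g v) (a b : X)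
    (m p : ℕ) :
    (dirDeriv ℝ a)^[m] ((dirDeriv ℝ b)^[p] g) =ᶠ[𝓝 v]
      (dirDeriv ℝ b)^[p] ((dirDeriv ℝ a)^[m] g) := by
  induction p generalizing g with
  | zero => rfl
  | succ p ih =>
    exact (ih (hg.dirDeriv_infty b)).trans
      ((iterate_dirDeriv_comm hg a b m).iterate_dirDeriv b p)

/-- Taylor expansion in one direction, with a remainder that is locally uniform in the other
variables. -/
theorem taylor_dir_isBigO (l : X →L[ℝ] ℝ) {e : X} (he : l e = 1) {v₀ : X} (hv₀ : l v₀ = 0)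
    (N : ℕ) {g : X → E} (hg : ContDiffAt ℝ N g v₀) :
    (fun v => g v - ∑ m ∈ Finset.range N,
      ((l v) ^ m / (m.factorial : ℝ)) • (dirDeriv ℝ e)^[m] g (v - l v • e)) =O[𝓝 v₀]
      fun v => (l v) ^ N := by
  induction N generalizing g with
  | zero =>
    simpa using hg.continuousAt.norm.isBoundedUnder_le.isBigO_one ℝ
  | succ N ih =>
    have hg' : ContDiffAt ℝ N (dirDeriv ℝ e g) v₀ := hg.dirDeriv e (by simp)
    obtain ⟨C, hC⟩ := (ih hg').bound
    have hd : ∀ᶠ v in 𝓝 v₀, DifferentiableAt ℝ g v := by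
      have h1 : ContDiffAt ℝ 1 g v₀ := hg.of_le (by exact_mod_cast Nat.le_add_left 1 N)
      filter_upwards [h1.eventually (by simp)] with w hw
      exact hw.differentiableAt (by simp)
    -- At `v₀` the segment from the projection `v - l v • e` to `v` is reduced to the point `v₀`, so
    -- by compactness of `[0, 1]` whatever holds near `v₀` holds along the whole segment for `v`
    -- near `v₀`.
    have hseg : ∀ᶠ v in 𝓝 v₀, ∀ t ∈ Set.Icc (0 : ℝ) 1,
        DifferentiableAt ℝ g (v - l v • e + (t * l v) • e) ∧
        ‖(fun v => dirDeriv ℝ e g v - ∑ m ∈ Finset.range N,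
          ((l v) ^ m / (m.factorial : ℝ)) • (dirDeriv ℝ e)^[m] (dirDeriv ℝ e g) (v - l v • e))
          (v - l v • e + (t * l v) • e)‖ ≤ C * ‖l (v - l v • e + (t * l v) • e) ^ N‖ := by
      refine isCompact_Icc.eventually_forall_of_forall_eventually fun t _ => ?_
      have hcont : Tendsto (fun z : X × ℝ => z.1 - l z.1 • e + (z.2 * l z.1) • e) (𝓝 (v₀, t))
          (𝓝 v₀) := by
        have : Continuous (fun z : X × ℝ => z.1 - l z.1 • e + (z.2 * l z.1) • e) := by fun_prop
        simpa [hv₀] using this.tendsto (v₀, t)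
      exact hcont.eventually (hd.and hC)
    refine Asymptotics.IsBigO.of_bound |C| ?_
    filter_upwards [hseg] with v hv
    set p := v - l v • e with hp
    set x := l v with hx
    have hlp : l p = 0 := by simp [hp, he, hx]
    have hl : ∀ t : ℝ, l (p + (t * x) • e) = t * x := by intro t; simp [hlp, he]
    -- The remainder along the segment. Its derivative is `x` times the remainder of order `N` of
    -- `dirDeriv ℝ e g`, which the induction hypothesis bounds; the mean value inequality then gains
    -- one power of `x`.
    let φ : ℝ → E := fun t => g (p + (t * x) • e) - ∑ m ∈ Finset.range (N + 1),
      ((t * x) ^ m / (m.factorial : ℝ)) • (dirDeriv ℝ e)^[m] g p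
    let φ' : ℝ → E := fun t => x • (dirDeriv ℝ e g (p + (t * x) • e) - ∑ m ∈ Finset.range N,
      ((t * x) ^ m / (m.factorial : ℝ)) • (dirDeriv ℝ e)^[m] (dirDeriv ℝ e g) p)
    have hφ : ∀ t ∈ Set.Icc (0 : ℝ) 1, HasDerivAt φ (φ' t) t := by
      intro t ht
      have h1 : HasDerivAt (fun t : ℝ => p + (t * x) • e) (x • e) t := by
        have := ((hasDerivAt_id t).mul_const x).smul_const e
        simpa using this.const_add p
      have h2 : HasDerivAt (fun t : ℝ => g (p + (t * x) • e))
          (x • dirDeriv ℝ e g (p + (t * x) • e)) t := by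
        have := (hv t ht).1.hasFDerivAt.comp_hasDerivAt t h1
        simpa [dirDeriv, Function.comp_def] using this
      have h3 : ∀ m : ℕ, HasDerivAt
          (fun t : ℝ => ((t * x) ^ (m + 1) / ((m + 1).factorial : ℝ)) •
            (dirDeriv ℝ e)^[m + 1] g p)
          (x • ((t * x) ^ m / (m.factorial : ℝ)) • (dirDeriv ℝ e)^[m] (dirDeriv ℝ e g) p) t := by
        intro m
        have := ((((hasDerivAt_id t).mul_const x).pow (m + 1)).div_const
          ((m + 1).factorial : ℝ)).smul_const ((dirDeriv ℝ e)^[m + 1] g p)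
        refine this.congr_deriv ?_
        rw [smul_smul, Function.iterate_succ_apply]
        congr 1
        have : ((m.factorial : ℝ)) ≠ 0 := by positivity
        rw [Nat.factorial_succ]
        push_cast
        simp only [id, one_mul]
        field_simp
      have h4 := HasDerivAt.fun_sum (u := Finset.range N) fun m _ => h3 m
      refine (h2.sub (h4.add_const (((1 : ℝ) / (Nat.factorial 0 : ℝ)) • g p))).congr_deriv ?_
        |>.congr_of_eventuallyEq ?_
      · simp [φ', smul_sub, Finset.smul_sum]
      · refine Eventually.of_forall fun t => ?_
        simp [φ, Finset.sum_range_succ']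
    have hbound : ∀ t ∈ Set.Ico (0 : ℝ) 1, ‖φ' t‖ ≤ |C| * ‖x ^ (N + 1)‖ := by
      intro t ht
      have h := (hv t ⟨ht.1, ht.2.le⟩).2
      have hpp : p + (t * x) • e - (t * x) • e = p := by abel
      simp only [hl, hpp] at h
      rw [norm_smul]
      calc ‖x‖ * _ ≤ ‖x‖ * (C * ‖(t * x) ^ N‖) := by gcongr
        _ ≤ ‖x‖ * (|C| * ‖x ^ N‖) := by
          gcongr ‖x‖ * ?_
          refine mul_le_mul (le_abs_self C) ?_ (norm_nonneg _) (abs_nonneg C)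
          rw [norm_pow, norm_pow, norm_mul]
          refine pow_le_pow_left₀ (by positivity) ?_ N
          refine mul_le_of_le_one_left (norm_nonneg x) ?_
          rw [Real.norm_of_nonneg ht.1]; exact ht.2.le
        _ = |C| * ‖x ^ (N + 1)‖ := by rw [norm_pow, norm_pow, pow_succ]; ring
    have := norm_image_sub_le_of_norm_deriv_le_segment_01'
      (fun t ht => (hφ t ht).hasDerivWithinAt) hbound
    have h0 : φ 0 = 0 := by simp [φ, Finset.sum_range_succ']
    have h1 : φ 1 = g v - ∑ m ∈ Finset.range (N + 1),
        (x ^ m / (m.factorial : ℝ)) • (dirDeriv ℝ e)^[m] g p := by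
      simp [φ, hp]
    rwa [h0, sub_zero, h1] at this

/-- A function of order `l ^ N` has vanishing derivatives of order below `N` on `l = 0`. -/
theorem iterate_dirDeriv_eq_zero_of_isBigO (l : X →L[ℝ] ℝ) {e : X} (he : l e = 1) {v₀ : X}
    (hv₀ : l v₀ = 0) {N : ℕ} {g : X → E} (hg : ContDiffAt ℝ N g v₀)
    (hO : g =O[𝓝 v₀] fun v => (l v) ^ N) {m : ℕ} (hm : m < N) :
    (dirDeriv ℝ e)^[m] g v₀ = 0 := by
  induction m using Nat.strong_induction_on with
  | _ m ih =>
    -- On the line `v₀ + x • e` the Taylor terms below `m` vanish by induction, so the term of order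
    -- `m` is the difference of two functions of order `x ^ (m + 1)`; dividing by `x ^ m` and
    -- letting `x → 0` shows that its coefficient is zero.
    have ht := taylor_dir_isBigO l he hv₀ (m + 1) (hg.of_le (by exact_mod_cast hm))
    have hline : Tendsto (fun x : ℝ => v₀ + x • e) (𝓝[≠] 0) (𝓝 v₀) := by
      have : Continuous (fun x : ℝ => v₀ + x • e) := by fun_prop
      have := this.tendsto 0
      simp only [zero_smul, add_zero] at this
      exact this.mono_left nhdsWithin_le_nhds
    have h1 := ht.comp_tendsto hline
    have h2 := hO.comp_tendsto hline
    have hl : ∀ x : ℝ, l (v₀ + x • e) = x := by intro x; simp [hv₀, he]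
    simp only [Function.comp_def, hl, add_sub_cancel_right] at h1 h2
    have h3 : (fun x : ℝ => x ^ N) =O[𝓝[≠] 0] fun x : ℝ => x ^ (m + 1) := by
      refine Asymptotics.IsBigO.of_bound 1 ?_
      filter_upwards [mem_nhdsWithin_of_mem_nhds (Metric.ball_mem_nhds (0 : ℝ) one_pos)] with x hx
      rw [one_mul, norm_pow, norm_pow]
      exact pow_le_pow_of_le_one (norm_nonneg x) (mem_ball_zero_iff.1 hx).le hm
    have h4 := (h2.trans h3).sub h1
    have h5 : (fun x : ℝ => x ^ m • ((dirDeriv ℝ e)^[m] g v₀)) =O[𝓝[≠] 0]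
        fun x : ℝ => x ^ m • x := by
      refine (h4.const_smul_left (m.factorial : ℝ)).congr ?_ ?_
      · intro x
        rw [Pi.smul_apply, Finset.sum_range_succ, Finset.sum_eq_zero]
        · rw [zero_add, sub_sub_cancel, smul_smul]
          congr 1
          field_simp
        · intro j hj
          rw [ih j (Finset.mem_range.1 hj) ((Finset.mem_range.1 hj).trans hm), smul_zero]
      · intro x; simp [pow_succ]
    have h6 : (fun _ : ℝ => (dirDeriv ℝ e)^[m] g v₀) =O[𝓝[≠] 0] fun x : ℝ => x := by
      obtain ⟨C, hC⟩ := h5.bound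
      refine Asymptotics.IsBigO.of_bound C ?_
      filter_upwards [hC, self_mem_nhdsWithin] with x hx hx0
      rw [norm_smul, norm_smul] at hx
      have : 0 < ‖x ^ m‖ := norm_pos_iff.2 (pow_ne_zero _ hx0)
      nlinarith
    have h7 : Tendsto (fun _ : ℝ => (dirDeriv ℝ e)^[m] g v₀) (𝓝[≠] 0) (𝓝 0) :=
      h6.trans_tendsto (tendsto_id.mono_left nhdsWithin_le_nhds)
    exact tendsto_nhds_unique tendsto_const_nhds h7

/-- A bound by `l ^ N` near `v₀` is also one near every neighbouring point, with the same constant,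
so the pointwise statement applies at each nearby zero of `l`. -/
theorem eventually_iterate_dirDeriv_eq_zero (l : X →L[ℝ] ℝ) {e : X} (he : l e = 1) {v₀ : X}
    {N : ℕ} {g : X → E} (hg : ContDiffAt ℝ ∞ g v₀)
    (hO : g =O[𝓝 v₀] fun v => (l v) ^ N) {m : ℕ} (hm : m < N) :
    ∀ᶠ v in 𝓝 v₀, l v = 0 → (dirDeriv ℝ e)^[m] g v = 0 := by
  have hN : ContDiffAt ℝ N g v₀ := hg.of_le (by exact_mod_cast le_top)
  obtain ⟨C, hC⟩ := hO.bound
  filter_upwards [hN.eventually (by simp), hC.eventually_nhds] with v hv hCv hlv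
  exact iterate_dirDeriv_eq_zero_of_isBigO l he hlv hv (Asymptotics.IsBigO.of_bound C hCv) hm

theorem eventually_dirDeriv_eq_zero (l : X →L[ℝ] ℝ) {a : X} (ha : l a = 0) {v₀ : X} {g : X → E}
    (hg : ∀ᶠ v in 𝓝 v₀, l v = 0 → g v = 0) :
    ∀ᶠ v in 𝓝 v₀, l v = 0 → dirDeriv ℝ a g v = 0 := by
  filter_upwards [hg.eventually_nhds] with v hv hlv
  by_cases hd : DifferentiableAt ℝ g v
  · have h1 : HasDerivAt (fun t : ℝ => v + t • a) a 0 := by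
      simpa using ((hasDerivAt_id (0 : ℝ)).smul_const a).const_add v
    have h2 : HasDerivAt (fun t : ℝ => g (v + t • a)) (dirDeriv ℝ a g v) 0 := by
      have hd' : HasFDerivAt g (fderiv ℝ g v) (v + (0 : ℝ) • a) := by simpa using hd.hasFDerivAt
      exact hd'.comp_hasDerivAt (0 : ℝ) h1
    have h3 : (fun t : ℝ => g (v + t • a)) =ᶠ[𝓝 0] fun _ => 0 := by
      have : Tendsto (fun t : ℝ => v + t • a) (𝓝 0) (𝓝 v) := by
        simpa using h1.continuousAt.tendsto
      filter_upwards [this.eventually hv] with t ht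
      exact ht (by simp [hlv, ha])
    exact h2.unique ((hasDerivAt_const (0 : ℝ) (0 : E)).congr_of_eventuallyEq h3)
  -- Where `g` is not differentiable, `fderiv` has the default value `0`; hence no smoothness is
  -- needed.
  · simp [dirDeriv, fderiv_zero_of_not_differentiableAt hd]

theorem eventually_iterate_dirDeriv_eq_zero_of_ker (l : X →L[ℝ] ℝ) {a : X} (ha : l a = 0) {v₀ : X}
    {g : X → E} (hg : ∀ᶠ v in 𝓝 v₀, l v = 0 → g v = 0) (m : ℕ) :
    ∀ᶠ v in 𝓝 v₀, l v = 0 → (dirDeriv ℝ a)^[m] g v = 0 := by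
  induction m generalizing g with
  | zero => exact hg
  | succ m ih => exact ih (eventually_dirDeriv_eq_zero l ha hg)

theorem tendsto_ker_proj (l : X →L[ℝ] ℝ) (e : X) {v₀ : X} (hv₀ : l v₀ = 0) :
    Tendsto (fun v => v - l v • e) (𝓝 v₀) (𝓝 v₀) := by
  have : Continuous (fun v => v - l v • e) := by fun_prop
  simpa [hv₀] using this.tendsto v₀

/-- All Taylor coefficients below `N` vanish on `l = 0`, so only the remainder is left. With the
converse above, this characterizes the order in `l` by derivatives, which is what allows estimates
to be differentiated. -/
theorem isBigO_of_iterate_dirDeriv_eq_zero (l : X →L[ℝ] ℝ) {e : X} (he : l e = 1) {v₀ : X}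
    (hv₀ : l v₀ = 0) {N : ℕ} {g : X → E} (hg : ContDiffAt ℝ ∞ g v₀)
    (h : ∀ m < N, ∀ᶠ v in 𝓝 v₀, l v = 0 → (dirDeriv ℝ e)^[m] g v = 0) :
    g =O[𝓝 v₀] fun v => (l v) ^ N := by
  refine (taylor_dir_isBigO l he hv₀ N (hg.of_le (by exact_mod_cast le_top))).congr' ?_ .rfl
  have h' : ∀ᶠ v in 𝓝 v₀, ∀ m ∈ Finset.range N, l v = 0 → (dirDeriv ℝ e)^[m] g v = 0 := by
    rw [Finset.eventually_all]
    exact fun m hm => h m (Finset.mem_range.1 hm)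
  filter_upwards [(tendsto_ker_proj l e hv₀).eventually h'] with v hv
  rw [Finset.sum_eq_zero, sub_zero]
  intro m hm
  rw [hv m hm (by simp [he]), smul_zero]

/-- Differentiation along `l = const` preserves the order in `l`. -/
theorem isBigO_dirDeriv (l : X →L[ℝ] ℝ) {e a : X} (he : l e = 1) (ha : l a = 0) {v₀ : X}
    (hv₀ : l v₀ = 0) {N : ℕ} {g : X → E} (hg : ContDiffAt ℝ ∞ g v₀)
    (hO : g =O[𝓝 v₀] fun v => (l v) ^ N) :
    dirDeriv ℝ a g =O[𝓝 v₀] fun v => (l v) ^ N := by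
  refine isBigO_of_iterate_dirDeriv_eq_zero l he hv₀ (hg.dirDeriv_infty a) fun m hm => ?_
  filter_upwards [iterate_dirDeriv_comm hg e a m, eventually_dirDeriv_eq_zero l ha
    (eventually_iterate_dirDeriv_eq_zero l he hg hO hm)] with v hv hv' hlv
  rw [hv, hv' hlv]

/-- Differentiation across `l = const` lowers the order in `l` by one. -/
theorem isBigO_dirDeriv_transversal (l : X →L[ℝ] ℝ) {e : X} (he : l e = 1) {v₀ : X}
    (hv₀ : l v₀ = 0) {N : ℕ} {g : X → E} (hg : ContDiffAt ℝ ∞ g v₀)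
    (hO : g =O[𝓝 v₀] fun v => (l v) ^ (N + 1)) :
    dirDeriv ℝ e g =O[𝓝 v₀] fun v => (l v) ^ N :=
  isBigO_of_iterate_dirDeriv_eq_zero l he hv₀ (hg.dirDeriv_infty e) fun m hm =>
    eventually_iterate_dirDeriv_eq_zero l he (m := m + 1) hg hO (by omega)

end DirDeriv

/-- A function of class `C¹` at `y` is Lipschitz there, in asymptotic form. -/
theorem ContDiffAt.comp_sub_comp_isBigO {ι Y Z : Type*} [NormedAddCommGroup Y] [NormedSpace ℝ Y]
    [NormedAddCommGroup Z] [NormedSpace ℝ Z] {F : Y → Z} {y : Y} {n : ℕ∞ω}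
    (hF : ContDiffAt ℝ n F y) (hn : 1 ≤ n)
    {fl : Filter ι} {a b : ι → Y} (ha : Tendsto a fl (𝓝 y)) (hb : Tendsto b fl (𝓝 y)) :
    (fun i => F (a i) - F (b i)) =O[fl] fun i => a i - b i := by
  have hF1 : ContDiffAt ℝ 1 F y := hF.of_le hn
  have := (hF1.hasStrictFDerivAt (by simp)).isBigO_sub
  exact this.comp_tendsto (ha.prodMk_nhds hb)

/-! ### Jets in `(ε, s)` along the cycle. -/

section Jets

variable {E : Type*} [NormedAddCommGroup E] [NormedSpace ℝ E]

section General

variable {X : Type*} [NormedAddCommGroup X] [NormedSpace ℝ X]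

theorem dirDeriv_eq_of_hasDerivAt {g : X → E} {v e : X} {d : E} (hg : DifferentiableAt ℝ g v)
    (hd : HasDerivAt (fun t : ℝ => g (v + t • e)) d 0) : dirDeriv ℝ e g v = d := by
  have h1 : HasDerivAt (fun t : ℝ => v + t • e) e 0 := by
    simpa using ((hasDerivAt_id (0 : ℝ)).smul_const e).const_add v
  have hg' : HasFDerivAt g (fderiv ℝ g v) (v + (0 : ℝ) • e) := by simpa using hg.hasFDerivAt
  exact (hg'.comp_hasDerivAt (0 : ℝ) h1).unique hd

theorem iterate_dirDeriv_add {g h : X → E} {v : X} (hg : ContDiffAt ℝ ∞ g v)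
    (hh : ContDiffAt ℝ ∞ h v) (e : X) (m : ℕ) :
    (dirDeriv ℝ e)^[m] (g + h) =ᶠ[𝓝 v] (dirDeriv ℝ e)^[m] g + (dirDeriv ℝ e)^[m] h := by
  induction m generalizing g h with
  | zero => rfl
  | succ m ih =>
    refine EventuallyEq.trans ?_ (ih (hg.dirDeriv_infty e) (hh.dirDeriv_infty e))
    refine EventuallyEq.iterate_dirDeriv ?_ e m
    have h1 : ContDiffAt ℝ 1 g v := by simpa using contDiffAt_infty.1 hg 1
    have h2 : ContDiffAt ℝ 1 h v := by simpa using contDiffAt_infty.1 hh 1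
    filter_upwards [h1.eventually (by simp), h2.eventually (by simp)] with w hw hw'
    have := fderiv_add (hw.differentiableAt (by simp)) (hw'.differentiableAt (by simp))
    simp [dirDeriv, this]

theorem iterate_dirDeriv_neg (g : X → E) (e : X) (m : ℕ) :
    (dirDeriv ℝ e)^[m] (-g) = -(dirDeriv ℝ e)^[m] g := by
  induction m generalizing g with
  | zero => rfl
  | succ m ih =>
    rw [Function.iterate_succ_apply, Function.iterate_succ_apply, ← ih]
    congr 1
    ext w
    simp [dirDeriv, fderiv_neg]

end General

/-- The mixed derivative `∂_s^p ∂_ε^m g` of a function of `(ε, θ, s)`. -/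
noncomputable def jetDeriv (𝕜 : Type*) {E : Type*} [NontriviallyNormedField 𝕜]
    [NormedAddCommGroup E] [NormedSpace 𝕜 E] (m p : ℕ) (g : 𝕜 × 𝕜 × 𝕜 → E) : 𝕜 × 𝕜 × 𝕜 → E :=
  (dirDeriv 𝕜 (0, 0, 1))^[p] ((dirDeriv 𝕜 (1, 0, 0))^[m] g)

/-- Smoothness at the points `(0, θ, 0)`. -/
def SmoothAtCycle (g : ℝ × ℝ × ℝ → E) : Prop := ∀ θ, ContDiffAt ℝ ∞ g (0, θ, 0)

/-- The coefficients of `ε^m s^p`, `m < N`, `p < P`, in the expansion of `g` vanish. -/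
def JetVanishes (N P : ℕ) (g : ℝ × ℝ × ℝ → E) : Prop :=
  ∀ m < N, ∀ p < P, ∀ θ, jetDeriv ℝ m p g (0, θ, 0) = 0

/-- The coefficient of `ε^m s^p` in the expansion of `g`. -/
noncomputable def jetCoeff (m p : ℕ) (g : ℝ × ℝ × ℝ → E) (θ : ℝ) : E :=
  ((m.factorial : ℝ) * p.factorial)⁻¹ • jetDeriv ℝ m p g (0, θ, 0)

/-- The coordinate `ε`. -/
noncomputable def epsCoord : ℝ × ℝ × ℝ →L[ℝ] ℝ := ContinuousLinearMap.fst ℝ ℝ (ℝ × ℝ)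

/-- The coordinate `s`. -/
noncomputable def sCoord : ℝ × ℝ × ℝ →L[ℝ] ℝ :=
  (ContinuousLinearMap.snd ℝ ℝ ℝ).comp (ContinuousLinearMap.snd ℝ ℝ (ℝ × ℝ))

@[simp] theorem epsCoord_apply (v : ℝ × ℝ × ℝ) : epsCoord v = v.1 := rfl

@[simp] theorem sCoord_apply (v : ℝ × ℝ × ℝ) : sCoord v = v.2.2 := rfl

theorem SmoothAtCycle.jetDeriv {g : ℝ × ℝ × ℝ → E} (hg : SmoothAtCycle g) (m p : ℕ) :
    SmoothAtCycle (jetDeriv ℝ m p g) := fun θ =>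
  ((hg θ).iterate_dirDeriv_infty _ m).iterate_dirDeriv_infty _ p

theorem SmoothAtCycle.dirDeriv {g : ℝ × ℝ × ℝ → E} (hg : SmoothAtCycle g) (e : ℝ × ℝ × ℝ) :
    SmoothAtCycle (dirDeriv ℝ e g) := fun θ => (hg θ).dirDeriv_infty e

theorem SmoothAtCycle.add {g h : ℝ × ℝ × ℝ → E} (hg : SmoothAtCycle g) (hh : SmoothAtCycle h) :
    SmoothAtCycle (g + h) := fun θ => (hg θ).add (hh θ)

theorem SmoothAtCycle.neg {g : ℝ × ℝ × ℝ → E} (hg : SmoothAtCycle g) :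
    SmoothAtCycle (-g) := fun θ => (hg θ).neg

theorem SmoothAtCycle.sub {g h : ℝ × ℝ × ℝ → E} (hg : SmoothAtCycle g) (hh : SmoothAtCycle h) :
    SmoothAtCycle (g - h) := fun θ => (hg θ).sub (hh θ)

theorem ContDiff.smoothAtCycle {g : ℝ × ℝ × ℝ → E} (hg : ContDiff ℝ ∞ g) : SmoothAtCycle g :=
  fun _ => hg.contDiffAt

theorem SmoothAtCycle.contDiff_jetCoeff {g : ℝ × ℝ × ℝ → E} (hg : SmoothAtCycle g) (m p : ℕ) :
    ContDiff ℝ ∞ (jetCoeff m p g) := by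
  rw [contDiff_iff_contDiffAt]
  intro θ
  exact contDiffAt_const.smul ((hg.jetDeriv m p θ).comp θ
    (contDiffAt_const.prodMk (contDiffAt_id.prodMk contDiffAt_const)))

theorem jetDeriv_add {g h : ℝ × ℝ × ℝ → E} (hg : SmoothAtCycle g) (hh : SmoothAtCycle h)
    (m p : ℕ) (θ : ℝ) :
    jetDeriv ℝ m p (g + h) (0, θ, 0) = jetDeriv ℝ m p g (0, θ, 0) + jetDeriv ℝ m p h (0, θ, 0) := by
  have h1 := (iterate_dirDeriv_add (hg θ) (hh θ) (1, 0, 0) m).iterate_dirDeriv (0, 0, 1) p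
  have h2 := iterate_dirDeriv_add ((hg θ).iterate_dirDeriv_infty (1, 0, 0) m)
    ((hh θ).iterate_dirDeriv_infty (1, 0, 0) m) (0, 0, 1) p
  exact (h1.trans h2).eq_of_nhds

theorem jetDeriv_neg (g : ℝ × ℝ × ℝ → E) (m p : ℕ) : jetDeriv ℝ m p (-g) = -jetDeriv ℝ m p g := by
  simp [jetDeriv, iterate_dirDeriv_neg]

theorem jetDeriv_sub {g h : ℝ × ℝ × ℝ → E} (hg : SmoothAtCycle g) (hh : SmoothAtCycle h)
    (m p : ℕ) (θ : ℝ) :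
    jetDeriv ℝ m p (g - h) (0, θ, 0) = jetDeriv ℝ m p g (0, θ, 0) - jetDeriv ℝ m p h (0, θ, 0) := by
  rw [sub_eq_add_neg, jetDeriv_add hg hh.neg, jetDeriv_neg, sub_eq_add_neg]
  rfl

theorem JetVanishes.add {g h : ℝ × ℝ × ℝ → E} (hg : SmoothAtCycle g) (hh : SmoothAtCycle h)
    {N P : ℕ} (h1 : JetVanishes N P g) (h2 : JetVanishes N P h) : JetVanishes N P (g + h) :=
  fun m hm p hp θ => by rw [jetDeriv_add hg hh, h1 m hm p hp, h2 m hm p hp, add_zero]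

/-- The derivatives `∂_ε^m`, `m < N`, vanish at all nearby points of the hyperplane `ε = 0`; as
`∂_s` is tangent to it, they still vanish after differentiation in `s`, any number of times. -/
theorem JetVanishes.of_isBigO_eps {g : ℝ × ℝ × ℝ → E} (hg : SmoothAtCycle g) {N : ℕ} (P : ℕ)
    (hO : ∀ θ : ℝ, g =O[𝓝 (0, θ, 0)] fun v => v.1 ^ N) : JetVanishes N P g := fun _ hm p _ θ =>
  (eventually_iterate_dirDeriv_eq_zero_of_ker epsCoord (a := (0, 0, 1)) rfl
    (eventually_iterate_dirDeriv_eq_zero epsCoord (e := (1, 0, 0)) rfl (hg θ) (hO θ) hm)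
    p).self_of_nhds rfl

/-- The same argument on the hyperplane `s = 0`, after exchanging the order of differentiation. -/
theorem JetVanishes.of_isBigO_s {g : ℝ × ℝ × ℝ → E} (hg : SmoothAtCycle g) (N : ℕ) {P : ℕ}
    (hO : ∀ θ : ℝ, g =O[𝓝 (0, θ, 0)] fun v => v.2.2 ^ P) : JetVanishes N P g := by
  intro m _ p hp θ
  rw [jetDeriv, (iterate_dirDeriv_comm_iterate (hg θ) (0, 0, 1) (1, 0, 0) p m).eq_of_nhds]
  exact (eventually_iterate_dirDeriv_eq_zero_of_ker sCoord (a := (1, 0, 0)) rfl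
    (eventually_iterate_dirDeriv_eq_zero sCoord (e := (0, 0, 1)) rfl (hg θ) (hO θ) hp)
    m).self_of_nhds rfl

/-- Expand in `ε` first: the remainder is `O(ε^N)`. Each coefficient lives on `ε = 0`, and its
expansion in `s` up to order `P` consists of jets that vanish, so it is `O(s^P)`. -/
theorem JetVanishes.isBigO {g : ℝ × ℝ × ℝ → E} (hg : SmoothAtCycle g) {N P : ℕ}
    (h : JetVanishes N P g) (θ : ℝ) :
    g =O[𝓝 (0, θ, 0)] fun v => |v.1| ^ N + |v.2.2| ^ P := by
  have hle1 : (fun v : ℝ × ℝ × ℝ => v.1 ^ N) =O[𝓝 (0, θ, 0)] fun v => |v.1| ^ N + |v.2.2| ^ P := by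
    refine Asymptotics.IsBigO.of_bound 1 (Eventually.of_forall fun v => ?_)
    rw [one_mul, Real.norm_eq_abs, Real.norm_eq_abs, abs_pow]
    exact (le_add_of_nonneg_right (by positivity)).trans (le_abs_self _)
  have hle2 : (fun v : ℝ × ℝ × ℝ => v.2.2 ^ P) =O[𝓝 (0, θ, 0)]
      fun v => |v.1| ^ N + |v.2.2| ^ P := by
    refine Asymptotics.IsBigO.of_bound 1 (Eventually.of_forall fun v => ?_)
    rw [one_mul, Real.norm_eq_abs, Real.norm_eq_abs, abs_pow]
    exact (le_add_of_nonneg_left (by positivity)).trans (le_abs_self _)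
  have h1 := taylor_dir_isBigO epsCoord (e := (1, 0, 0)) rfl (v₀ := (0, θ, 0)) rfl N
    (contDiffAt_infty.1 (hg θ) N)
  have h2 : (fun v : ℝ × ℝ × ℝ => ∑ m ∈ Finset.range N, ((epsCoord v) ^ m / (m.factorial : ℝ)) •
      (dirDeriv ℝ (1, 0, 0))^[m] g (v - epsCoord v • (1, 0, 0))) =O[𝓝 (0, θ, 0)]
      fun v => v.2.2 ^ P := by
    refine Asymptotics.IsBigO.fun_sum (E' := E) fun m hm => ?_
    have h3 := taylor_dir_isBigO sCoord (e := (0, 0, 1)) rfl (v₀ := (0, θ, 0)) rfl P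
      (contDiffAt_infty.1 ((hg θ).iterate_dirDeriv_infty (1, 0, 0) m) P)
    have h4 := h3.comp_tendsto (tendsto_ker_proj epsCoord (1, 0, 0) (v₀ := (0, θ, 0)) rfl)
    have h5 : (fun v : ℝ × ℝ × ℝ => (dirDeriv ℝ (1, 0, 0))^[m] g (v - epsCoord v • (1, 0, 0)))
        =O[𝓝 (0, θ, 0)] fun v => v.2.2 ^ P := by
      refine h4.congr (fun v => ?_) (fun v => by simp)
      simp only [Function.comp_def]
      rw [Finset.sum_eq_zero, sub_zero]
      intro p hp
      have hv : v - epsCoord v • ((1 : ℝ), (0 : ℝ), (0 : ℝ))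
          - sCoord (v - epsCoord v • ((1 : ℝ), (0 : ℝ), (0 : ℝ))) • ((0 : ℝ), (0 : ℝ), (1 : ℝ))
          = (0, v.2.1, 0) := by
        ext <;> simp
      have := h m (Finset.mem_range.1 hm) p (Finset.mem_range.1 hp) v.2.1
      rw [jetDeriv] at this
      rw [hv, this, smul_zero]
    have h6 : (fun v : ℝ × ℝ × ℝ => (epsCoord v) ^ m / (m.factorial : ℝ)) =O[𝓝 (0, θ, 0)]
        fun _ => (1 : ℝ) := by
      have : Continuous (fun v : ℝ × ℝ × ℝ => (epsCoord v) ^ m / (m.factorial : ℝ)) := by fun_prop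
      exact this.continuousAt.norm.isBoundedUnder_le.isBigO_one ℝ
    simpa using h6.smul h5
  exact ((h1.trans hle1).add (h2.trans hle2)).congr_left fun v => by abel

/-- The truncated subtraction in the exponent is harmless for `m > N`, because the descending
factorial is then `0`. -/
theorem iterate_dirDeriv_eps_pow {k : ℝ × ℝ → E} (hk : Differentiable ℝ k) (N m : ℕ) :
    (dirDeriv ℝ ((1 : ℝ), (0 : ℝ), (0 : ℝ)))^[m] (fun v => v.1 ^ N • k v.2) =
      fun v => ((N.descFactorial m : ℝ) * v.1 ^ (N - m)) • k v.2 := by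
  induction m with
  | zero => simp
  | succ m ih =>
    rw [Function.iterate_succ_apply', ih]
    ext v
    refine dirDeriv_eq_of_hasDerivAt (by fun_prop) ?_
    have h1 : HasDerivAt (fun t : ℝ => v.1 + t) 1 0 := (hasDerivAt_id (0 : ℝ)).const_add v.1
    have h2 := ((h1.pow (N - m)).const_mul (N.descFactorial m : ℝ)).smul_const (k v.2)
    refine (h2.congr_deriv ?_).congr_of_eventuallyEq (Eventually.of_forall fun t => ?_)
    · rw [Nat.descFactorial_succ, Nat.sub_sub]
      push_cast
      simp only [add_zero, mul_one]
      congr 1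
      ring
    · have : v.2 + ((0 : ℝ), (0 : ℝ)) = v.2 := by ext <;> simp
      simp [this]

theorem iterate_dirDeriv_s_sum {a : ℕ → ℝ → E} (ha : ∀ p, Differentiable ℝ (a p)) (P q : ℕ) :
    (dirDeriv ℝ ((0 : ℝ), (0 : ℝ), (1 : ℝ)))^[q]
        (fun v => ∑ p ∈ Finset.range P, v.2.2 ^ p • a p v.2.1) =
      fun v => ∑ p ∈ Finset.range P, ((p.descFactorial q : ℝ) * v.2.2 ^ (p - q)) • a p v.2.1 := by
  induction q with
  | zero => simp
  | succ q ih =>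
    rw [Function.iterate_succ_apply', ih]
    ext v
    refine dirDeriv_eq_of_hasDerivAt ?_ ?_
    · refine DifferentiableAt.fun_sum fun p _ => ?_
      have := ha p
      fun_prop
    have h1 : HasDerivAt (fun t : ℝ => v.2.2 + t) 1 0 := (hasDerivAt_id (0 : ℝ)).const_add v.2.2
    have h2 := HasDerivAt.fun_sum (u := Finset.range P) fun p _ =>
      ((h1.pow (p - q)).const_mul (p.descFactorial q : ℝ)).smul_const (a p v.2.1)
    refine (h2.congr_deriv ?_).congr_of_eventuallyEq (Eventually.of_forall fun t => ?_)
    · refine Finset.sum_congr rfl fun p _ => ?_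
      rw [Nat.descFactorial_succ, Nat.sub_sub]
      push_cast
      simp only [add_zero, mul_one]
      congr 1
      ring
    · simp

theorem smoothAtCycle_monomial {a : ℕ → ℝ → E} (ha : ∀ p, ContDiff ℝ ∞ (a p)) (N P : ℕ) :
    SmoothAtCycle fun v : ℝ × ℝ × ℝ => v.1 ^ N • ∑ p ∈ Finset.range P, v.2.2 ^ p • a p v.2.1 := by
  refine ContDiff.smoothAtCycle (contDiff_fst.pow N |>.smul (ContDiff.sum fun p _ => ?_))
  exact (contDiff_snd.snd.pow p).smul ((ha p).comp contDiff_snd.fst)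

theorem jetDeriv_monomial {a : ℕ → ℝ → E} (ha : ∀ p, ContDiff ℝ ∞ (a p)) (N P : ℕ) (q : ℕ)
    (hq : q < P) (θ : ℝ) :
    jetDeriv ℝ N q (fun v => v.1 ^ N • ∑ p ∈ Finset.range P, v.2.2 ^ p • a p v.2.1) (0, θ, 0) =
      ((N.factorial : ℝ) * q.factorial) • a q θ := by
  have hd : ∀ p, Differentiable ℝ (a p) := fun p => (ha p).differentiable (by simp)
  have hk : Differentiable ℝ
      (fun y : ℝ × ℝ => ∑ p ∈ Finset.range P, y.2 ^ p • a p y.1) := by fun_prop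
  rw [jetDeriv, iterate_dirDeriv_eps_pow hk N N]
  have : (fun v : ℝ × ℝ × ℝ => ((N.descFactorial N : ℝ) * v.1 ^ (N - N)) •
      ∑ p ∈ Finset.range P, v.2.2 ^ p • a p v.2.1) = fun v =>
      ∑ p ∈ Finset.range P, v.2.2 ^ p • (fun p => (N.factorial : ℝ) • a p) p v.2.1 := by
    ext v
    simp [Finset.smul_sum, Nat.descFactorial_self, smul_comm (N.factorial : ℝ)]
  rw [this, iterate_dirDeriv_s_sum (fun p => (hd p).const_smul _) P q]
  simp only
  rw [Finset.sum_eq_single_of_mem q (Finset.mem_range.2 hq)]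
  · simp [Nat.descFactorial_self, smul_smul, mul_comm]
  · intro p _ hpq
    -- Lower powers of `s` are killed by the differentiation, higher ones by the evaluation at `s =
    -- 0`.
    rcases lt_or_gt_of_ne hpq with h | h
    · simp [Nat.descFactorial_eq_zero_iff_lt.2 h]
    · simp [zero_pow (Nat.sub_ne_zero_of_lt h)]

/-- Removing the leading term in `ε`. -/
theorem JetVanishes.sub_leading {g : ℝ × ℝ × ℝ → E} (hg : SmoothAtCycle g) {N P : ℕ}
    (h : JetVanishes N P g) {a : ℕ → ℝ → E} (ha : ∀ p, ContDiff ℝ ∞ (a p))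
    (hga : ∀ p < P, ∀ θ, a p θ = jetCoeff N p g θ) :
    JetVanishes (N + 1) P
      (g - fun v => v.1 ^ N • ∑ p ∈ Finset.range P, v.2.2 ^ p • a p v.2.1) := by
  intro m hm q hq θ
  rw [jetDeriv_sub hg (smoothAtCycle_monomial ha N P)]
  rcases Nat.lt_succ_iff_lt_or_eq.1 hm with hlt | rfl
  · rw [h m hlt q hq, zero_sub, neg_eq_zero]
    refine JetVanishes.of_isBigO_eps (smoothAtCycle_monomial ha N P) P (fun θ => ?_) m hlt q hq θ
    have hc : ContinuousAt
        (fun v : ℝ × ℝ × ℝ => ∑ p ∈ Finset.range P, v.2.2 ^ p • a p v.2.1) (0, θ, 0) := by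
      have : ∀ p, Continuous (a p) := fun p => (ha p).continuous
      fun_prop
    simpa using (Asymptotics.isBigO_refl (fun v : ℝ × ℝ × ℝ => v.1 ^ N) (𝓝 (0, θ, 0))).smul
      (hc.norm.isBoundedUnder_le.isBigO_one ℝ)
  · rw [jetDeriv_monomial ha m P q hq, hga q hq, jetCoeff, smul_smul, mul_inv_cancel₀, one_smul,
      sub_self]
    positivity

/-- Estimates near each point of the cycle, for functions periodic in `θ`, are uniform. -/
theorem exists_uniform_bound_of_isBigO {g : ℝ → ℝ → ℝ → E} {b : ℝ → ℝ → ℝ}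
    (hb : ∀ ε s, 0 ≤ b ε s) (hper : ∀ ε θ s, g ε (θ + 1) s = g ε θ s)
    (hO : ∀ θ : ℝ, (fun v : ℝ × ℝ × ℝ => g v.1 v.2.1 v.2.2) =O[𝓝 (0, θ, 0)]
      fun v => b v.1 v.2.2) :
    ∃ C : ℝ, ∃ η : ℝ, 0 < η ∧ ∀ ε θ s : ℝ, |ε| < η → |s| < η → ‖g ε θ s‖ ≤ C * b ε s := by
  have key : ∃ C : ℝ, ∃ η : ℝ, 0 < η ∧ ∀ θ ∈ Set.Icc (0 : ℝ) 1, ∀ ε s : ℝ, |ε| < η → |s| < η →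
      ‖g ε θ s‖ ≤ C * b ε s := by
    refine isCompact_Icc.induction_on (p := fun S => ∃ C : ℝ, ∃ η : ℝ, 0 < η ∧ ∀ θ ∈ S,
      ∀ ε s : ℝ, |ε| < η → |s| < η → ‖g ε θ s‖ ≤ C * b ε s) ⟨0, 1, one_pos, by simp⟩ ?_ ?_ ?_
    · rintro S T hST ⟨C, η, hη, h⟩
      exact ⟨C, η, hη, fun θ hθ => h θ (hST hθ)⟩
    · rintro S T ⟨C, η, hη, h⟩ ⟨C', η', hη', h'⟩
      refine ⟨max C C', min η η', lt_min hη hη', fun θ hθ ε s hε hs => ?_⟩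
      rcases hθ with hθ | hθ
      · exact (h θ hθ ε s (hε.trans_le (min_le_left _ _)) (hs.trans_le (min_le_left _ _))).trans
          (mul_le_mul_of_nonneg_right (le_max_left _ _) (hb ε s))
      · exact (h' θ hθ ε s (hε.trans_le (min_le_right _ _)) (hs.trans_le (min_le_right _ _))).trans
          (mul_le_mul_of_nonneg_right (le_max_right _ _) (hb ε s))
    · intro θ _
      obtain ⟨C, hC⟩ := (hO θ).bound
      obtain ⟨η, hη, hball⟩ := Metric.eventually_nhds_iff_ball.1 hC
      refine ⟨Metric.ball θ η, mem_nhdsWithin_of_mem_nhds (Metric.ball_mem_nhds θ hη), C, η, hη,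
        fun θ' hθ' ε s hε hs => ?_⟩
      have := hball (ε, θ', s) (by
        rw [Metric.mem_ball, Prod.dist_eq, Prod.dist_eq]
        exact max_lt (by simpa using hε) (max_lt hθ' (by simpa using hs)))
      simpa [Real.norm_of_nonneg (hb ε s)] using this
  obtain ⟨C, η, hη, h⟩ := key
  refine ⟨C, η, hη, fun ε θ s hε hs => ?_⟩
  have hp : Function.Periodic (fun θ => g ε θ s) 1 := fun θ => hper ε θ s
  have := h (Int.fract θ) ⟨Int.fract_nonneg θ, (Int.fract_lt_one θ).le⟩ ε s hε hs
  have he : g ε (Int.fract θ) s = g ε θ s := by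
    have := hp.sub_int_mul_eq ⌊θ⌋ (x := θ)
    rwa [mul_one, Int.self_sub_floor] at this
  rwa [he] at this

end Jets

/-! ### The two families in a common form. -/

/-- The factor of the delay in the delayed argument: `ε`, respectively `1`. -/
def DelayKind.scale {𝕜 : Type*} [One 𝕜] : DelayKind → 𝕜 → 𝕜
  | .shortDelay, ε => ε
  | .weakDelay, _ => 1

/-- The factor of the delayed argument: `1`, respectively `ε`. -/
def DelayKind.weight {𝕜 : Type*} [One 𝕜] : DelayKind → 𝕜 → 𝕜
  | .shortDelay, _ => 1
  | .weakDelay, ε => ε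

theorem delayedArg_eq (k : DelayKind) (r : Plane → ℝ) (ε om lam : ℝ) (W : ℝ → ℝ → Plane)
    (θ s : ℝ) :
    delayedArg k r ε om lam W θ s = k.weight ε • W (θ - k.scale ε * om * r (W θ s))
      (s * Real.exp (-(k.scale ε * lam * r (W θ s)))) := by
  cases k <;> simp [delayedArg, DelayKind.scale, DelayKind.weight]

/-- At `ε = 0` either the delay or the whole delayed argument is multiplied by zero. This is why the
linearization that governs every order in `ε` is that of the ordinary differential equation. -/
theorem delayedArg_zero (k : DelayKind) (r : Plane → ℝ) (om lam : ℝ) (W : ℝ → ℝ → Plane)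
    (θ s : ℝ) : delayedArg k r 0 om lam W θ s = k.base (W θ s) := by
  cases k <;> simp [delayedArg, DelayKind.base]

theorem DelayKind.contDiff_scale (k : DelayKind) : ContDiff ℝ ∞ (k.scale : ℝ → ℝ) := by
  cases k
  · exact contDiff_id
  · exact contDiff_const

theorem DelayKind.contDiff_weight (k : DelayKind) : ContDiff ℝ ∞ (k.weight : ℝ → ℝ) := by
  cases k
  · exact contDiff_const
  · exact contDiff_id

theorem DelayKind.contDiff_base (k : DelayKind) : ContDiff ℝ ∞ k.base := by
  cases k
  · exact contDiff_id
  · exact contDiff_const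

/-! ### Smooth dependence of the error on parameters. -/

section Params

variable {Q E : Type*} [NormedAddCommGroup Q] [NormedSpace ℝ Q] [NormedAddCommGroup E]
  [NormedSpace ℝ E]

theorem deriv_theta_eq_dirDeriv {U : Q → ℝ → ℝ → E} {q : Q} {θ s : ℝ}
    (hU : DifferentiableAt ℝ (fun x : Q × ℝ × ℝ => U x.1 x.2.1 x.2.2) (q, θ, s)) :
    deriv (fun t => U q t s) θ =
      dirDeriv ℝ ((0 : Q), (1 : ℝ), (0 : ℝ)) (fun x : Q × ℝ × ℝ => U x.1 x.2.1 x.2.2) (q, θ, s) := by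
  have h1 : HasDerivAt (fun t : ℝ => (q, t, s)) ((0 : Q), (1 : ℝ), (0 : ℝ)) θ :=
    (hasDerivAt_const θ q).prodMk ((hasDerivAt_id θ).prodMk (hasDerivAt_const θ s))
  exact (hU.hasFDerivAt.comp_hasDerivAt θ h1).deriv

theorem deriv_s_eq_dirDeriv {U : Q → ℝ → ℝ → E} {q : Q} {θ s : ℝ}
    (hU : DifferentiableAt ℝ (fun x : Q × ℝ × ℝ => U x.1 x.2.1 x.2.2) (q, θ, s)) :
    deriv (fun u => U q θ u) s =
      dirDeriv ℝ ((0 : Q), (0 : ℝ), (1 : ℝ)) (fun x : Q × ℝ × ℝ => U x.1 x.2.1 x.2.2) (q, θ, s) := by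
  have h1 : HasDerivAt (fun u : ℝ => (q, θ, u)) ((0 : Q), (0 : ℝ), (1 : ℝ)) s :=
    (hasDerivAt_const s q).prodMk ((hasDerivAt_const s θ).prodMk (hasDerivAt_id s))
  exact (hU.hasFDerivAt.comp_hasDerivAt s h1).deriv

/-- The parameter space `Q` is left general because two cases are needed: `ε` alone for a truncated
series, and pairs `(τ, ε)` for the family that joins two consecutive truncations. -/
theorem contDiffAt_delayedArg (k : DelayKind) {r : Plane → ℝ} {e a b : Q → ℝ}
    {U : Q → ℝ → ℝ → Plane} (he : ContDiff ℝ ∞ e) (ha : ContDiff ℝ ∞ a) (hb : ContDiff ℝ ∞ b)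
    (hU : ContDiff ℝ ∞ (fun x : Q × ℝ × ℝ => U x.1 x.2.1 x.2.2)) {x : Q × ℝ × ℝ}
    (hr : ContDiffAt ℝ ∞ r (U x.1 x.2.1 x.2.2)) :
    ContDiffAt ℝ ∞ (fun x : Q × ℝ × ℝ =>
      delayedArg k r (e x.1) (a x.1) (b x.1) (U x.1) x.2.1 x.2.2) x := by
  simp only [delayedArg_eq]
  have hsc : ContDiffAt ℝ ∞ (fun x : Q × ℝ × ℝ => k.scale (e x.1)) x :=
    (k.contDiff_scale.comp (he.comp contDiff_fst)).contDiffAt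
  have hwt : ContDiffAt ℝ ∞ (fun x : Q × ℝ × ℝ => k.weight (e x.1)) x :=
    (k.contDiff_weight.comp (he.comp contDiff_fst)).contDiffAt
  have ha' : ContDiffAt ℝ ∞ (fun x : Q × ℝ × ℝ => a x.1) x := (ha.comp contDiff_fst).contDiffAt
  have hb' : ContDiffAt ℝ ∞ (fun x : Q × ℝ × ℝ => b x.1) x := (hb.comp contDiff_fst).contDiffAt
  have hr' : ContDiffAt ℝ ∞ (fun x : Q × ℝ × ℝ => r (U x.1 x.2.1 x.2.2)) x :=
    ContDiffAt.comp x hr hU.contDiffAt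
  have hpt : ContDiffAt ℝ ∞ (fun x : Q × ℝ × ℝ => ((x.1,
      x.2.1 - k.scale (e x.1) * a x.1 * r (U x.1 x.2.1 x.2.2),
      x.2.2 * Real.exp (-(k.scale (e x.1) * b x.1 * r (U x.1 x.2.1 x.2.2)))) : Q × ℝ × ℝ)) x :=
    contDiffAt_fst.prodMk
      ((contDiff_snd.fst.contDiffAt.sub ((hsc.mul ha').mul hr')).prodMk
        (contDiff_snd.snd.contDiffAt.mul ((hsc.mul hb').mul hr').neg.exp))
  exact hwt.smul (ContDiffAt.comp x hU.contDiffAt hpt)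

theorem contDiffAt_invarianceError (k : DelayKind) {f : ℝ × Plane × Plane → Plane}
    {r : Plane → ℝ} {e a b : Q → ℝ}
    {U : Q → ℝ → ℝ → Plane} (he : ContDiff ℝ ∞ e) (ha : ContDiff ℝ ∞ a) (hb : ContDiff ℝ ∞ b)
    (hU : ContDiff ℝ ∞ (fun x : Q × ℝ × ℝ => U x.1 x.2.1 x.2.2)) {x : Q × ℝ × ℝ}
    (hr : ContDiffAt ℝ ∞ r (U x.1 x.2.1 x.2.2))
    (hex : e x.1 = 0)
    (hf : ContDiffAt ℝ ∞ f (0, U x.1 x.2.1 x.2.2, k.base (U x.1 x.2.1 x.2.2))) :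
    ContDiffAt ℝ ∞ (fun x : Q × ℝ × ℝ =>
      invarianceError k f r (e x.1) (a x.1) (b x.1) (U x.1) x.2.1 x.2.2) x := by
  have hd : Differentiable ℝ (fun x : Q × ℝ × ℝ => U x.1 x.2.1 x.2.2) :=
    hU.differentiable (by simp)
  have ha' : ContDiffAt ℝ ∞ (fun x : Q × ℝ × ℝ => a x.1) x := (ha.comp contDiff_fst).contDiffAt
  have hb' : ContDiffAt ℝ ∞ (fun x : Q × ℝ × ℝ => b x.1) x := (hb.comp contDiff_fst).contDiffAt
  have hdel := contDiffAt_delayedArg k he ha hb hU hr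
  have heq : (fun x : Q × ℝ × ℝ =>
      invarianceError k f r (e x.1) (a x.1) (b x.1) (U x.1) x.2.1 x.2.2) = fun x =>
      a x.1 • dirDeriv ℝ ((0 : Q), (1 : ℝ), (0 : ℝ)) (fun x : Q × ℝ × ℝ => U x.1 x.2.1 x.2.2) x
      + (x.2.2 * b x.1) •
        dirDeriv ℝ ((0 : Q), (0 : ℝ), (1 : ℝ)) (fun x : Q × ℝ × ℝ => U x.1 x.2.1 x.2.2) x
      - f (e x.1, U x.1 x.2.1 x.2.2,
        delayedArg k r (e x.1) (a x.1) (b x.1) (U x.1) x.2.1 x.2.2) := by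
    ext1 x
    rw [invarianceError, deriv_theta_eq_dirDeriv (hd _), deriv_s_eq_dirDeriv (hd _)]
  rw [heq]
  have h0 : delayedArg k r (e x.1) (a x.1) (b x.1) (U x.1) x.2.1 x.2.2 =
      k.base (U x.1 x.2.1 x.2.2) := by rw [hex, delayedArg_zero]
  have hpt : ContDiffAt ℝ ∞ (fun x : Q × ℝ × ℝ => ((e x.1, U x.1 x.2.1 x.2.2,
      delayedArg k r (e x.1) (a x.1) (b x.1) (U x.1) x.2.1 x.2.2) : ℝ × Plane × Plane)) x :=
    (he.comp contDiff_fst).contDiffAt.prodMk (hU.contDiffAt.prodMk hdel)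
  refine ((ha'.smul (hU.contDiffAt.dirDeriv_infty _)).add
    ((contDiff_snd.snd.contDiffAt.mul hb').smul (hU.contDiffAt.dirDeriv_infty _))).sub ?_
  refine ContDiffAt.comp x (g := f) ?_ hpt
  rw [h0, hex]
  exact hf

end Params

theorem isBigO_pow_smul {X E : Type*} [TopologicalSpace X] [NormedAddCommGroup E]
    [NormedSpace ℝ E] {x : X} {c : X → ℝ} {h : X → E} (hc : ContinuousAt c x)
    (hh : ContinuousAt h x) {N j : ℕ} (hj : N ≤ j) :
    (fun y => c y ^ j • h y) =O[𝓝 x] fun y => c y ^ N := by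
  obtain ⟨i, rfl⟩ := Nat.exists_eq_add_of_le hj
  have h1 : ContinuousAt (fun y => c y ^ i • h y) x := (hc.pow i).smul hh
  have := (Asymptotics.isBigO_refl (fun y => c y ^ N) (𝓝 x)).smul
    (h1.norm.isBoundedUnder_le.isBigO_one ℝ)
  refine this.congr (fun y => ?_) (fun y => by simp)
  rw [smul_smul, ← pow_add]

/-! ### Truncated series and dependence of their error on the truncation in `s`. -/

section Truncation

variable {k : DelayKind} {f : ℝ × Plane × Plane → Plane} {r : Plane → ℝ} {om lam : ℕ → ℝ}
  {W : ℕ → ℕ → ℝ → Plane}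

theorem contDiff_truncScalar (a : ℕ → ℝ) (N : ℕ) : ContDiff ℝ ∞ (truncScalar a N) := by
  unfold truncScalar
  fun_prop

theorem contDiff_truncSeries {n : ℕ} (hW : ∀ m ≤ n, ∀ p, ContDiff ℝ ∞ (W m p)) (P : ℕ) :
    ContDiff ℝ ∞ (fun v : ℝ × ℝ × ℝ => truncSeries W n P v.1 v.2.1 v.2.2) := by
  unfold truncSeries
  refine ContDiff.sum fun m hm => (contDiff_fst.pow m).smul (ContDiff.sum fun p _ => ?_)
  exact (contDiff_snd.snd.pow p).smul
    ((hW m (Nat.lt_succ_iff.1 (Finset.mem_range.1 hm)) p).comp contDiff_snd.fst)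

@[simp] theorem truncSeries_zero_zero (n P : ℕ) (θ : ℝ) : truncSeries W n P 0 θ 0 = W 0 0 θ := by
  simp [truncSeries, Finset.sum_range_succ']

theorem truncSeries_eps_zero (n P : ℕ) (θ s : ℝ) :
    truncSeries W n P 0 θ s = truncSeries W 0 P 0 θ s := by
  simp [truncSeries, Finset.sum_range_succ']

@[simp] theorem truncScalar_zero (a : ℕ → ℝ) (n : ℕ) : truncScalar a n 0 = a 0 := by
  simp [truncScalar, Finset.sum_range_succ']

theorem truncSeries_periodic {n : ℕ} (hW : ∀ m ≤ n, ∀ p, Function.Periodic (W m p) 1)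
    (P : ℕ) (ε θ s : ℝ) : truncSeries W n P ε (θ + 1) s = truncSeries W n P ε θ s := by
  unfold truncSeries
  refine Finset.sum_congr rfl fun m hm => ?_
  simp only [hW m (Nat.lt_succ_iff.1 (Finset.mem_range.1 hm)) _ θ]

theorem truncError_periodic {n : ℕ} (hW : ∀ m ≤ n, ∀ p, Function.Periodic (W m p) 1)
    (P : ℕ) (ε θ s : ℝ) :
    truncError k f r om lam W n P ε (θ + 1) s = truncError k f r om lam W n P ε θ s := by
  have h1 := truncSeries_periodic hW P
  have h2 : deriv (fun t => truncSeries W n P ε t s) (θ + 1) =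
      deriv (fun t => truncSeries W n P ε t s) θ := by
    rw [← deriv_comp_add_const]
    simp only [h1]
  have h3 : ∀ x c u : ℝ, truncSeries W n P ε (x + 1 - c) u = truncSeries W n P ε (x - c) u := by
    intro x c u
    rw [← h1 ε (x - c), sub_add_eq_add_sub]
  simp only [truncError, invarianceError, delayedArg_eq, h1, h2, h3]

theorem smoothAtCycle_truncError {n : ℕ} (hW : ∀ m ≤ n, ∀ p, ContDiff ℝ ∞ (W m p))
    (hr : ∀ θ, ContDiffAt ℝ ∞ r (W 0 0 θ))
    (hf : ∀ θ, ContDiffAt ℝ ∞ f (0, W 0 0 θ, k.base (W 0 0 θ))) (P : ℕ) :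
    SmoothAtCycle fun v : ℝ × ℝ × ℝ => truncError k f r om lam W n P v.1 v.2.1 v.2.2 := by
  intro θ
  refine contDiffAt_invarianceError k contDiff_id (contDiff_truncScalar om n)
    (contDiff_truncScalar lam n) (contDiff_truncSeries hW P) ?_ rfl ?_
  · simpa using hr θ
  · simpa using hf θ

theorem truncSeries_sub_isBigO {n : ℕ} (hW : ∀ m ≤ n, ∀ p, ContDiff ℝ ∞ (W m p)) {p P : ℕ}
    (hp : p ≤ P) (v₀ : ℝ × ℝ × ℝ) :
    (fun v : ℝ × ℝ × ℝ => truncSeries W n P v.1 v.2.1 v.2.2 - truncSeries W n p v.1 v.2.1 v.2.2)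
      =O[𝓝 v₀] fun v => v.2.2 ^ (p + 1) := by
  have : ∀ v : ℝ × ℝ × ℝ,
      truncSeries W n P v.1 v.2.1 v.2.2 - truncSeries W n p v.1 v.2.1 v.2.2 =
      ∑ m ∈ Finset.range (n + 1), ∑ j ∈ Finset.Ico (p + 1) (P + 1),
        v.2.2 ^ j • (v.1 ^ m • W m j v.2.1) := by
    intro v
    unfold truncSeries
    rw [← Finset.sum_sub_distrib]
    refine Finset.sum_congr rfl fun m _ => ?_
    rw [← smul_sub, Finset.sum_Ico_eq_sub _ (by omega)]
    simp only [Finset.smul_sum, smul_sub, smul_comm (v.1 ^ m)]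
  simp only [this]
  refine Asymptotics.IsBigO.fun_sum fun m hm => Asymptotics.IsBigO.fun_sum fun j hj => ?_
  have h1 : Continuous (W m j) := (hW m (Nat.lt_succ_iff.1 (Finset.mem_range.1 hm)) j).continuous
  exact isBigO_pow_smul (by fun_prop) (by fun_prop) (Finset.mem_Ico.1 hj).1

/-- The terms of order at most `p` in `s` of the error do not depend on the order `P ≥ p` of
truncation. -/
theorem truncError_sub_isBigO {n : ℕ} (hW : ∀ m ≤ n, ∀ p, ContDiff ℝ ∞ (W m p))
    (hr : ∀ θ, ContDiffAt ℝ ∞ r (W 0 0 θ))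
    (hf : ∀ θ, ContDiffAt ℝ ∞ f (0, W 0 0 θ, k.base (W 0 0 θ))) {p P : ℕ} (hp : p ≤ P) (θ : ℝ) :
    (fun v : ℝ × ℝ × ℝ => truncError k f r om lam W n P v.1 v.2.1 v.2.2
      - truncError k f r om lam W n p v.1 v.2.1 v.2.2) =O[𝓝 (0, θ, 0)]
      fun v => v.2.2 ^ (p + 1) := by
  set T : ℕ → ℝ × ℝ × ℝ → Plane := fun P v => truncSeries W n P v.1 v.2.1 v.2.2 with hTdef
  have hT : ∀ P, ContDiff ℝ ∞ (T P) := contDiff_truncSeries hW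
  have hTd : ∀ P v, DifferentiableAt ℝ (T P) v := fun P => (hT P).differentiable (by simp)
  have hsub : ∀ v₀, (fun v => T P v - T p v) =O[𝓝 v₀] fun v => v.2.2 ^ (p + 1) :=
    truncSeries_sub_isBigO hW hp
  have hT0 : ∀ P, Tendsto (T P) (𝓝 (0, θ, 0)) (𝓝 (W 0 0 θ)) := by
    intro P
    have := (hT P).continuous.tendsto (0, θ, 0)
    simpa [hTdef] using this
  have hrsub : (fun v => r (T P v) - r (T p v)) =O[𝓝 (0, θ, 0)] fun v => v.2.2 ^ (p + 1) :=
    ((hr θ).comp_sub_comp_isBigO (by simp) (hT0 P) (hT0 p)).trans (hsub _)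
  -- the point at which the delayed argument is evaluated
  set pt : (ℝ × ℝ × ℝ) × ℝ → ℝ × ℝ × ℝ := fun y =>
    (y.1.1, y.1.2.1 - k.scale y.1.1 * truncScalar om n y.1.1 * y.2,
      y.1.2.2 * Real.exp (-(k.scale y.1.1 * truncScalar lam n y.1.1 * y.2))) with hpt
  have hsc : ContDiff ℝ ∞ (fun y : (ℝ × ℝ × ℝ) × ℝ => k.scale y.1.1) :=
    k.contDiff_scale.comp contDiff_fst.fst
  have homc : ContDiff ℝ ∞ (fun y : (ℝ × ℝ × ℝ) × ℝ => truncScalar om n y.1.1) :=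
    (contDiff_truncScalar om n).comp contDiff_fst.fst
  have hlamc : ContDiff ℝ ∞ (fun y : (ℝ × ℝ × ℝ) × ℝ => truncScalar lam n y.1.1) :=
    (contDiff_truncScalar lam n).comp contDiff_fst.fst
  have hexpc : ContDiff ℝ ∞ (fun y : (ℝ × ℝ × ℝ) × ℝ =>
      Real.exp (-(k.scale y.1.1 * truncScalar lam n y.1.1 * y.2))) :=
    ((hsc.mul hlamc).mul contDiff_snd).neg.exp
  have hptc : ContDiff ℝ ∞ pt :=
    contDiff_fst.fst.prodMk ((contDiff_fst.snd.fst.sub ((hsc.mul homc).mul contDiff_snd)).prodMk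
      (contDiff_fst.snd.snd.mul hexpc))
  have hy : ∀ P, Tendsto (fun v => (v, r (T P v))) (𝓝 (0, θ, 0))
      (𝓝 (((0 : ℝ), θ, (0 : ℝ)), r (W 0 0 θ))) := fun P =>
    tendsto_id.prodMk_nhds ((hr θ).continuousAt.tendsto.comp (hT0 P))
  have hD : (fun v => T P (pt (v, r (T P v))) - T p (pt (v, r (T p v)))) =O[𝓝 (0, θ, 0)]
      fun v => v.2.2 ^ (p + 1) := by
    -- Change of the series at a fixed delayed point. The `s`-coordinate of that point is `s` times
    -- a bounded exponential, so the order in `s` is preserved.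
    have h1 : (fun v => T P (pt (v, r (T P v))) - T p (pt (v, r (T P v)))) =O[𝓝 (0, θ, 0)]
        fun v => v.2.2 ^ (p + 1) := by
      have hlim : Tendsto (fun v => pt (v, r (T P v))) (𝓝 (0, θ, 0))
          (𝓝 (pt (((0 : ℝ), θ, (0 : ℝ)), r (W 0 0 θ)))) :=
        (hptc.continuous.tendsto _).comp (hy P)
      refine ((hsub _).comp_tendsto hlim).trans ?_
      have hb := ((hexpc.continuous.tendsto _).comp (hy P)).norm.isBoundedUnder_le.isBigO_one ℝ
      have := ((Asymptotics.isBigO_refl (fun v : ℝ × ℝ × ℝ => v.2.2) (𝓝 (0, θ, 0))).mul hb).pow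
        (p + 1)
      simpa [Function.comp_def, hpt] using this
    -- Change of the delayed point for a fixed series. The point depends on the series only through
    -- the value of `r`.
    have h2 : (fun v => T p (pt (v, r (T P v))) - T p (pt (v, r (T p v)))) =O[𝓝 (0, θ, 0)]
        fun v => v.2.2 ^ (p + 1) := by
      have h3 := (((hT p).comp hptc).contDiffAt).comp_sub_comp_isBigO (by simp) (hy P) (hy p)
      refine h3.trans ?_
      have h4 : (fun v => (v, r (T P v)) - (v, r (T p v))) =
          fun v : ℝ × ℝ × ℝ => ((0 : ℝ × ℝ × ℝ), r (T P v) - r (T p v)) := by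
        ext v <;> simp
      rw [h4]
      exact (Asymptotics.isBigO_zero _ _).prod_left hrsub
    exact (h1.add h2).congr_left fun v => by abel
  have hdel : ∀ P v, delayedArg k r v.1 (truncScalar om n v.1) (truncScalar lam n v.1)
      (truncSeries W n P v.1) v.2.1 v.2.2 = k.weight v.1 • T P (pt (v, r (T P v))) := fun P v => by
    rw [delayedArg_eq]
  have hwt : (fun v : ℝ × ℝ × ℝ => k.weight v.1) =O[𝓝 (0, θ, 0)] fun _ => (1 : ℝ) :=
    ((k.contDiff_weight.continuous.comp continuous_fst).tendsto
      ((0 : ℝ), θ, (0 : ℝ))).norm.isBoundedUnder_le.isBigO_one ℝ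
  have hDel : (fun v : ℝ × ℝ × ℝ => k.weight v.1 • T P (pt (v, r (T P v)))
      - k.weight v.1 • T p (pt (v, r (T p v)))) =O[𝓝 (0, θ, 0)] fun v => v.2.2 ^ (p + 1) := by
    simpa [smul_sub] using hwt.smul hD
  have hptf : ∀ P, Tendsto (fun v => (v.1, T P v, k.weight v.1 • T P (pt (v, r (T P v)))))
      (𝓝 (0, θ, 0)) (𝓝 ((0 : ℝ), W 0 0 θ, k.base (W 0 0 θ))) := by
    intro P
    refine (continuous_fst.tendsto' _ _ rfl).prodMk_nhds ((hT0 P).prodMk_nhds ?_)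
    have h1 := (k.contDiff_weight.continuous.comp continuous_fst).tendsto ((0 : ℝ), θ, (0 : ℝ))
    have h2 := h1.smul (((hT P).continuous.comp hptc.continuous).tendsto _ |>.comp (hy P))
    have hb : k.base (W 0 0 θ) =
        k.weight (0 : ℝ) • T P (pt (((0 : ℝ), θ, (0 : ℝ)), r (W 0 0 θ))) := by
      cases k <;> simp [DelayKind.base, DelayKind.weight, hpt, hTdef, DelayKind.scale]
    rw [hb]
    exact h2
  have hF := (hf θ).comp_sub_comp_isBigO (by simp) (hptf P) (hptf p)
  have hF' : (fun v : ℝ × ℝ × ℝ => f (v.1, T P v, k.weight v.1 • T P (pt (v, r (T P v))))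
      - f (v.1, T p v, k.weight v.1 • T p (pt (v, r (T p v))))) =O[𝓝 (0, θ, 0)]
      fun v => v.2.2 ^ (p + 1) := by
    refine hF.trans ?_
    have h4 : (fun v => (v.1, T P v, k.weight v.1 • T P (pt (v, r (T P v))))
        - (v.1, T p v, k.weight v.1 • T p (pt (v, r (T p v))))) =
        fun v : ℝ × ℝ × ℝ => ((0 : ℝ), T P v - T p v, k.weight v.1 • T P (pt (v, r (T P v)))
          - k.weight v.1 • T p (pt (v, r (T p v)))) := by
      ext v <;> simp
    rw [h4]
    exact (Asymptotics.isBigO_zero _ _).prod_left ((hsub _).prod_left hDel)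
  have hdiff : ContDiffAt ℝ ∞ (T P - T p) (0, θ, 0) := ((hT P).sub (hT p)).contDiffAt
  have hθ : dirDeriv ℝ ((0 : ℝ), (1 : ℝ), (0 : ℝ)) (T P - T p) =O[𝓝 (0, θ, 0)]
      fun v => v.2.2 ^ (p + 1) :=
    isBigO_dirDeriv sCoord (e := (0, 0, 1)) rfl rfl (v₀ := (0, θ, 0)) rfl hdiff (hsub _)
  -- The derivative across `s = 0` loses one power of `s`; the factor `s` in `s λ ∂_s` restores it
  -- below.
  have hs : dirDeriv ℝ ((0 : ℝ), (0 : ℝ), (1 : ℝ)) (T P - T p) =O[𝓝 (0, θ, 0)]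
      fun v => v.2.2 ^ p :=
    isBigO_dirDeriv_transversal sCoord (e := (0, 0, 1)) rfl (v₀ := (0, θ, 0)) rfl hdiff (hsub _)
  have hom : (fun v : ℝ × ℝ × ℝ => truncScalar om n v.1) =O[𝓝 (0, θ, 0)] fun _ => (1 : ℝ) :=
    (((contDiff_truncScalar om n).continuous.comp continuous_fst).tendsto
      ((0 : ℝ), θ, (0 : ℝ))).norm.isBoundedUnder_le.isBigO_one ℝ
  have hlam : (fun v : ℝ × ℝ × ℝ => truncScalar lam n v.1) =O[𝓝 (0, θ, 0)] fun _ => (1 : ℝ) :=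
    (((contDiff_truncScalar lam n).continuous.comp continuous_fst).tendsto
      ((0 : ℝ), θ, (0 : ℝ))).norm.isBoundedUnder_le.isBigO_one ℝ
  have h1 := hom.smul hθ
  have h2 := ((Asymptotics.isBigO_refl (fun v : ℝ × ℝ × ℝ => v.2.2) (𝓝 (0, θ, 0))).mul hlam).smul hs
  simp only [smul_eq_mul, one_mul, mul_one, ← pow_succ'] at h1 h2
  refine ((h1.add h2).sub hF').congr_left fun v => ?_
  have hdd : ∀ e, dirDeriv ℝ e (T P - T p) v = dirDeriv ℝ e (T P) v - dirDeriv ℝ e (T p) v := by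
    intro e
    simp [dirDeriv, fderiv_sub (hTd P v) (hTd p v)]
  simp only [truncError, invarianceError, hdel, hdd, deriv_theta_eq_dirDeriv (hTd _ _),
    deriv_s_eq_dirDeriv (hTd _ _), smul_sub]
  simp only [hTdef]
  abel

end Truncation

/-- Bridge between the one-variable derivatives that define `sCoeff` and the jets used everywhere
else. The open set `S` is needed because the parameterization is smooth only for small `|s|`. -/
theorem iteratedDeriv_line_eq_iterate_dirDeriv {𝕜 X E : Type*} [NontriviallyNormedField 𝕜]
    [NormedAddCommGroup X] [NormedSpace 𝕜 X] [NormedAddCommGroup E] [NormedSpace 𝕜 E]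
    {g : X → E} {S : Set X} (hS : IsOpen S) (e y : X)
    (hg : ∀ m, ∀ v ∈ S, DifferentiableAt 𝕜 ((dirDeriv 𝕜 e)^[m] g) v) (p : ℕ) :
    ∀ t : 𝕜, y + t • e ∈ S →
      iteratedDeriv p (fun t : 𝕜 => g (y + t • e)) t = (dirDeriv 𝕜 e)^[p] g (y + t • e) := by
  induction p with
  | zero => intro t _; simp
  | succ p ih =>
    intro t ht
    have hline : HasDerivAt (fun t : 𝕜 => y + t • e) e t := by
      simpa using ((hasDerivAt_id t).smul_const e).const_add y
    rw [iteratedDeriv_succ, Function.iterate_succ_apply']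
    have h1 : iteratedDeriv p (fun t : 𝕜 => g (y + t • e)) =ᶠ[𝓝 t]
        fun t => (dirDeriv 𝕜 e)^[p] g (y + t • e) := by
      filter_upwards [hline.continuousAt.eventually (hS.mem_nhds ht)] with u hu using ih u hu
    rw [h1.deriv_eq]
    exact ((hg p _ ht).hasFDerivAt.comp_hasDerivAt t hline).deriv

/-! ### Products of functions and of truncated power series. -/

section Products

variable {X E : Type*} [NormedAddCommGroup X] [NormedSpace ℝ X] [NormedAddCommGroup E]
  [NormedSpace ℝ E]

theorem dirDeriv_smul {a : X → ℝ} {h : X → E} {v : X} (ha : DifferentiableAt ℝ a v)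
    (hh : DifferentiableAt ℝ h v) (e : X) :
    dirDeriv ℝ e (fun v => a v • h v) v = a v • dirDeriv ℝ e h v + dirDeriv ℝ e a v • h v := by
  have := fderiv_fun_smul ha hh
  simp [dirDeriv, this]

theorem dirDeriv_fun_add {g h : X → E} {v : X} (hg : DifferentiableAt ℝ g v)
    (hh : DifferentiableAt ℝ h v) (e : X) :
    dirDeriv ℝ e (fun v => g v + h v) v = dirDeriv ℝ e g v + dirDeriv ℝ e h v := by
  have := fderiv_fun_add hg hh
  simp [dirDeriv, this]

end Products

section Expansions

variable {X E : Type*} [TopologicalSpace X] [NormedAddCommGroup E] [NormedSpace ℝ E]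

/-- The Cauchy product of truncated power series. -/
theorem isBigO_truncated_mul {c : X → ℝ} {a : ℕ → X → ℝ} {b : ℕ → X → E} {x : X}
    (hc : ContinuousAt c x) (ha : ∀ i, ContinuousAt (a i) x) (hb : ∀ i, ContinuousAt (b i) x)
    (P : ℕ) :
    (fun y => (∑ i ∈ Finset.range P, c y ^ i * a i y) • (∑ j ∈ Finset.range P, c y ^ j • b j y)
      - ∑ p ∈ Finset.range P, c y ^ p • ∑ i ∈ Finset.range (p + 1), a (p - i) y • b i y)
      =O[𝓝 x] fun y => c y ^ P := by
  -- What the truncated Cauchy product omits are the terms with `i + j ≥ P`.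
  have key : ∀ y, (∑ i ∈ Finset.range P, c y ^ i * a i y) • (∑ j ∈ Finset.range P, c y ^ j • b j y)
      - ∑ p ∈ Finset.range P, c y ^ p • ∑ i ∈ Finset.range (p + 1), a (p - i) y • b i y
      = ∑ i ∈ Finset.range P, ∑ j ∈ Finset.Ico (P - i) P, c y ^ (i + j) • (a j y • b i y) := by
    intro y
    have h1 : ∑ p ∈ Finset.range P, c y ^ p • ∑ i ∈ Finset.range (p + 1), a (p - i) y • b i y
        = ∑ i ∈ Finset.range P, ∑ j ∈ Finset.range (P - i), c y ^ (i + j) • (a j y • b i y) := by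
      rw [← Finset.sum_range_diag_flip P fun i j => c y ^ (i + j) • (a j y • b i y)]
      refine Finset.sum_congr rfl fun p _ => ?_
      rw [Finset.smul_sum]
      refine Finset.sum_congr rfl fun i hi => ?_
      rw [Nat.add_sub_cancel' (Nat.lt_succ_iff.1 (Finset.mem_range.1 hi))]
    have h2 : (∑ i ∈ Finset.range P, c y ^ i * a i y) • (∑ j ∈ Finset.range P, c y ^ j • b j y)
        = ∑ i ∈ Finset.range P, ∑ j ∈ Finset.range P, c y ^ (i + j) • (a j y • b i y) := by
      rw [Finset.smul_sum]
      refine Finset.sum_congr rfl fun i _ => ?_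
      rw [Finset.sum_smul]
      refine Finset.sum_congr rfl fun j _ => ?_
      simp only [smul_smul]
      congr 1
      ring
    rw [h1, h2, ← Finset.sum_sub_distrib]
    refine Finset.sum_congr rfl fun i _ => ?_
    rw [Finset.sum_Ico_eq_sub _ (Nat.sub_le P i)]
  simp only [key]
  refine Asymptotics.IsBigO.fun_sum fun i _ => Asymptotics.IsBigO.fun_sum fun j hj => ?_
  refine isBigO_pow_smul hc ((ha j).smul (hb i)) ?_
  have := (Finset.mem_Ico.1 hj).1
  omega

/-- Products of functions with given truncated expansions. -/
theorem isBigO_mul_expansion {c : X → ℝ} {a : ℕ → X → ℝ} {b : ℕ → X → E} {B : X → E} {x : X}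
    (hc : ContinuousAt c x) (ha : ∀ i, ContinuousAt (a i) x) (hb : ∀ i, ContinuousAt (b i) x)
    (P : ℕ) (hB : (fun y => B y - ∑ j ∈ Finset.range P, c y ^ j • b j y) =O[𝓝 x]
      fun y => c y ^ P) :
    (fun y => (∑ i ∈ Finset.range P, c y ^ i * a i y) • B y
      - ∑ p ∈ Finset.range P, c y ^ p • ∑ i ∈ Finset.range (p + 1), a (p - i) y • b i y)
      =O[𝓝 x] fun y => c y ^ P := by
  have h1 : ContinuousAt (fun y => ∑ i ∈ Finset.range P, c y ^ i * a i y) x := by fun_prop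
  have h2 := (h1.norm.isBoundedUnder_le.isBigO_one ℝ).smul hB
  simp only [smul_eq_mul, one_mul] at h2
  exact (h2.add (isBigO_truncated_mul hc ha hb P)).congr_left fun y => by
    rw [smul_sub, sub_add_sub_cancel]

end Expansions

/-! ### Polynomials in `s` with coefficients depending on `θ`. -/

section Polynomials

variable {E : Type*} [NormedAddCommGroup E] [NormedSpace ℝ E]

/-- The polynomial `∑_{p < P} s^p a_p(θ)`. -/
noncomputable def sPoly (P : ℕ) (a : ℕ → ℝ → E) (v : ℝ × ℝ × ℝ) : E :=
  ∑ p ∈ Finset.range P, v.2.2 ^ p • a p v.2.1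

theorem contDiff_sPoly {a : ℕ → ℝ → E} (ha : ∀ p, ContDiff ℝ ∞ (a p)) (P : ℕ) :
    ContDiff ℝ ∞ (sPoly P a) := by
  unfold sPoly
  exact ContDiff.sum fun p _ => (contDiff_snd.snd.pow p).smul ((ha p).comp contDiff_snd.fst)

theorem dirDeriv_theta_sPoly {a : ℕ → ℝ → E} (ha : ∀ p, ContDiff ℝ ∞ (a p)) (P : ℕ)
    (v : ℝ × ℝ × ℝ) :
    dirDeriv ℝ ((0 : ℝ), (1 : ℝ), (0 : ℝ)) (sPoly P a) v = sPoly P (fun p => deriv (a p)) v := by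
  refine dirDeriv_eq_of_hasDerivAt ((contDiff_sPoly ha P).differentiable (by simp) v) ?_
  have h1 : HasDerivAt (fun t : ℝ => v.2.1 + t) 1 0 := (hasDerivAt_id (0 : ℝ)).const_add v.2.1
  have h2 : ∀ p, HasDerivAt (fun t : ℝ => v.2.2 ^ p • a p (v.2.1 + t))
      (v.2.2 ^ p • deriv (a p) v.2.1) 0 := by
    intro p
    have h3 : HasDerivAt (a p) (deriv (a p) v.2.1) (v.2.1 + 0) := by
      rw [add_zero]
      exact ((ha p).differentiable (by simp) _).hasDerivAt
    simpa [Function.comp_def] using (h3.scomp (0 : ℝ) h1).fun_const_smul (v.2.2 ^ p)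
  have h4 := HasDerivAt.fun_sum (u := Finset.range P) fun p _ => h2 p
  simpa [sPoly] using h4

theorem dirDeriv_s_sPoly {a : ℕ → ℝ → E} (ha : ∀ p, ContDiff ℝ ∞ (a p)) (P : ℕ)
    (v : ℝ × ℝ × ℝ) :
    dirDeriv ℝ ((0 : ℝ), (0 : ℝ), (1 : ℝ)) (sPoly P a) v =
      ∑ p ∈ Finset.range P, ((p : ℝ) * v.2.2 ^ (p - 1)) • a p v.2.1 := by
  have := congrFun (iterate_dirDeriv_s_sum (fun p => (ha p).differentiable (by simp)) P 1) v
  simp only [Function.iterate_one, Nat.descFactorial_one] at this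
  exact this

/-- The Euler operator `s ∂_s` is diagonal on powers of `s`, so that, unlike `∂_s`, it respects the
truncation order. -/
theorem smul_dirDeriv_s_sPoly {a : ℕ → ℝ → E} (ha : ∀ p, ContDiff ℝ ∞ (a p)) (P : ℕ)
    (v : ℝ × ℝ × ℝ) :
    v.2.2 • dirDeriv ℝ ((0 : ℝ), (0 : ℝ), (1 : ℝ)) (sPoly P a) v =
      sPoly P (fun p θ => (p : ℝ) • a p θ) v := by
  rw [dirDeriv_s_sPoly ha, sPoly, Finset.smul_sum]
  refine Finset.sum_congr rfl fun p _ => ?_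
  rw [smul_smul, smul_smul]
  congr 1
  cases p with
  | zero => simp
  | succ p => rw [Nat.add_sub_cancel, pow_succ]; ring

end Polynomials

/-! ### The unperturbed parameterization and the linearized equation in its frame. -/

/-- The situation of the unperturbed parameterization near the limit cycle: `g` is a function of
`(θ, s)` with Taylor coefficients `w`, which solves the invariance equation of the vector
field `X`. -/
structure UnperturbedExpansion (X : Plane → Plane) (om₀ lam₀ : ℝ) (g : ℝ × ℝ × ℝ → Plane)
    (w : ℕ → ℝ → Plane) : Prop where
  smooth : SmoothAtCycle g
  smooth_coeff : ∀ p, ContDiff ℝ ∞ (w p)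
  taylor : ∀ (P : ℕ) (θ : ℝ), (fun v => g v - sPoly P w v) =O[𝓝 (0, θ, 0)] fun v => v.2.2 ^ P
  value : ∀ θ, g (0, θ, 0) = w 0 θ
  field : ∀ θ, ContDiffAt ℝ ∞ X (w 0 θ)
  solves : ∀ θ : ℝ, ∀ᶠ v in 𝓝 (0, θ, 0),
    om₀ • dirDeriv ℝ ((0 : ℝ), (1 : ℝ), (0 : ℝ)) g v
      + (v.2.2 * lam₀) • dirDeriv ℝ ((0 : ℝ), (0 : ℝ), (1 : ℝ)) g v = X (g v)

namespace UnperturbedExpansion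

variable {X : Plane → Plane} {om₀ lam₀ : ℝ} {g : ℝ × ℝ × ℝ → Plane} {w : ℕ → ℝ → Plane}

theorem taylor_theta (hg : UnperturbedExpansion X om₀ lam₀ g w) (P : ℕ) (θ : ℝ) :
    (fun v => dirDeriv ℝ ((0 : ℝ), (1 : ℝ), (0 : ℝ)) g v - sPoly P (fun p => deriv (w p)) v)
      =O[𝓝 (0, θ, 0)] fun v => v.2.2 ^ P := by
  have hs := contDiff_sPoly hg.smooth_coeff P
  have h := isBigO_dirDeriv sCoord (e := (0, 0, 1)) (a := (0, 1, 0)) rfl rfl (v₀ := (0, θ, 0)) rfl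
    ((hg.smooth θ).sub hs.contDiffAt) (hg.taylor P θ)
  refine h.congr' ?_ .rfl
  have h1 : ContDiffAt ℝ 1 g (0, θ, 0) := by simpa using contDiffAt_infty.1 (hg.smooth θ) 1
  filter_upwards [h1.eventually (by simp)] with v hv
  rw [← dirDeriv_theta_sPoly hg.smooth_coeff]
  simp [dirDeriv, fderiv_fun_sub (hv.differentiableAt (by simp)) (hs.differentiable (by simp) v)]

/-- One order is lost by differentiating across `s = 0`, so the argument starts from the expansion
of order `P + 1`. -/
theorem taylor_s (hg : UnperturbedExpansion X om₀ lam₀ g w) (P : ℕ) (θ : ℝ) :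
    (fun v => dirDeriv ℝ ((0 : ℝ), (0 : ℝ), (1 : ℝ)) g v
      - sPoly P (fun p θ => ((p : ℝ) + 1) • w (p + 1) θ) v)
      =O[𝓝 (0, θ, 0)] fun v => v.2.2 ^ P := by
  have hs := contDiff_sPoly hg.smooth_coeff (P + 1)
  have h := isBigO_dirDeriv_transversal sCoord (e := (0, 0, 1)) rfl (v₀ := (0, θ, 0)) rfl
    ((hg.smooth θ).sub hs.contDiffAt) (hg.taylor (P + 1) θ)
  refine h.congr' ?_ .rfl
  have h1 : ContDiffAt ℝ 1 g (0, θ, 0) := by simpa using contDiffAt_infty.1 (hg.smooth θ) 1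
  filter_upwards [h1.eventually (by simp)] with v hv
  have h2 : sPoly P (fun p θ => ((p : ℝ) + 1) • w (p + 1) θ) v =
      dirDeriv ℝ ((0 : ℝ), (0 : ℝ), (1 : ℝ)) (sPoly (P + 1) w) v := by
    rw [dirDeriv_s_sPoly hg.smooth_coeff, sPoly, Finset.sum_range_succ']
    simp [smul_smul, mul_comm]
  rw [h2]
  simp [dirDeriv, fderiv_fun_sub (hv.differentiableAt (by simp)) (hs.differentiable (by simp) v)]

/-- `(∑ s^p B₁^{(p)}) ∂_θ W + (∑ s^p B₂^{(p)}) ∂_s W` has the coefficients `frameMul w B₁ B₂`. -/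
theorem isBigO_frameMul (hg : UnperturbedExpansion X om₀ lam₀ g w) {B₁ B₂ : ℕ → ℝ → ℝ}
    (h₁ : ∀ p, ContDiff ℝ ∞ (B₁ p)) (h₂ : ∀ p, ContDiff ℝ ∞ (B₂ p)) (P : ℕ) (θ : ℝ) :
    (fun v => sPoly P B₁ v • dirDeriv ℝ ((0 : ℝ), (1 : ℝ), (0 : ℝ)) g v
      + sPoly P B₂ v • dirDeriv ℝ ((0 : ℝ), (0 : ℝ), (1 : ℝ)) g v
      - sPoly P (frameMul w B₁ B₂) v) =O[𝓝 (0, θ, 0)] fun v => v.2.2 ^ P := by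
  have c1 : ∀ p, Continuous (B₁ p) := fun p => (h₁ p).continuous
  have c2 : ∀ p, Continuous (B₂ p) := fun p => (h₂ p).continuous
  have cw : ∀ p, Continuous (w p) := fun p => (hg.smooth_coeff p).continuous
  have cw' : ∀ p, Continuous (deriv (w p)) := fun p =>
    (hg.smooth_coeff p).continuous_deriv (by simp)
  have e1 := isBigO_mul_expansion (c := fun v : ℝ × ℝ × ℝ => v.2.2) (a := fun p v => B₁ p v.2.1)
    (b := fun p v => deriv (w p) v.2.1) (x := (0, θ, 0)) (by fun_prop) (by fun_prop) (by fun_prop)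
    P (hg.taylor_theta P θ)
  have e2 := isBigO_mul_expansion (c := fun v : ℝ × ℝ × ℝ => v.2.2) (a := fun p v => B₂ p v.2.1)
    (b := fun p v => ((p : ℝ) + 1) • w (p + 1) v.2.1) (x := (0, θ, 0)) (by fun_prop)
    (by fun_prop) (by fun_prop) P (hg.taylor_s P θ)
  refine (e1.add e2).congr_left fun v => ?_
  have : sPoly P (frameMul w B₁ B₂) v = ∑ p ∈ Finset.range P,
      v.2.2 ^ p • ∑ i ∈ Finset.range (p + 1), B₁ (p - i) v.2.1 • deriv (w i) v.2.1
      + ∑ p ∈ Finset.range P, v.2.2 ^ p • ∑ i ∈ Finset.range (p + 1),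
        B₂ (p - i) v.2.1 • (((i : ℝ) + 1) • w (i + 1) v.2.1) := by
    rw [sPoly, ← Finset.sum_add_distrib]
    refine Finset.sum_congr rfl fun p _ => ?_
    rw [← smul_add, ← Finset.sum_add_distrib, frameMul]
    simp only [smul_smul, mul_comm]
  rw [this]
  simp only [sPoly, smul_eq_mul]
  abel

/-- The linearized equation in the frame `(∂_θ W, ∂_s W)`. -/
theorem linearized_frame (hg : UnperturbedExpansion X om₀ lam₀ g w) {a₁ a₂ : ℝ × ℝ × ℝ → ℝ}
    (h₁ : ContDiff ℝ ∞ a₁) (h₂ : ContDiff ℝ ∞ a₂) (θ : ℝ) :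
    ∀ᶠ v in 𝓝 ((0 : ℝ), θ, (0 : ℝ)),
      om₀ • dirDeriv ℝ (0, 1, 0) (fun v => a₁ v • dirDeriv ℝ (0, 1, 0) g v
          + a₂ v • dirDeriv ℝ (0, 0, 1) g v) v
        + (v.2.2 * lam₀) • dirDeriv ℝ (0, 0, 1) (fun v => a₁ v • dirDeriv ℝ (0, 1, 0) g v
          + a₂ v • dirDeriv ℝ (0, 0, 1) g v) v
        - fderiv ℝ X (g v) (a₁ v • dirDeriv ℝ (0, 1, 0) g v + a₂ v • dirDeriv ℝ (0, 0, 1) g v)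
      = (om₀ * dirDeriv ℝ (0, 1, 0) a₁ v + v.2.2 * lam₀ * dirDeriv ℝ (0, 0, 1) a₁ v) •
          dirDeriv ℝ (0, 1, 0) g v
        + (om₀ * dirDeriv ℝ (0, 1, 0) a₂ v + v.2.2 * lam₀ * dirDeriv ℝ (0, 0, 1) a₂ v
          - lam₀ * a₂ v) • dirDeriv ℝ (0, 0, 1) g v := by
  have hd1 : ∀ {E : Type} [NormedAddCommGroup E] [NormedSpace ℝ E] {h : ℝ × ℝ × ℝ → E},
      ContDiffAt ℝ ∞ h (0, θ, 0) → ∀ᶠ v in 𝓝 ((0 : ℝ), θ, (0 : ℝ)), DifferentiableAt ℝ h v := by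
    intro E _ _ h hh
    have h1 : ContDiffAt ℝ 1 h (0, θ, 0) := by simpa using contDiffAt_infty.1 hh 1
    filter_upwards [h1.eventually (by simp)] with v hv using hv.differentiableAt (by simp)
  have hX : ∀ᶠ v in 𝓝 ((0 : ℝ), θ, (0 : ℝ)), DifferentiableAt ℝ X (g v) := by
    have h1 : ContDiffAt ℝ 1 X (g (0, θ, 0)) := by
      rw [hg.value]
      simpa using contDiffAt_infty.1 (hg.field θ) 1
    filter_upwards [(hg.smooth θ).continuousAt.eventually (h1.eventually (by simp))] with v hv
      using hv.differentiableAt (by simp)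
  have d2 := (hg.smooth θ).dirDeriv_infty (0, 1, 0)
  have d3 := (hg.smooth θ).dirDeriv_infty (0, 0, 1)
  filter_upwards [(hg.solves θ).eventually_nhds, hd1 (hg.smooth θ), hd1 d2, hd1 d3, hX,
    dirDeriv_comm (hg.smooth θ) (0, 1, 0) (0, 0, 1)] with v hv hgv hd2 hd3 hXv hcomm
  have hda1 : DifferentiableAt ℝ a₁ v := h₁.differentiable (by simp) v
  have hda2 : DifferentiableAt ℝ a₂ v := h₂.differentiable (by simp) v
  -- Differentiate the invariance equation, which holds near `v`, in the direction `e`: this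
  -- expresses `DX(g) ∂_e g` through second derivatives of `g`.
  have hfield : ∀ e, fderiv ℝ X (g v) (dirDeriv ℝ e g v) =
      dirDeriv ℝ e (fun v => om₀ • dirDeriv ℝ ((0 : ℝ), (1 : ℝ), (0 : ℝ)) g v
      + (v.2.2 * lam₀) • dirDeriv ℝ ((0 : ℝ), (0 : ℝ), (1 : ℝ)) g v) v := by
    intro e
    have h1 : (fun v => om₀ • dirDeriv ℝ ((0 : ℝ), (1 : ℝ), (0 : ℝ)) g v
      + (v.2.2 * lam₀) • dirDeriv ℝ ((0 : ℝ), (0 : ℝ), (1 : ℝ)) g v) =ᶠ[𝓝 v] X ∘ g := hv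
    rw [(h1.dirDeriv e).eq_of_nhds, dirDeriv, dirDeriv, fderiv_comp v hXv hgv]
    rfl
  have hsl : DifferentiableAt ℝ (fun v : ℝ × ℝ × ℝ => v.2.2 * lam₀) v := by fun_prop
  have hsl2 : dirDeriv ℝ ((0 : ℝ), (1 : ℝ), (0 : ℝ)) (fun v : ℝ × ℝ × ℝ => v.2.2 * lam₀) v = 0 := by
    refine dirDeriv_eq_of_hasDerivAt hsl ?_
    simpa using hasDerivAt_const (0 : ℝ) (v.2.2 * lam₀)
  -- The coefficient `s λ₀` depends on `s` but not on `θ`. This asymmetry is the source of the term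
  -- `-λ₀ a₂`, hence of `-λ₀` in the equation for `A₂`.
  have hsl3 : dirDeriv ℝ ((0 : ℝ), (0 : ℝ), (1 : ℝ)) (fun v : ℝ × ℝ × ℝ => v.2.2 * lam₀) v
      = lam₀ := by
    refine dirDeriv_eq_of_hasDerivAt hsl ?_
    simpa using ((hasDerivAt_id (0 : ℝ)).const_add v.2.2).mul_const lam₀
  have hconst : ∀ e, dirDeriv ℝ e (fun _ : ℝ × ℝ × ℝ => om₀) v = 0 := by
    intro e; simp [dirDeriv]
  have hc : DifferentiableAt ℝ (fun _ : ℝ × ℝ × ℝ => om₀) v := differentiableAt_const _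
  have hF : ∀ e, fderiv ℝ X (g v) (dirDeriv ℝ e g v) =
      om₀ • dirDeriv ℝ e (dirDeriv ℝ (0, 1, 0) g) v
      + ((v.2.2 * lam₀) • dirDeriv ℝ e (dirDeriv ℝ (0, 0, 1) g) v
      + dirDeriv ℝ e (fun v : ℝ × ℝ × ℝ => v.2.2 * lam₀) v • dirDeriv ℝ (0, 0, 1) g v) := by
    intro e
    rw [hfield, dirDeriv_fun_add (hc.fun_smul hd2) (hsl.fun_smul hd3), dirDeriv_smul hc hd2,
      dirDeriv_smul hsl hd3, hconst, zero_smul, add_zero]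
  have hΦ : ∀ e, dirDeriv ℝ e (fun v => a₁ v • dirDeriv ℝ (0, 1, 0) g v
          + a₂ v • dirDeriv ℝ (0, 0, 1) g v) v =
      (a₁ v • dirDeriv ℝ e (dirDeriv ℝ (0, 1, 0) g) v + dirDeriv ℝ e a₁ v •
        dirDeriv ℝ (0, 1, 0) g v) + (a₂ v • dirDeriv ℝ e (dirDeriv ℝ (0, 0, 1) g) v
        + dirDeriv ℝ e a₂ v • dirDeriv ℝ (0, 0, 1) g v) := by
    intro e
    rw [dirDeriv_fun_add (hda1.fun_smul hd2) (hda2.fun_smul hd3), dirDeriv_smul hda1 hd2,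
      dirDeriv_smul hda2 hd3]
  rw [map_add, map_smul, map_smul, hF, hF, hsl2, hsl3, hΦ, hΦ, hcomm]
  module

/-- The linearized equation at the truncated unperturbed parameterization, for a correction
which solves the equations in the frame `(∂_θ W, ∂_s W)`. -/
theorem linearized_isBigO (hg : UnperturbedExpansion X om₀ lam₀ g w) {E V : ℕ → ℝ → Plane}
    {α β : ℝ} {A₁ A₂ E₁ E₂ : ℕ → ℝ → ℝ}
    (hA₁ : ∀ p, ContDiff ℝ ∞ (A₁ p)) (hA₂ : ∀ p, ContDiff ℝ ∞ (A₂ p))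
    (hE₁ : ∀ p, ContDiff ℝ ∞ (E₁ p)) (hE₂ : ∀ p, ContDiff ℝ ∞ (E₂ p))
    (hVs : ∀ p, ContDiff ℝ ∞ (V p))
    (hV : ∀ p, V p = frameMul w A₁ A₂ p) (hE : ∀ p, E p = frameMul w E₁ E₂ p)
    (h₁ : ∀ p θ, om₀ * deriv (A₁ p) θ + lam₀ * p * A₁ p θ + (if p = 0 then α else 0) = -E₁ p θ)
    (h₂ : ∀ p θ, om₀ * deriv (A₂ p) θ + lam₀ * ((p : ℝ) - 1) * A₂ p θ
      + (if p = 1 then β else 0) = -E₂ p θ) (P : ℕ) (θ : ℝ) :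
    (fun v => om₀ • dirDeriv ℝ (0, 1, 0) (sPoly (P + 1) V) v
        + (v.2.2 * lam₀) • dirDeriv ℝ (0, 0, 1) (sPoly (P + 1) V) v
        + α • dirDeriv ℝ (0, 1, 0) (sPoly (P + 1) w) v
        + (v.2.2 * β) • dirDeriv ℝ (0, 0, 1) (sPoly (P + 1) w) v
        - fderiv ℝ X (sPoly (P + 1) w v) (sPoly (P + 1) V v)
        + sPoly (P + 1) E v) =O[𝓝 ((0 : ℝ), θ, (0 : ℝ))] fun v => v.2.2 ^ (P + 1) := by
  have hVeq : V = frameMul w A₁ A₂ := funext hV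
  have hEeq : E = frameMul w E₁ E₂ := funext hE
  have ha₁ := contDiff_sPoly hA₁ (P + 1)
  have ha₂ := contDiff_sPoly hA₂ (P + 1)
  have hu := contDiff_sPoly hg.smooth_coeff (P + 1)
  have hh := contDiff_sPoly hVs (P + 1)
  set u := sPoly (P + 1) w with hudef
  set h := sPoly (P + 1) V with hhdef
  set a₁ := sPoly (P + 1) A₁ with ha₁def
  set a₂ := sPoly (P + 1) A₂ with ha₂def
  set Φ : ℝ × ℝ × ℝ → Plane := fun v => a₁ v • dirDeriv ℝ (0, 1, 0) g v
    + a₂ v • dirDeriv ℝ (0, 0, 1) g v with hΦ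
  have hΦs : ContDiffAt ℝ ∞ Φ (0, θ, 0) :=
    (ha₁.contDiffAt.smul ((hg.smooth θ).dirDeriv_infty _)).add
      (ha₂.contDiffAt.smul ((hg.smooth θ).dirDeriv_infty _))
  have hd1 : ∀ {h : ℝ × ℝ × ℝ → Plane},
      ContDiffAt ℝ ∞ h (0, θ, 0) → ∀ᶠ v in 𝓝 ((0 : ℝ), θ, (0 : ℝ)), DifferentiableAt ℝ h v := by
    intro h hh
    have h1 : ContDiffAt ℝ 1 h (0, θ, 0) := by simpa using contDiffAt_infty.1 hh 1
    filter_upwards [h1.eventually (by simp)] with v hv using hv.differentiableAt (by simp)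
  -- replace the truncations by the exact functions
  have key : ∀ {q q' : ℝ × ℝ × ℝ → Plane}, ContDiffAt ℝ ∞ q (0, θ, 0) →
      ContDiffAt ℝ ∞ q' (0, θ, 0) →
      (fun v => q v - q' v) =O[𝓝 ((0 : ℝ), θ, (0 : ℝ))] (fun v => v.2.2 ^ (P + 1)) →
      (fun v => dirDeriv ℝ (0, 1, 0) q v - dirDeriv ℝ (0, 1, 0) q' v)
        =O[𝓝 ((0 : ℝ), θ, (0 : ℝ))] (fun v => v.2.2 ^ (P + 1)) ∧
      ∀ c : ℝ, (fun v => (v.2.2 * c) • dirDeriv ℝ (0, 0, 1) q v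
          - (v.2.2 * c) • dirDeriv ℝ (0, 0, 1) q' v)
        =O[𝓝 ((0 : ℝ), θ, (0 : ℝ))] (fun v => v.2.2 ^ (P + 1)) := by
    intro q q' hq hq' hO
    have hsub : ∀ e, dirDeriv ℝ e (fun v => q v - q' v) =ᶠ[𝓝 (0, θ, 0)]
        fun v => dirDeriv ℝ e q v - dirDeriv ℝ e q' v := by
      intro e
      filter_upwards [hd1 hq, hd1 hq'] with v h1 h2
      simp [dirDeriv, fderiv_fun_sub h1 h2]
    constructor
    · exact (isBigO_dirDeriv sCoord (e := (0, 0, 1)) (a := (0, 1, 0)) rfl rfl (v₀ := (0, θ, 0)) rfl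
        (hq.sub hq') hO).congr' (hsub _) .rfl
    · intro c
      have h1 := (isBigO_dirDeriv_transversal sCoord (e := (0, 0, 1)) rfl (v₀ := (0, θ, 0)) rfl
        (hq.sub hq') hO).congr' (hsub _) .rfl
      have h2 := ((Asymptotics.isBigO_refl (fun v : ℝ × ℝ × ℝ => v.2.2)
        (𝓝 ((0 : ℝ), θ, (0 : ℝ)))).smul h1).const_smul_left c
      refine h2.congr (fun v => ?_) (fun v => ?_)
      · simp only [Pi.smul_apply]
        rw [smul_smul, mul_comm c, smul_sub]
      · simp [pow_succ']
  have huO : (fun v => u v - g v) =O[𝓝 ((0 : ℝ), θ, (0 : ℝ))] (fun v => v.2.2 ^ (P + 1)) :=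
    (hg.taylor (P + 1) θ).symm
  have hhO : (fun v => h v - Φ v) =O[𝓝 ((0 : ℝ), θ, (0 : ℝ))] (fun v => v.2.2 ^ (P + 1)) := by
    have := hg.isBigO_frameMul hA₁ hA₂ (P + 1) θ
    rw [← hVeq] at this
    exact this.symm
  obtain ⟨ku, ku'⟩ := key hu.contDiffAt (hg.smooth θ) huO
  obtain ⟨kh, kh'⟩ := key hh.contDiffAt hΦs hhO
  have hlim0 : Tendsto (fun v : ℝ × ℝ × ℝ => v.2.2 ^ (P + 1)) (𝓝 ((0 : ℝ), θ, (0 : ℝ))) (𝓝 0) := by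
    have : Continuous (fun v : ℝ × ℝ × ℝ => v.2.2 ^ (P + 1)) := by fun_prop
    simpa using this.tendsto ((0 : ℝ), θ, (0 : ℝ))
  have hgt : Tendsto g (𝓝 ((0 : ℝ), θ, (0 : ℝ))) (𝓝 (w 0 θ)) := by
    simpa [hg.value] using (hg.smooth θ).continuousAt.tendsto
  have hut : Tendsto u (𝓝 ((0 : ℝ), θ, (0 : ℝ))) (𝓝 (w 0 θ)) := by
    simpa using (huO.trans_tendsto hlim0).add hgt
  have hΦt : Tendsto Φ (𝓝 ((0 : ℝ), θ, (0 : ℝ))) (𝓝 (Φ (0, θ, 0))) := hΦs.continuousAt.tendsto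
  have hht : Tendsto h (𝓝 ((0 : ℝ), θ, (0 : ℝ))) (𝓝 (Φ (0, θ, 0))) := by
    simpa using (hhO.trans_tendsto hlim0).add hΦt
  have hDX : ContDiffAt ℝ ∞ (fun y : Plane × Plane => fderiv ℝ X y.1 y.2)
      (w 0 θ, Φ (0, θ, 0)) := by
    have h1 : ContDiffAt ℝ ∞ (fderiv ℝ X) (w 0 θ) := (hg.field θ).fderiv_right (by simp)
    exact (ContDiffAt.comp (w 0 θ, Φ (0, θ, 0)) h1 contDiffAt_fst).clm_apply contDiffAt_snd
  have hDO : (fun v => fderiv ℝ X (u v) (h v) - fderiv ℝ X (g v) (Φ v))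
      =O[𝓝 ((0 : ℝ), θ, (0 : ℝ))] (fun v => v.2.2 ^ (P + 1)) :=
    (hDX.comp_sub_comp_isBigO (by simp) (hut.prodMk_nhds hht) (hgt.prodMk_nhds hΦt)).trans
      (huO.prod_left hhO)
  have hEO := hg.isBigO_frameMul hE₁ hE₂ (P + 1) θ
  rw [← hEeq] at hEO
  -- the equations in the frame
  have hT₁ : ∀ v : ℝ × ℝ × ℝ, om₀ * dirDeriv ℝ (0, 1, 0) a₁ v
      + v.2.2 * lam₀ * dirDeriv ℝ (0, 0, 1) a₁ v + α = -sPoly (P + 1) E₁ v := by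
    intro v
    have h3 : v.2.2 * lam₀ * dirDeriv ℝ (0, 0, 1) a₁ v
        = lam₀ * sPoly (P + 1) (fun p θ => (p : ℝ) • A₁ p θ) v := by
      rw [← smul_dirDeriv_s_sPoly hA₁, smul_eq_mul]; ring
    rw [h3, ha₁def, dirDeriv_theta_sPoly hA₁]
    have h4 : α = ∑ p ∈ Finset.range (P + 1), v.2.2 ^ p * (if p = 0 then α else 0) := by
      rw [Finset.sum_eq_single_of_mem 0 (by simp) (fun p _ hp => by simp [hp])]
      simp
    conv_lhs => rw [h4]
    simp only [sPoly, smul_eq_mul, Finset.mul_sum, ← Finset.sum_add_distrib,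
      ← Finset.sum_neg_distrib]
    refine Finset.sum_congr rfl fun p _ => ?_
    rw [← mul_neg, ← h₁ p]
    ring
  have hT₂ : ∀ v : ℝ × ℝ × ℝ, om₀ * dirDeriv ℝ (0, 1, 0) a₂ v
      + v.2.2 * lam₀ * dirDeriv ℝ (0, 0, 1) a₂ v - lam₀ * a₂ v
      + ∑ p ∈ Finset.range (P + 1), v.2.2 ^ p * (if p = 1 then β else 0)
      = -sPoly (P + 1) E₂ v := by
    intro v
    have h3 : v.2.2 * lam₀ * dirDeriv ℝ (0, 0, 1) a₂ v
        = lam₀ * sPoly (P + 1) (fun p θ => (p : ℝ) • A₂ p θ) v := by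
      rw [← smul_dirDeriv_s_sPoly hA₂, smul_eq_mul]; ring
    rw [h3, ha₂def, dirDeriv_theta_sPoly hA₂]
    simp only [sPoly, smul_eq_mul, Finset.mul_sum, ← Finset.sum_add_distrib,
      ← Finset.sum_neg_distrib, ← Finset.sum_sub_distrib]
    refine Finset.sum_congr rfl fun p _ => ?_
    rw [← mul_neg, ← h₂ p]
    ring
  -- The equations in the frame contain `β` through the term `p = 1`. For `P = 0` this term is cut
  -- off, but then `s β` itself is within the admitted error; for larger `P` the difference is zero.
  have hβ : (fun v : ℝ × ℝ × ℝ => (v.2.2 * β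
      - ∑ p ∈ Finset.range (P + 1), v.2.2 ^ p * (if p = 1 then β else 0)) •
        dirDeriv ℝ (0, 0, 1) g v) =O[𝓝 ((0 : ℝ), θ, (0 : ℝ))] (fun v => v.2.2 ^ (P + 1)) := by
    rcases P with _ | P
    · have := isBigO_pow_smul (c := fun v : ℝ × ℝ × ℝ => v.2.2) (x := ((0 : ℝ), θ, (0 : ℝ)))
        (h := fun v => β • dirDeriv ℝ (0, 0, 1) g v) (by fun_prop)
        (((hg.smooth θ).dirDeriv_infty _).continuousAt.const_smul β) (le_refl 1)
      simpa [smul_smul] using this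
    · have : ∀ v : ℝ × ℝ × ℝ, v.2.2 * β
          - ∑ p ∈ Finset.range (P + 1 + 1), v.2.2 ^ p * (if p = 1 then β else 0) = 0 := by
        intro v
        rw [Finset.sum_eq_single_of_mem 1 (by simp) (fun p _ hp => by simp [hp])]
        simp
      simp only [this, zero_smul]
      exact Asymptotics.isBigO_zero _ _
  -- The sum of all the errors made in replacing truncations by exact functions. The exact functions
  -- themselves cancel by `linearized_frame` and the equations for `A₁` and `A₂`.
  have hall := ((((kh.const_smul_left om₀).add (kh' lam₀)).add
    ((ku.const_smul_left α).add (ku' β))).sub hDO).add (hβ.sub hEO)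
  refine hall.congr' ?_ .rfl
  filter_upwards [hg.linearized_frame ha₁ ha₂ θ] with v hv
  simp only [Pi.smul_apply]
  have e1 : om₀ * dirDeriv ℝ (0, 1, 0) a₁ v + v.2.2 * lam₀ * dirDeriv ℝ (0, 0, 1) a₁ v
      = -sPoly (P + 1) E₁ v - α := by rw [← hT₁ v]; ring
  have e2 : om₀ * dirDeriv ℝ (0, 1, 0) a₂ v + v.2.2 * lam₀ * dirDeriv ℝ (0, 0, 1) a₂ v
      - lam₀ * a₂ v = -sPoly (P + 1) E₂ v
      - ∑ p ∈ Finset.range (P + 1), v.2.2 ^ p * (if p = 1 then β else 0) := by rw [← hT₂ v]; ring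
  rw [e1, e2] at hv
  change om₀ • dirDeriv ℝ (0, 1, 0) Φ v + (v.2.2 * lam₀) • dirDeriv ℝ (0, 0, 1) Φ v
    - fderiv ℝ X (g v) (Φ v) = _ at hv
  have hv' : om₀ • dirDeriv ℝ (0, 1, 0) Φ v + (v.2.2 * lam₀) • dirDeriv ℝ (0, 0, 1) Φ v
    = fderiv ℝ X (g v) (Φ v) + ((-sPoly (P + 1) E₁ v - α) • dirDeriv ℝ (0, 1, 0) g v
      + (-sPoly (P + 1) E₂ v
      - ∑ p ∈ Finset.range (P + 1), v.2.2 ^ p * (if p = 1 then β else 0)) •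
        dirDeriv ℝ (0, 0, 1) g v) := by rw [← hv]; abel
  rw [smul_sub om₀, eq_sub_of_add_eq hv']
  module

end UnperturbedExpansion

/-! ### The given parameterization and its Taylor coefficients. -/

section Parameterization

variable {k : DelayKind} {f : ℝ × Plane × Plane → Plane} {r : Plane → ℝ} {δ om₀ lam₀ : ℝ}
  {W₀ : ℝ → ℝ → Plane}

theorem IsLimitCycleParam.contDiffAt (h : IsLimitCycleParam k f δ om₀ lam₀ W₀) (v : ℝ × ℝ × ℝ)
    (hv : |v.2.2| < δ) : ContDiffAt ℝ ∞ (fun v : ℝ × ℝ × ℝ => W₀ v.2.1 v.2.2) v := by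
  have h1 : ContDiffAt ℝ ∞ (Function.uncurry W₀) v.2 :=
    h.smooth.contDiffAt ((isOpen_univ.prod isOpen_Ioo).mem_nhds ⟨trivial, abs_lt.1 hv⟩)
  exact ContDiffAt.comp v h1 contDiffAt_snd

theorem IsLimitCycleParam.smoothAtCycle (h : IsLimitCycleParam k f δ om₀ lam₀ W₀) :
    SmoothAtCycle (fun v : ℝ × ℝ × ℝ => W₀ v.2.1 v.2.2) :=
  fun _ => h.contDiffAt _ (by simpa using h.delta_pos)

theorem isOpen_abs_s_lt (δ : ℝ) : IsOpen {v : ℝ × ℝ × ℝ | |v.2.2| < δ} :=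
  isOpen_lt (by fun_prop) continuous_const

theorem IsLimitCycleParam.sCoeff_eq (h : IsLimitCycleParam k f δ om₀ lam₀ W₀) (p : ℕ) :
    sCoeff W₀ p = jetCoeff 0 p (fun v : ℝ × ℝ × ℝ => W₀ v.2.1 v.2.2) := by
  ext1 θ
  have h1 := iteratedDeriv_line_eq_iterate_dirDeriv (𝕜 := ℝ)
    (g := fun v : ℝ × ℝ × ℝ => W₀ v.2.1 v.2.2) (isOpen_abs_s_lt δ) (0, 0, 1) (0, θ, 0)
    (fun m v hv => ((h.contDiffAt v hv).iterate_dirDeriv_infty _ m).differentiableAt (by simp)) p 0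
    (by simpa using h.delta_pos)
  simp only [Prod.smul_mk, smul_eq_mul, mul_zero, mul_one, Prod.mk_add_mk, add_zero, zero_add] at h1
  rw [sCoeff, h1]
  simp [jetCoeff, jetDeriv]

theorem IsLimitCycleParam.contDiff_sCoeff (h : IsLimitCycleParam k f δ om₀ lam₀ W₀) (p : ℕ) :
    ContDiff ℝ ∞ (sCoeff W₀ p) := by
  rw [h.sCoeff_eq]
  exact h.smoothAtCycle.contDiff_jetCoeff 0 p

theorem sCoeff_zero (W₀ : ℝ → ℝ → Plane) (θ : ℝ) : sCoeff W₀ 0 θ = W₀ θ 0 := by simp [sCoeff]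

theorem IsLimitCycleParam.periodic_sCoeff (h : IsLimitCycleParam k f δ om₀ lam₀ W₀) (p : ℕ) :
    Function.Periodic (sCoeff W₀ p) 1 := by
  intro θ
  have h1 : (fun s => W₀ (θ + 1) s) =ᶠ[𝓝 0] fun s => W₀ θ s := by
    filter_upwards [Metric.ball_mem_nhds (0 : ℝ) h.delta_pos] with s hs
    exact h.periodic θ s (by simpa using hs)
  rw [sCoeff, sCoeff, h1.iteratedDeriv_eq]

/-- The invariance equation is the statement that `W₀` carries `(θ₀ + ω₀ t, s₀ e^{λ₀ t})` to
solutions, read at `t = 0` through the chain rule. -/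
theorem IsLimitCycleParam.unperturbedExpansion (h : IsLimitCycleParam k f δ om₀ lam₀ W₀)
    (hf : ∀ θ, ContDiffAt ℝ ∞ f (0, W₀ θ 0, k.base (W₀ θ 0))) :
    UnperturbedExpansion (fun x => f (0, x, k.base x)) om₀ lam₀
      (fun v : ℝ × ℝ × ℝ => W₀ v.2.1 v.2.2) (sCoeff W₀) where
  smooth := h.smoothAtCycle
  smooth_coeff := h.contDiff_sCoeff
  taylor P θ := by
    have h1 := taylor_dir_isBigO sCoord (e := (0, 0, 1)) rfl (v₀ := (0, θ, 0)) rfl P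
      (contDiffAt_infty.1 (h.smoothAtCycle θ) P)
    -- the coefficients do not depend on the first variable
    have h2 : ∀ (p : ℕ) (ε θ s : ℝ), |s| < δ →
        (dirDeriv ℝ (0, 0, 1))^[p] (fun v : ℝ × ℝ × ℝ => W₀ v.2.1 v.2.2) (ε, θ, s) =
        iteratedDeriv p (fun s => W₀ θ s) s := by
      intro p ε θ s hs
      have := iteratedDeriv_line_eq_iterate_dirDeriv (𝕜 := ℝ)
        (g := fun v : ℝ × ℝ × ℝ => W₀ v.2.1 v.2.2) (isOpen_abs_s_lt δ) (0, 0, 1) (ε, θ, 0)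
        (fun m v hv => ((h.contDiffAt v hv).iterate_dirDeriv_infty _ m).differentiableAt
          (by simp)) p s (by simpa using hs)
      simpa using this.symm
    refine h1.congr_left fun v => ?_
    congr 1
    refine Finset.sum_congr rfl fun p _ => ?_
    have hv : v - sCoord v • ((0 : ℝ), (0 : ℝ), (1 : ℝ)) = (v.1, v.2.1, 0) := by ext <;> simp
    rw [hv, h2 p _ _ _ (by simpa using h.delta_pos), sCoeff, smul_smul, sCoord_apply]
    congr 1
    ring
  value θ := (sCoeff_zero W₀ θ).symm
  field θ := by
    rw [sCoeff_zero]
    exact ContDiffAt.comp (W₀ θ 0) (hf θ)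
      (contDiffAt_const.prodMk (contDiffAt_id.prodMk k.contDiff_base.contDiffAt))
  solves θ := by
    filter_upwards [(isOpen_abs_s_lt δ).mem_nhds
      (show ((0 : ℝ), θ, (0 : ℝ)) ∈ {v : ℝ × ℝ × ℝ | |v.2.2| < δ} by simpa using h.delta_pos)]
      with v hv
    have h1 := h.solution v.2.1 v.2.2 0 (by simpa using hv)
    have hd := ((h.contDiffAt v hv).differentiableAt (by simp)).hasFDerivAt
    have h2 : HasDerivAt (fun τ : ℝ => (v.1, v.2.1 + om₀ * τ, v.2.2 * Real.exp (lam₀ * τ)))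
        ((0 : ℝ), om₀, v.2.2 * lam₀) 0 := by
      refine (hasDerivAt_const (0 : ℝ) v.1).prodMk (HasDerivAt.prodMk ?_ ?_)
      · simpa using ((hasDerivAt_id (0 : ℝ)).const_mul om₀).const_add v.2.1
      · simpa using (((hasDerivAt_id (0 : ℝ)).const_mul lam₀).exp).const_mul v.2.2
    have hd' : HasFDerivAt (fun v : ℝ × ℝ × ℝ => W₀ v.2.1 v.2.2)
        (fderiv ℝ (fun v : ℝ × ℝ × ℝ => W₀ v.2.1 v.2.2) v)
        ((v.1, v.2.1 + om₀ * 0, v.2.2 * Real.exp (lam₀ * 0))) := by simpa using hd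
    have hc : HasDerivAt (fun τ => W₀ (v.2.1 + om₀ * τ) (v.2.2 * Real.exp (lam₀ * τ)))
        (fderiv ℝ (fun v : ℝ × ℝ × ℝ => W₀ v.2.1 v.2.2) v (0, om₀, v.2.2 * lam₀)) 0 := by
      have := hd'.comp_hasDerivAt (0 : ℝ) h2
      exact this
    have h3 := hc.unique h1
    simp only [mul_zero, add_zero, Real.exp_zero, mul_one] at h3
    rw [← h3]
    have : ((0 : ℝ), om₀, v.2.2 * lam₀) = om₀ • ((0 : ℝ), (1 : ℝ), (0 : ℝ))
        + (v.2.2 * lam₀) • ((0 : ℝ), (0 : ℝ), (1 : ℝ)) := by ext <;> simp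
    rw [this, map_add, map_smul, map_smul]
    rfl

end Parameterization

/-! ### Induction on the order in `ε`. -/

section Orders

variable {k : DelayKind} {f : ℝ × Plane × Plane → Plane} {r : Plane → ℝ} {om lam : ℕ → ℝ}
  {W : ℕ → ℕ → ℝ → Plane} {g : ℝ × ℝ × ℝ → Plane}

/-- The error of the truncated series, as a function of `(ε, θ, s)`. -/
noncomputable def errorFun (k : DelayKind) (f : ℝ × Plane × Plane → Plane) (r : Plane → ℝ)
    (om lam : ℕ → ℝ) (W : ℕ → ℕ → ℝ → Plane) (n P : ℕ) (v : ℝ × ℝ × ℝ) : Plane :=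
  truncError k f r om lam W n P v.1 v.2.1 v.2.2

/-- The coefficients of the leading term of the error at order `n`. -/
noncomputable def leadingError (k : DelayKind) (f : ℝ × Plane × Plane → Plane) (r : Plane → ℝ)
    (om lam : ℕ → ℝ) (W : ℕ → ℕ → ℝ → Plane) (n p : ℕ) : ℝ → Plane :=
  jetCoeff (n + 1) p (errorFun k f r om lam W n p)

/-- The series solve the invariance equation to the order `n` in `ε`. -/
def SolvesToOrder (k : DelayKind) (f : ℝ × Plane × Plane → Plane) (r : Plane → ℝ)
    (om lam : ℕ → ℝ) (W : ℕ → ℕ → ℝ → Plane) (n : ℕ) : Prop :=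
  ∀ P, JetVanishes (n + 1) (P + 1) (errorFun k f r om lam W n P)

/-- `leadingError` reads its coefficient of index `p` from the truncation at `P = p`. Longer
truncations change the error by `O(s^{p+1})`, which that jet does not see, so one sequence serves
all `P`. -/
theorem jetCoeff_errorFun {n : ℕ} (hW : ∀ m ≤ n, ∀ p, ContDiff ℝ ∞ (W m p))
    (hr : ∀ θ, ContDiffAt ℝ ∞ r (W 0 0 θ))
    (hf : ∀ θ, ContDiffAt ℝ ∞ f (0, W 0 0 θ, k.base (W 0 0 θ))) {p P : ℕ} (hp : p ≤ P) (θ : ℝ) :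
    leadingError k f r om lam W n p θ = jetCoeff (n + 1) p (errorFun k f r om lam W n P) θ := by
  have h1 := smoothAtCycle_truncError (om := om) (lam := lam) hW hr hf p
  have h2 := smoothAtCycle_truncError (om := om) (lam := lam) hW hr hf P
  have h3 := JetVanishes.of_isBigO_s (h2.sub h1) (n + 2)
    (fun θ => truncError_sub_isBigO hW hr hf hp θ) (n + 1) (by omega) p (by omega) θ
  rw [jetDeriv_sub h2 h1, sub_eq_zero] at h3
  rw [leadingError, jetCoeff, jetCoeff]
  congr 1
  exact h3.symm

theorem contDiff_leadingError {n : ℕ} (hW : ∀ m ≤ n, ∀ p, ContDiff ℝ ∞ (W m p))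
    (hr : ∀ θ, ContDiffAt ℝ ∞ r (W 0 0 θ))
    (hf : ∀ θ, ContDiffAt ℝ ∞ f (0, W 0 0 θ, k.base (W 0 0 θ))) (p : ℕ) :
    ContDiff ℝ ∞ (leadingError k f r om lam W n p) :=
  (smoothAtCycle_truncError hW hr hf p).contDiff_jetCoeff (n + 1) p

theorem SolvesToOrder.sub_leadingError {n : ℕ} (h : SolvesToOrder k f r om lam W n)
    (hW : ∀ m ≤ n, ∀ p, ContDiff ℝ ∞ (W m p)) (hr : ∀ θ, ContDiffAt ℝ ∞ r (W 0 0 θ))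
    (hf : ∀ θ, ContDiffAt ℝ ∞ f (0, W 0 0 θ, k.base (W 0 0 θ))) (P : ℕ) :
    JetVanishes (n + 2) (P + 1) (errorFun k f r om lam W n P -
      fun v => v.1 ^ (n + 1) • sPoly (P + 1) (leadingError k f r om lam W n) v) :=
  (h P).sub_leading (smoothAtCycle_truncError hW hr hf P) (contDiff_leadingError hW hr hf)
    fun _ hp θ => jetCoeff_errorFun hW hr hf (Nat.lt_succ_iff.1 hp) θ

theorem smoothAtCycle_eps_pow_smul {a : ℝ × ℝ × ℝ → Plane} (ha : SmoothAtCycle a) (N : ℕ) :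
    SmoothAtCycle fun v => v.1 ^ N • a v :=
  fun θ => (contDiff_fst.pow N).contDiffAt.smul (ha θ)

theorem solvesToAllOrders_of_forall (h : ∀ n, SolvesToOrder k f r om lam W n)
    (hW : ∀ m p, ContDiff ℝ ∞ (W m p)) (hper : ∀ m p, Function.Periodic (W m p) 1)
    (hr : ∀ θ, ContDiffAt ℝ ∞ r (W 0 0 θ))
    (hf : ∀ θ, ContDiffAt ℝ ∞ f (0, W 0 0 θ, k.base (W 0 0 θ))) :
    SolvesToAllOrders k f r om lam W := by
  intro N P
  refine exists_uniform_bound_of_isBigO (b := fun ε s => |ε| ^ (N + 1) + |s| ^ (P + 1))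
    (fun ε s => by positivity) (truncError_periodic (fun m _ => hper m) P) fun θ => ?_
  exact (h N P).isBigO (smoothAtCycle_truncError (fun m _ => hW m) hr hf P) θ

theorem SolvesToOrder.isLeadingError {n : ℕ} (h : SolvesToOrder k f r om lam W n)
    (hW : ∀ m p, ContDiff ℝ ∞ (W m p)) (hper : ∀ m p, Function.Periodic (W m p) 1)
    (hEper : ∀ p, Function.Periodic (leadingError k f r om lam W n p) 1)
    (hr : ∀ θ, ContDiffAt ℝ ∞ r (W 0 0 θ))
    (hf : ∀ θ, ContDiffAt ℝ ∞ f (0, W 0 0 θ, k.base (W 0 0 θ))) :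
    IsLeadingError k f r om lam W n (leadingError k f r om lam W n) := by
  intro P
  have hW' : ∀ m ≤ n, ∀ p, ContDiff ℝ ∞ (W m p) := fun m _ => hW m
  refine exists_uniform_bound_of_isBigO
    (g := fun ε θ s => truncError k f r om lam W n P ε θ s - ε ^ (n + 1) •
      ∑ p ∈ Finset.range (P + 1), s ^ p • leadingError k f r om lam W n p θ)
    (b := fun ε s => |ε| ^ (n + 2) + |s| ^ (P + 1))
    (fun ε s => by positivity) (fun ε θ s => ?_) fun θ => ?_
  · rw [truncError_periodic (fun m _ => hper m)]
    simp only [hEper _ θ]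
  · exact (h.sub_leadingError hW' hr hf P).isBigO
      ((smoothAtCycle_truncError hW' hr hf P).sub (smoothAtCycle_eps_pow_smul
        (contDiff_sPoly (contDiff_leadingError hW' hr hf) _).smoothAtCycle _)) θ

theorem truncSeries_zero_eq_sPoly (P : ℕ) (θ s ε : ℝ) :
    truncSeries W 0 P ε θ s = sPoly (P + 1) (W 0) (ε, θ, s) := by
  simp [truncSeries, sPoly]

/-- The unperturbed parameterization solves the equation to order `0`. -/
theorem solvesToOrder_zero
    (hg : UnperturbedExpansion (fun x => f (0, x, k.base x)) (om 0) (lam 0) g (W 0))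
    (hr : ∀ θ, ContDiffAt ℝ ∞ r (W 0 0 θ))
    (hf : ∀ θ, ContDiffAt ℝ ∞ f (0, W 0 0 θ, k.base (W 0 0 θ))) :
    SolvesToOrder k f r om lam W 0 := by
  intro P
  have hW : ∀ m ≤ 0, ∀ p, ContDiff ℝ ∞ (W m p) := by
    intro m hm
    obtain rfl : m = 0 := Nat.le_zero.1 hm
    exact hg.smooth_coeff
  have hs : SmoothAtCycle (errorFun k f r om lam W 0 P) := smoothAtCycle_truncError hW hr hf P
  -- The error restricted to `ε = 0`, extended independently of `ε`. It differs from the error by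
  -- `O(ε)`, which is negligible at this order.
  set Z : ℝ × ℝ × ℝ → Plane := fun v => errorFun k f r om lam W 0 P (0, v.2) with hZ
  have hZs : SmoothAtCycle Z := fun θ => ContDiffAt.comp
    (g := errorFun k f r om lam W 0 P) (f := fun v : ℝ × ℝ × ℝ => (0, v.2)) (0, θ, 0) (hs θ)
    (contDiffAt_const.prodMk contDiffAt_snd)
  have h1 : JetVanishes 1 (P + 1) (errorFun k f r om lam W 0 P - Z) := by
    refine JetVanishes.of_isBigO_eps (hs.sub hZs) (P + 1) fun θ => ?_
    refine (taylor_dir_isBigO epsCoord (e := (1, 0, 0)) rfl (v₀ := (0, θ, 0)) rfl 1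
      (contDiffAt_infty.1 (hs θ) 1)).congr_left fun v => ?_
    simp [hZ, errorFun]
  -- At `ε = 0` the equation holds exactly for `g`, and the truncation `u` differs from `g` by
  -- `O(s^{P+1})`, so the error is of that order too.
  have h2 : JetVanishes 1 (P + 1) Z := by
    refine JetVanishes.of_isBigO_s hZs 1 fun θ => ?_
    set u := sPoly (P + 1) (W 0) with hu
    have hus : ContDiff ℝ ∞ u := contDiff_sPoly hg.smooth_coeff _
    have huO : (fun v => u v - g v) =O[𝓝 ((0 : ℝ), θ, (0 : ℝ))] (fun v => v.2.2 ^ (P + 1)) :=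
      (hg.taylor (P + 1) θ).symm
    have hsub : ∀ e, dirDeriv ℝ e (fun v => u v - g v) =ᶠ[𝓝 (0, θ, 0)]
        fun v => dirDeriv ℝ e u v - dirDeriv ℝ e g v := by
      intro e
      have h1 : ContDiffAt ℝ 1 g (0, θ, 0) := by simpa using contDiffAt_infty.1 (hg.smooth θ) 1
      filter_upwards [h1.eventually (by simp)] with v hv
      simp [dirDeriv, fderiv_fun_sub (hus.differentiable (by simp) v)
        (hv.differentiableAt (by simp))]
    have h3 := (isBigO_dirDeriv sCoord (e := (0, 0, 1)) (a := (0, 1, 0)) rfl rfl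
      (v₀ := (0, θ, 0)) rfl (hus.contDiffAt.sub (hg.smooth θ)) huO).congr' (hsub _) .rfl
    have h4 := (isBigO_dirDeriv_transversal sCoord (e := (0, 0, 1)) rfl
      (v₀ := (0, θ, 0)) rfl (hus.contDiffAt.sub (hg.smooth θ)) huO).congr' (hsub _) .rfl
    have h5 := (Asymptotics.isBigO_refl (fun v : ℝ × ℝ × ℝ => v.2.2)
        (𝓝 ((0 : ℝ), θ, (0 : ℝ)))).smul h4
    simp only [sCoord_apply, smul_eq_mul, ← pow_succ'] at h5
    have hgt : Tendsto g (𝓝 ((0 : ℝ), θ, (0 : ℝ))) (𝓝 (W 0 0 θ)) := by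
      simpa [hg.value] using (hg.smooth θ).continuousAt.tendsto
    have hut : Tendsto u (𝓝 ((0 : ℝ), θ, (0 : ℝ))) (𝓝 (W 0 0 θ)) := by
      have := hus.continuous.tendsto ((0 : ℝ), θ, (0 : ℝ))
      simpa [hu, sPoly, Finset.sum_range_succ'] using this
    have h6 := ((hg.field θ).comp_sub_comp_isBigO (by simp) hut hgt).trans huO
    refine (((h3.const_smul_left (om 0)).add (h5.const_smul_left (lam 0))).sub h6).congr' ?_ .rfl
    filter_upwards [hg.solves θ] with v hv
    have hdu : ∀ v, DifferentiableAt ℝ (fun x : ℝ × ℝ × ℝ => truncSeries W 0 P x.1 x.2.1 x.2.2) v :=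
      (contDiff_truncSeries hW P).differentiable (by simp)
    have htu : (fun x : ℝ × ℝ × ℝ => truncSeries W 0 P x.1 x.2.1 x.2.2) = u := by
      ext1 x
      rw [truncSeries_zero_eq_sPoly]
    have hu0 : ∀ v : ℝ × ℝ × ℝ, u (0, v.2) = u v := fun v => rfl
    have hdu0 : ∀ e : ℝ × ℝ, dirDeriv ℝ (0, e) u (0, v.2) = dirDeriv ℝ (0, e) u v := by
      intro e
      have := hus.differentiable (by simp)
      have h7 : HasDerivAt (fun t : ℝ => u (v + t • ((0 : ℝ), e))) (dirDeriv ℝ (0, e) u v) 0 := by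
        have h1 : HasDerivAt (fun t : ℝ => v + t • ((0 : ℝ), e)) ((0 : ℝ), e) 0 := by
          simpa using ((hasDerivAt_id (0 : ℝ)).smul_const ((0 : ℝ), e)).const_add v
        have h8 : HasFDerivAt u (fderiv ℝ u v) (v + (0 : ℝ) • ((0 : ℝ), e)) := by
          simpa using (this v).hasFDerivAt
        exact h8.comp_hasDerivAt (0 : ℝ) h1
      exact dirDeriv_eq_of_hasDerivAt (this _) h7
    simp only [hZ, errorFun, truncError, invarianceError, delayedArg_zero, truncScalar_zero]
    rw [deriv_theta_eq_dirDeriv (hdu _), deriv_s_eq_dirDeriv (hdu _), htu, hdu0, hdu0,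
      truncSeries_zero_eq_sPoly]
    simp only [Pi.smul_apply]
    rw [← hv]
    have : sPoly (P + 1) (W 0) (0, v.2.1, v.2.2) = u v := rfl
    rw [this]
    module
  have := h1.add (hs.sub hZs) hZs h2
  simpa using this

/-- The linear equations for the correction increase the order in `ε`. -/
theorem SolvesToOrder.succ {n : ℕ} (h : SolvesToOrder k f r om lam W n)
    (hg : UnperturbedExpansion (fun x => f (0, x, k.base x)) (om 0) (lam 0) g (W 0))
    (hW : ∀ m ≤ n + 1, ∀ p, ContDiff ℝ ∞ (W m p)) (hr : ∀ θ, ContDiffAt ℝ ∞ r (W 0 0 θ))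
    (hf : ∀ θ, ContDiffAt ℝ ∞ f (0, W 0 0 θ, k.base (W 0 0 θ)))
    (hc : IsCorrection (om 0) (lam 0) (W 0) (leadingError k f r om lam W n) (W (n + 1))
      (om (n + 1)) (lam (n + 1))) :
    SolvesToOrder k f r om lam W (n + 1) := by
  intro P
  obtain ⟨A₁, A₂, E₁, E₂, hA₁, hA₂, hV, hE, e₁, e₂⟩ := hc
  have hW' : ∀ m ≤ n, ∀ p, ContDiff ℝ ∞ (W m p) := fun m hm => hW m (by omega)
  -- Smoothness of the components of the error is not part of `IsCorrection`; it is read off from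
  -- the equations, whose other terms are smooth.
  have hE₁ : ∀ p, ContDiff ℝ ∞ (E₁ p) := by
    intro p
    have : E₁ p = fun θ => -(om 0 * deriv (A₁ p) θ + lam 0 * p * A₁ p θ
        + (if p = 0 then om (n + 1) else 0)) := by ext θ; rw [e₁, neg_neg]
    rw [this]
    have h1 : ContDiff ℝ ∞ (deriv (A₁ p)) := (contDiff_infty_iff_deriv.1 (hA₁ p).1).2
    exact ((contDiff_const.mul h1).add (contDiff_const.mul (hA₁ p).1)).add contDiff_const |>.neg
  have hE₂ : ∀ p, ContDiff ℝ ∞ (E₂ p) := by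
    intro p
    have : E₂ p = fun θ => -(om 0 * deriv (A₂ p) θ + lam 0 * ((p : ℝ) - 1) * A₂ p θ
        + (if p = 1 then lam (n + 1) else 0)) := by ext θ; rw [e₂, neg_neg]
    rw [this]
    have h1 : ContDiff ℝ ∞ (deriv (A₂ p)) := (contDiff_infty_iff_deriv.1 (hA₂ p).1).2
    exact ((contDiff_const.mul h1).add (contDiff_const.mul (hA₂ p).1)).add contDiff_const |>.neg
  have hlin := hg.linearized_isBigO (fun p => (hA₁ p).1) (fun p => (hA₂ p).1) hE₁ hE₂
    (hW (n + 1) le_rfl) (fun p => funext (hV p)) (fun p => funext (hE p)) e₁ e₂ P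
  -- the family joining the two truncations
  set hh := sPoly (P + 1) (W (n + 1)) with hhdef
  have hhs : ContDiff ℝ ∞ hh := contDiff_sPoly (hW (n + 1) le_rfl) _
  let U : ℝ × ℝ → ℝ → ℝ → Plane := fun q θ s => truncSeries W n P q.2 θ s + q.1 • hh (0, θ, s)
  let a : ℝ × ℝ → ℝ := fun q => truncScalar om n q.2 + q.1 * om (n + 1)
  let b : ℝ × ℝ → ℝ := fun q => truncScalar lam n q.2 + q.1 * lam (n + 1)
  let Ψ : (ℝ × ℝ) × ℝ × ℝ → Plane := fun x =>
    invarianceError k f r x.1.2 (a x.1) (b x.1) (U x.1) x.2.1 x.2.2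
  have hU : ContDiff ℝ ∞ (fun x : (ℝ × ℝ) × ℝ × ℝ => U x.1 x.2.1 x.2.2) :=
    ((contDiff_truncSeries hW' P).comp (contDiff_fst.snd.prodMk contDiff_snd)).add
      (contDiff_fst.fst.smul (hhs.comp (contDiff_const.prodMk contDiff_snd)))
  have ha : ContDiff ℝ ∞ a :=
    ((contDiff_truncScalar om n).comp contDiff_snd).add (contDiff_fst.mul contDiff_const)
  have hb : ContDiff ℝ ∞ b :=
    ((contDiff_truncScalar lam n).comp contDiff_snd).add (contDiff_fst.mul contDiff_const)
  have hΨ : ∀ θ, ContDiffAt ℝ ∞ Ψ ((0, 0), θ, 0) := by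
    intro θ
    refine contDiffAt_invarianceError (Q := ℝ × ℝ) k contDiff_snd ha hb hU ?_ rfl ?_
    · simpa [U] using hr θ
    · simpa [U] using hf θ
  have hΨ0 : ∀ v : ℝ × ℝ × ℝ, Ψ ((0, v.1), v.2) = errorFun k f r om lam W n P v := by
    intro v
    simp [Ψ, errorFun, truncError, a, b, U]
  have hΨ1 : ∀ v : ℝ × ℝ × ℝ, Ψ ((v.1 ^ (n + 1), v.1), v.2) =
      errorFun k f r om lam W (n + 1) P v := by
    intro v
    have h1 : U (v.1 ^ (n + 1), v.1) = truncSeries W (n + 1) P v.1 := by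
      ext1 θ; ext1 s
      simp [U, truncSeries, Finset.sum_range_succ _ (n + 1), hhdef, sPoly]
    have h2 : ∀ c : ℕ → ℝ, truncScalar c n v.1 + v.1 ^ (n + 1) * c (n + 1) =
        truncScalar c (n + 1) v.1 := by
      intro c
      simp [truncScalar, Finset.sum_range_succ _ (n + 1)]
    simp [Ψ, errorFun, truncError, h1, a, b, h2]
  have hs : SmoothAtCycle (errorFun k f r om lam W n P) := smoothAtCycle_truncError hW' hr hf P
  have hs1 : SmoothAtCycle (errorFun k f r om lam W (n + 1) P) :=
    smoothAtCycle_truncError hW hr hf P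
  let D := dirDeriv ℝ (((1 : ℝ), (0 : ℝ)), (0 : ℝ), (0 : ℝ)) Ψ
  have hD : ∀ θ, ContDiffAt ℝ ∞ D ((0, 0), θ, 0) := fun θ => (hΨ θ).dirDeriv_infty _
  let Y : ℝ × ℝ × ℝ → Plane := fun v => D ((0, 0), v.2)
  have hYs : SmoothAtCycle Y := fun θ => ContDiffAt.comp (0, θ, 0) (hD θ)
    (contDiffAt_const.prodMk contDiffAt_snd)
  let tauCoord : (ℝ × ℝ) × ℝ × ℝ →L[ℝ] ℝ :=
    (ContinuousLinearMap.fst ℝ ℝ ℝ).comp (ContinuousLinearMap.fst ℝ (ℝ × ℝ) (ℝ × ℝ))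
  let epsCoord' : (ℝ × ℝ) × ℝ × ℝ →L[ℝ] ℝ :=
    (ContinuousLinearMap.snd ℝ ℝ ℝ).comp (ContinuousLinearMap.fst ℝ (ℝ × ℝ) (ℝ × ℝ))
  -- The remainder of the first-order expansion of `Ψ` in `τ = ε^{n+1}`, with the derivative `∂_τ Ψ`
  -- frozen at `τ = ε = 0`. The second-order term in `τ` is `O(ε^{2n+2})`, and freezing `ε` costs
  -- `ε^{n+1} · O(ε)`.
  set R : ℝ × ℝ × ℝ → Plane := fun v => errorFun k f r om lam W (n + 1) P v
    - errorFun k f r om lam W n P v - v.1 ^ (n + 1) • Y v with hR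
  have hRs : SmoothAtCycle R := (hs1.sub hs).sub (smoothAtCycle_eps_pow_smul hYs _)
  have hRO : ∀ θ : ℝ, R =O[𝓝 (0, θ, 0)] fun v => v.1 ^ (n + 2) := by
    intro θ
    have t1 : Tendsto (fun v : ℝ × ℝ × ℝ => ((v.1 ^ (n + 1), v.1), v.2)) (𝓝 (0, θ, 0))
        (𝓝 ((0, 0), θ, 0)) := by
      have : Continuous (fun v : ℝ × ℝ × ℝ => ((v.1 ^ (n + 1), v.1), v.2)) := by fun_prop
      simpa using this.tendsto ((0 : ℝ), θ, (0 : ℝ))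
    have t2 : Tendsto (fun v : ℝ × ℝ × ℝ => (((0 : ℝ), v.1), v.2)) (𝓝 (0, θ, 0))
        (𝓝 ((0, 0), θ, 0)) := by
      have : Continuous (fun v : ℝ × ℝ × ℝ => (((0 : ℝ), v.1), v.2)) := by fun_prop
      simpa using this.tendsto ((0 : ℝ), θ, (0 : ℝ))
    have h1 := (taylor_dir_isBigO tauCoord (e := ((1, 0), 0, 0)) rfl (v₀ := ((0, 0), θ, 0)) rfl 2
      (contDiffAt_infty.1 (hΨ θ) 2)).comp_tendsto t1
    have h2 := (taylor_dir_isBigO epsCoord' (e := ((0, 1), 0, 0)) rfl (v₀ := ((0, 0), θ, 0)) rfl 1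
      (contDiffAt_infty.1 (hD θ) 1)).comp_tendsto t2
    have h1' : (fun v : ℝ × ℝ × ℝ => errorFun k f r om lam W (n + 1) P v
        - errorFun k f r om lam W n P v - v.1 ^ (n + 1) • D ((0, v.1), v.2))
        =O[𝓝 (0, θ, 0)] fun v => v.1 ^ (n + 2) := by
      have hle : (fun v : ℝ × ℝ × ℝ => (v.1 ^ (n + 1)) ^ 2) =O[𝓝 (0, θ, 0)]
          fun v => v.1 ^ (n + 2) := by
        have := isBigO_pow_smul (c := fun v : ℝ × ℝ × ℝ => v.1) (x := ((0 : ℝ), θ, (0 : ℝ)))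
          (h := fun _ => (1 : ℝ)) (by fun_prop) (by fun_prop)
          (show n + 2 ≤ (n + 1) * 2 by omega)
        simpa [pow_mul] using this
      refine (h1.trans hle).congr_left fun v => ?_
      have hv : v.2 - ((0 : ℝ), (0 : ℝ)) = v.2 := by ext <;> simp
      simp [Finset.sum_range_succ, tauCoord, hv, hΨ0, hΨ1, D, sub_sub]
    have h2' : (fun v : ℝ × ℝ × ℝ => v.1 ^ (n + 1) • (D ((0, v.1), v.2) - Y v))
        =O[𝓝 (0, θ, 0)] fun v => v.1 ^ (n + 2) := by
      have := (Asymptotics.isBigO_refl (fun v : ℝ × ℝ × ℝ => v.1 ^ (n + 1))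
        (𝓝 ((0 : ℝ), θ, (0 : ℝ)))).smul h2
      refine this.congr (fun v => ?_) (fun v => ?_)
      · have hv : v.2 - ((0 : ℝ), (0 : ℝ)) = v.2 := by ext <;> simp
        simp [epsCoord', hv, Y]
        rfl
      · simp [epsCoord', pow_succ]
    refine (h1'.add h2').congr_left fun v => ?_
    simp only [hR, smul_sub]
    abel
  -- `Y` is the linearized operator of the undelayed equation at the truncation of `W₀`, applied to
  -- the correction. By the choice of the correction it equals minus the leading error modulo
  -- `s^{P+1}`.
  have hYO : ∀ θ : ℝ, (fun v => Y v + sPoly (P + 1) (leadingError k f r om lam W n) v)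
      =O[𝓝 (0, θ, 0)] fun v => v.2.2 ^ (P + 1) := by
    intro θ
    refine (hlin θ).congr' ?_ .rfl
    set u := sPoly (P + 1) (W 0) with hudef
    have hus : ContDiff ℝ ∞ u := contDiff_sPoly hg.smooth_coeff _
    have hut : Tendsto u (𝓝 ((0 : ℝ), θ, (0 : ℝ))) (𝓝 (W 0 0 θ)) := by
      have := hus.continuous.tendsto ((0 : ℝ), θ, (0 : ℝ))
      simpa [hudef, sPoly, Finset.sum_range_succ'] using this
    have hX : ContDiffAt ℝ 1 (fun x => f (0, x, k.base x)) (W 0 0 θ) := by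
      simpa using contDiffAt_infty.1 (hg.field θ) 1
    have hΨ1 : ContDiffAt ℝ 1 Ψ ((0, 0), θ, 0) := by simpa using contDiffAt_infty.1 (hΨ θ) 1
    have t3 : Tendsto (fun v : ℝ × ℝ × ℝ => (((0 : ℝ), (0 : ℝ)), v.2)) (𝓝 (0, θ, 0))
        (𝓝 ((0, 0), θ, 0)) := by
      have : Continuous (fun v : ℝ × ℝ × ℝ => (((0 : ℝ), (0 : ℝ)), v.2)) := by fun_prop
      simpa using this.tendsto ((0 : ℝ), θ, (0 : ℝ))
    filter_upwards [hut.eventually (hX.eventually (by simp)),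
      t3.eventually (hΨ1.eventually (by simp))] with v hXv hΨv
    congr 1
    have hUd : ∀ x, DifferentiableAt ℝ (fun x : (ℝ × ℝ) × ℝ × ℝ => U x.1 x.2.1 x.2.2) x :=
      hU.differentiable (by simp)
    have hud : ∀ x, DifferentiableAt ℝ u x := hus.differentiable (by simp)
    have hhd : ∀ x, DifferentiableAt ℝ hh x := hhs.differentiable (by simp)
    have hlines : ∀ {q : ℝ × ℝ × ℝ → Plane}, (∀ x, DifferentiableAt ℝ q x) →
        (∀ ε θ s, q (ε, θ, s) = q (0, θ, s)) →
        HasDerivAt (fun t => q (0, t, v.2.2)) (dirDeriv ℝ (0, 1, 0) q v) v.2.1 ∧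
        HasDerivAt (fun t => q (0, v.2.1, t)) (dirDeriv ℝ (0, 0, 1) q v) v.2.2 := by
      intro q hq hq0
      have l1 : HasDerivAt (fun t : ℝ => (v.1, t, v.2.2)) ((0 : ℝ), (1 : ℝ), (0 : ℝ)) v.2.1 :=
        (hasDerivAt_const _ _).prodMk ((hasDerivAt_id _).prodMk (hasDerivAt_const _ _))
      have l2 : HasDerivAt (fun t : ℝ => (v.1, v.2.1, t)) ((0 : ℝ), (0 : ℝ), (1 : ℝ)) v.2.2 :=
        (hasDerivAt_const _ _).prodMk ((hasDerivAt_const _ _).prodMk (hasDerivAt_id _))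
      constructor
      · have := (hq v).hasFDerivAt.comp_hasDerivAt v.2.1 l1
        simp only [Function.comp_def, hq0 v.1] at this
        exact this
      · have := (hq v).hasFDerivAt.comp_hasDerivAt v.2.2 l2
        simp only [Function.comp_def, hq0 v.1] at this
        exact this
    obtain ⟨u2, u3⟩ := hlines hud (fun _ _ _ => rfl)
    obtain ⟨h2, h3⟩ := hlines hhd (fun _ _ _ => rfl)
    have hUeq : ∀ τ θ s, U (τ, 0) θ s = u (0, θ, s) + τ • hh (0, θ, s) := by
      intro τ θ s
      simp only [U]
      rw [truncSeries_eps_zero, truncSeries_zero_eq_sPoly]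
    have hval : ∀ τ : ℝ, Ψ ((τ, 0), v.2) =
        (om 0 + τ * om (n + 1)) • (dirDeriv ℝ (0, 1, 0) u v + τ • dirDeriv ℝ (0, 1, 0) hh v)
        + (v.2.2 * (lam 0 + τ * lam (n + 1))) •
          (dirDeriv ℝ (0, 0, 1) u v + τ • dirDeriv ℝ (0, 0, 1) hh v)
        - f (0, u v + τ • hh v, k.base (u v + τ • hh v)) := by
      intro τ
      have d2 := (u2.add (h2.fun_const_smul τ)).deriv
      have d3 := (u3.add (h3.fun_const_smul τ)).deriv
      simp only [Ψ, invarianceError, delayedArg_zero, hUeq, a, b, truncScalar_zero]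
      rw [← d2, ← d3]
      rfl
    symm
    refine dirDeriv_eq_of_hasDerivAt (hΨv.differentiableAt (by simp)) ?_
    have hl : ∀ t : ℝ, (((0 : ℝ), (0 : ℝ)), v.2) + t • (((1 : ℝ), (0 : ℝ)), ((0 : ℝ), (0 : ℝ)))
        = ((t, 0), v.2) := by intro t; ext <;> simp
    simp only [hl, hval]
    have i1 : HasDerivAt (fun t : ℝ => t) 1 0 := hasDerivAt_id 0
    have i2 : ∀ c d : Plane, HasDerivAt (fun t : ℝ => c + t • d) d 0 := fun c d => by
      simpa using (i1.smul_const d).const_add c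
    have i3 : ∀ c d : ℝ, HasDerivAt (fun t : ℝ => c + t * d) d 0 := fun c d => by
      simpa using (i1.mul_const d).const_add c
    have i4 : HasDerivAt (fun t : ℝ => f (0, u v + t • hh v, k.base (u v + t • hh v)))
        (fderiv ℝ (fun x => f (0, x, k.base x)) (u v) (hh v)) 0 := by
      have hx : HasFDerivAt (fun x => f (0, x, k.base x))
          (fderiv ℝ (fun x => f (0, x, k.base x)) (u v)) (u v + (0 : ℝ) • hh v) := by
        simpa using (hXv.differentiableAt (by simp)).hasFDerivAt
      exact hx.comp_hasDerivAt (0 : ℝ) (i2 (u v) (hh v))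
    have := ((((i3 (om 0) (om (n + 1))).fun_smul (i2 (dirDeriv ℝ (0, 1, 0) u v)
      (dirDeriv ℝ (0, 1, 0) hh v))).add
      (((i3 (lam 0) (lam (n + 1))).const_mul v.2.2).fun_smul (i2 (dirDeriv ℝ (0, 0, 1) u v)
      (dirDeriv ℝ (0, 0, 1) hh v)))).sub i4)
    refine this.congr_deriv ?_
    simp only [zero_mul, zero_smul, add_zero]
    abel
  -- With `E` the leading error, the new error is the sum of (old error `- ε^{n+1} E`), `R` and
  -- `ε^{n+1} (Y + E)`. The jets of each of the three vanish to the required orders.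
  have j1 := h.sub_leadingError hW' hr hf P
  have j2 : JetVanishes (n + 2) (P + 1) R := JetVanishes.of_isBigO_eps hRs (P + 1) hRO
  have hEs : SmoothAtCycle (sPoly (P + 1) (leadingError k f r om lam W n)) :=
    (contDiff_sPoly (contDiff_leadingError hW' hr hf) _).smoothAtCycle
  have hlast := smoothAtCycle_eps_pow_smul (hYs.add hEs) (n + 1)
  have j3 : JetVanishes (n + 2) (P + 1) (fun v => v.1 ^ (n + 1) •
      (Y + sPoly (P + 1) (leadingError k f r om lam W n)) v) := by
    refine JetVanishes.of_isBigO_s hlast _ fun θ => ?_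
    have hc : ContinuousAt (fun v : ℝ × ℝ × ℝ => v.1 ^ (n + 1)) (0, θ, 0) := by fun_prop
    simpa using (hc.norm.isBoundedUnder_le.isBigO_one ℝ).smul (hYO θ)
  have hfirst := hs.sub (smoothAtCycle_eps_pow_smul hEs (n + 1))
  have := (j1.add hfirst hRs j2).add (hfirst.add hRs) hlast j3
  convert this using 1
  ext1 v
  simp only [Pi.add_apply, Pi.sub_apply, hR, smul_add]
  abel

end Orders

/-! ### Classes of functions: smooth periodic, and analytic in a strip. -/

/-- `g` extends analytically to the strip of half width `ξ`. -/
def ExtendsToStrip (ξ : ℝ) (g : ℝ → ℝ) : Prop :=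
  ∃ G : ℂ → ℂ, DifferentiableOn ℂ G (strip ξ) ∧ ∀ θ : ℝ, G θ = (g θ : ℂ)

theorem isOpen_strip (ξ : ℝ) : IsOpen (strip ξ) :=
  isOpen_lt (Complex.continuous_im.abs) continuous_const

theorem ofReal_mem_strip {ξ : ℝ} (hξ : 0 < ξ) (θ : ℝ) : (θ : ℂ) ∈ strip ξ := by
  simpa [strip] using hξ

theorem add_ofReal_mem_strip {ξ : ℝ} {z : ℂ} (hz : z ∈ strip ξ) (t : ℝ) :
    z + (t : ℂ) ∈ strip ξ := by
  simpa [strip] using hz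

/-- A class of functions closed under the ring operations and under differentiation. -/
structure IsDifferentialClass (𝒞 : (ℝ → ℝ) → Prop) : Prop where
  const : ∀ c : ℝ, 𝒞 fun _ => c
  add : ∀ {g h}, 𝒞 g → 𝒞 h → 𝒞 fun θ => g θ + h θ
  mul : ∀ {g h}, 𝒞 g → 𝒞 h → 𝒞 fun θ => g θ * h θ
  deriv_mem : ∀ {g}, 𝒞 g → 𝒞 (deriv g)

namespace IsDifferentialClass

variable {𝒞 : (ℝ → ℝ) → Prop}

theorem neg (h𝒞 : IsDifferentialClass 𝒞) {g : ℝ → ℝ} (hg : 𝒞 g) : 𝒞 fun θ => -g θ := by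
  simpa using h𝒞.mul (h𝒞.const (-1)) hg

theorem sub (h𝒞 : IsDifferentialClass 𝒞) {g h : ℝ → ℝ} (hg : 𝒞 g) (hh : 𝒞 h) :
    𝒞 fun θ => g θ - h θ := by
  simpa [sub_eq_add_neg] using h𝒞.add hg (h𝒞.neg hh)

theorem sum (h𝒞 : IsDifferentialClass 𝒞) {g : ℕ → ℝ → ℝ} (s : Finset ℕ)
    (hg : ∀ i ∈ s, 𝒞 (g i)) : 𝒞 fun θ => ∑ i ∈ s, g i θ := by
  classical
  induction s using Finset.induction_on with
  | empty => simpa using h𝒞.const 0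
  | insert a s ha ih =>
    simp only [Finset.sum_insert ha]
    exact h𝒞.add (hg a (by simp)) (ih fun i hi => hg i (by simp [hi]))

end IsDifferentialClass

/-- The frame computations use only ring operations, derivatives and one reciprocal. Done once for
an abstract class, they give smoothness with periodicity here and analyticity in the strip in the
next instance. -/
theorem isDifferentialClass_smooth :
    IsDifferentialClass fun g => ContDiff ℝ ∞ g ∧ Function.Periodic g 1 where
  const c := ⟨contDiff_const, fun _ => rfl⟩
  add hg hh := ⟨hg.1.add hh.1, fun θ => by simp only [hg.2 θ, hh.2 θ]⟩
  mul hg hh := ⟨hg.1.mul hh.1, fun θ => by simp only [hg.2 θ, hh.2 θ]⟩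
  deriv_mem {g} hg := ⟨(contDiff_infty_iff_deriv.1 hg.1).2, fun θ => by
    rw [← deriv_comp_add_const]
    simp only [hg.2 _]⟩

/-- Real differentiability is carried along so that the complex derivative of the extension can be
identified on the real line with the derivative of `g`. -/
theorem isDifferentialClass_extendsToStrip {ξ : ℝ} (hξ : 0 < ξ) :
    IsDifferentialClass fun g => Differentiable ℝ g ∧ ExtendsToStrip ξ g where
  const c := ⟨differentiable_const c, fun _ => c, differentiableOn_const _, fun _ => rfl⟩
  add := by
    rintro g h ⟨hg, G, hG, hG'⟩ ⟨hh, H, hH, hH'⟩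
    exact ⟨hg.add hh, fun z => G z + H z, hG.add hH, fun θ => by simp [hG', hH']⟩
  mul := by
    rintro g h ⟨hg, G, hG, hG'⟩ ⟨hh, H, hH, hH'⟩
    exact ⟨hg.mul hh, fun z => G z * H z, hG.mul hH, fun θ => by simp [hG', hH']⟩
  deriv_mem := by
    rintro g ⟨hg, G, hG, hG'⟩
    have hd : ∀ θ : ℝ, deriv G θ = ((deriv g θ : ℝ) : ℂ) := by
      intro θ
      have h1 : HasDerivAt G (deriv G θ) (θ : ℂ) :=
        (hG.differentiableAt ((isOpen_strip ξ).mem_nhds (ofReal_mem_strip hξ θ))).hasDerivAt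
      have h2 := h1.comp_ofReal
      simp only [hG'] at h2
      exact h2.unique (hg θ).hasDerivAt.ofReal_comp
    have hG2 : DifferentiableOn ℂ (deriv G) (strip ξ) := hG.deriv (isOpen_strip ξ)
    refine ⟨fun θ => ?_, deriv G, hG2, hd⟩
    have h1 : HasDerivAt (deriv G) (deriv (deriv G) θ) (θ : ℂ) :=
      (hG2.differentiableAt ((isOpen_strip ξ).mem_nhds (ofReal_mem_strip hξ θ))).hasDerivAt
    have h2 := h1.real_of_complex
    simp only [hd, Complex.ofReal_re] at h2
    exact h2.differentiableAt

/-! ### Cohomological equations on the circle. -/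

section Cohomological

/-- The average of `h (θ + t)`, `0 ≤ t ≤ 1`, with weight `κ`. -/
noncomputable def weightedAverage {𝕜 : Type*} [RCLike 𝕜] (κ : ℝ → ℝ) (h : 𝕜 → 𝕜) (z : 𝕜) : 𝕜 :=
  ∫ t in (0 : ℝ)..1, (κ t : 𝕜) * h (z + (t : 𝕜))

/-- Differentiation under the integral sign, over `ℝ` and `ℂ` at once. The shifts are real, so in
the complex case the points `z + t` stay in any strip containing `z`; this is why no width is lost.
-/
theorem hasDerivAt_weightedAverage {𝕜 : Type*} [RCLike 𝕜] {κ : ℝ → ℝ} (hκ : Continuous κ)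
    {h : 𝕜 → 𝕜} {U : Set 𝕜} (hU : IsOpen U) (hh : DifferentiableOn 𝕜 h U)
    (hh' : ContinuousOn (deriv h) U) {z : 𝕜} (hz : ∀ t ∈ Set.Icc (0 : ℝ) 1, z + (t : 𝕜) ∈ U) :
    HasDerivAt (weightedAverage κ h) (weightedAverage κ (deriv h) z) z := by
  have htube : ∀ᶠ x in 𝓝 z, ∀ t ∈ Set.Icc (0 : ℝ) 1, x + (t : 𝕜) ∈ U := by
    refine isCompact_Icc.eventually_forall_of_forall_eventually fun t ht => ?_
    have hc : Continuous fun y : 𝕜 × ℝ => y.1 + (y.2 : 𝕜) := by fun_prop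
    exact hc.continuousAt.eventually (hU.mem_nhds (hz t ht))
  obtain ⟨ρ, hρ, hball⟩ := Metric.nhds_basis_closedBall.eventually_iff.1 htube
  have hK : IsCompact (Metric.closedBall z ρ ×ˢ Set.Icc (0 : ℝ) 1) :=
    (isCompact_closedBall z ρ).prod isCompact_Icc
  have hcont : ContinuousOn (fun y : 𝕜 × ℝ => (κ y.2 : 𝕜) * deriv h (y.1 + (y.2 : 𝕜)))
      (Metric.closedBall z ρ ×ˢ Set.Icc (0 : ℝ) 1) := by
    refine ContinuousOn.mul (by fun_prop) (hh'.comp (by fun_prop) fun y hy => ?_)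
    exact hball hy.1 y.2 hy.2
  obtain ⟨C, hC⟩ := hK.exists_bound_of_continuousOn hcont
  have hsub : Set.uIoc (0 : ℝ) 1 ⊆ Set.Icc 0 1 := by
    rw [Set.uIoc_of_le zero_le_one]
    exact Set.Ioc_subset_Icc_self
  have hcx : ∀ x ∈ Metric.closedBall z ρ,
      ContinuousOn (fun t : ℝ => (κ t : 𝕜) * h (x + (t : 𝕜))) (Set.Icc 0 1) := fun x hx =>
    ContinuousOn.mul (by fun_prop) (hh.continuousOn.comp (by fun_prop) fun t ht => hball hx t ht)
  have hzm : z ∈ Metric.closedBall z ρ := Metric.mem_closedBall_self hρ.le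
  refine (intervalIntegral.hasDerivAt_integral_of_dominated_loc_of_deriv_le
    (F := fun (x : 𝕜) (t : ℝ) => (κ t : 𝕜) * h (x + (t : 𝕜)))
    (F' := fun (x : 𝕜) (t : ℝ) => (κ t : 𝕜) * deriv h (x + (t : 𝕜)))
    (bound := fun _ => C)
    (Metric.closedBall_mem_nhds z hρ) ?_ ?_ ?_ ?_ ?_ ?_).2
  · filter_upwards [Metric.closedBall_mem_nhds z hρ] with x hx
    exact ((hcx x hx).mono hsub).aestronglyMeasurable measurableSet_uIoc
  · refine ContinuousOn.intervalIntegrable ?_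
    rw [Set.uIcc_of_le zero_le_one]
    exact hcx z hzm
  · refine ContinuousOn.aestronglyMeasurable ?_ measurableSet_uIoc
    exact (hcont.comp (f := fun t : ℝ => (z, t)) (by fun_prop) fun t ht => ⟨hzm, ht⟩).mono hsub
  · exact Eventually.of_forall fun t ht x hx => hC (x, t) ⟨hx, hsub ht⟩
  · exact intervalIntegrable_const
  · refine Eventually.of_forall fun t ht x hx => ?_
    have h1 : HasDerivAt h (deriv h (x + (t : 𝕜))) (x + (t : 𝕜)) :=
      (hh.differentiableAt (hU.mem_nhds (hball hx t (hsub ht)))).hasDerivAt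
    exact (h1.comp_add_const x (t : 𝕜)).const_mul _

theorem contDiff_weightedAverage {κ : ℝ → ℝ} (hκ : Continuous κ) {h : ℝ → ℝ}
    (hh : ContDiff ℝ ∞ h) : ContDiff ℝ ∞ (weightedAverage κ h) := by
  have hd : ∀ {h : ℝ → ℝ}, ContDiff ℝ ∞ h → ∀ θ, HasDerivAt (weightedAverage κ h)
      (weightedAverage κ (deriv h) θ) θ := fun {h} hh θ =>
    hasDerivAt_weightedAverage hκ isOpen_univ (hh.differentiable (by simp)).differentiableOn
      (hh.continuous_deriv (by simp)).continuousOn (fun _ _ => trivial)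
  rw [contDiff_infty]
  intro n
  induction n generalizing h with
  | zero =>
    exact contDiff_zero.2 (continuous_iff_continuousAt.2 fun θ => (hd hh θ).continuousAt)
  | succ n ih =>
    have h1 : deriv (weightedAverage κ h) = weightedAverage κ (deriv h) :=
      funext fun θ => (hd hh θ).deriv
    push_cast
    rw [contDiff_succ_iff_deriv]
    refine ⟨fun θ => (hd hh θ).differentiableAt, by simp, ?_⟩
    rw [h1]
    exact ih (contDiff_infty_iff_deriv.1 hh).2

theorem ExtendsToStrip.weightedAverage {ξ : ℝ} {κ : ℝ → ℝ} (hκ : Continuous κ) {h : ℝ → ℝ}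
    (hh : ExtendsToStrip ξ h) : ExtendsToStrip ξ (weightedAverage κ h) := by
  obtain ⟨H, hH, hHh⟩ := hh
  refine ⟨_root_.weightedAverage κ H, fun z hz => ?_, fun θ => ?_⟩
  · exact (hasDerivAt_weightedAverage hκ (isOpen_strip ξ) hH
      (hH.deriv (isOpen_strip ξ)).continuousOn
      fun t _ => add_ofReal_mem_strip hz t).differentiableAt.differentiableWithinAt
  · have : ∀ t : ℝ, ((κ t : ℝ) : ℂ) * H ((θ : ℂ) + (t : ℂ)) =
        ((κ t * h (θ + t) : ℝ) : ℂ) := by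
      intro t
      rw [← Complex.ofReal_add, hHh]
      simp
    simp only [_root_.weightedAverage, Complex.coe_algebraMap, RCLike.ofReal_real_eq_id, id]
    refine Eq.trans ?_ intervalIntegral.integral_ofReal
    exact intervalIntegral.integral_congr fun t _ => this t

/-- The weight whose average solves `u' + c u = h` (up to the mean value of `h` if `c = 0`). -/
noncomputable def cohomologicalWeight (c t : ℝ) : ℝ :=
  if c = 0 then t else Real.exp (c * t) / (Real.exp c - 1)

/-- Integration by parts in `t`. The weight satisfies `κ(1) - κ(0) = 1`, so by periodicity the
boundary term is `h θ`. The remaining integral is `c` times the average if `c ≠ 0`, since then `κ' =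
c κ`, and the mean value of `h` if `c = 0`, since then `κ' = 1`. -/
theorem deriv_weightedAverage_add {c : ℝ} {h : ℝ → ℝ} (hh : ContDiff ℝ ∞ h)
    (hper : Function.Periodic h 1) (θ : ℝ) :
    deriv (weightedAverage (cohomologicalWeight c) h) θ
      + c * weightedAverage (cohomologicalWeight c) h θ
      = h θ - if c = 0 then ∫ t in (0 : ℝ)..1, h t else 0 := by
  have hκd : ∀ t, HasDerivAt (cohomologicalWeight c)
      (if c = 0 then 1 else c * cohomologicalWeight c t) t := by
    intro t
    unfold cohomologicalWeight
    split_ifs with hc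
    · exact hasDerivAt_id t
    · have := (((hasDerivAt_id t).const_mul c).exp).div_const (Real.exp c - 1)
      refine this.congr_deriv ?_
      simp only [id]
      ring
  have hκ : Continuous (cohomologicalWeight c) :=
    continuous_iff_continuousAt.2 fun t => (hκd t).continuousAt
  have hjump : cohomologicalWeight c 1 - cohomologicalWeight c 0 = 1 := by
    unfold cohomologicalWeight
    split_ifs with hc
    · simp
    · have : Real.exp c - 1 ≠ 0 := by
        rw [sub_ne_zero]
        simpa using hc
      rw [mul_one, mul_zero, Real.exp_zero, ← sub_div, div_self this]
  have hd : Differentiable ℝ h := hh.differentiable (by simp)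
  have hc' : Continuous (deriv h) := hh.continuous_deriv (by simp)
  have h1 := (hasDerivAt_weightedAverage (𝕜 := ℝ) hκ isOpen_univ hd.differentiableOn
    hc'.continuousOn (z := θ) (fun _ _ => trivial)).deriv
  have hv : ∀ t : ℝ, HasDerivAt (fun t => h (θ + t)) (deriv h (θ + t)) t := fun t =>
    (hd (θ + t)).hasDerivAt.comp_const_add θ t
  have hκ' : Continuous fun t => if c = 0 then (1 : ℝ) else c * cohomologicalWeight c t := by
    split_ifs <;> fun_prop
  have h2 := intervalIntegral.integral_mul_deriv_eq_deriv_mul (a := 0) (b := 1)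
    (fun t _ => hκd t) (fun t _ => hv t) (hκ'.intervalIntegrable 0 1)
    ((show Continuous fun t => deriv h (θ + t) by fun_prop).intervalIntegrable 0 1)
  have h3 : weightedAverage (cohomologicalWeight c) (deriv h) θ =
      ∫ t in (0 : ℝ)..1, cohomologicalWeight c t * deriv h (θ + t) := rfl
  have h4 : weightedAverage (cohomologicalWeight c) h θ =
      ∫ t in (0 : ℝ)..1, cohomologicalWeight c t * h (θ + t) := rfl
  rw [h1, h3, h2, h4, hper θ, add_zero, ← sub_mul, hjump, one_mul]
  split_ifs with hc
  · have h5 : ∫ t in (0 : ℝ)..1, h (θ + t) = ∫ t in (0 : ℝ)..1, h t := by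
      rw [intervalIntegral.integral_comp_add_left, add_zero]
      simpa using hper.intervalIntegral_add_eq θ 0
    simp [h5, hc]
  · simp only [mul_assoc, intervalIntegral.integral_const_mul]
    ring

/-- The cohomological equation `a u' + b u = h - [b = 0] ∫ h` on the circle. -/
theorem exists_cohomological_solution {a : ℝ} (ha : a ≠ 0) (b : ℝ) {h : ℝ → ℝ}
    (hh : ContDiff ℝ ∞ h) (hper : Function.Periodic h 1) :
    ∃ u : ℝ → ℝ, (ContDiff ℝ ∞ u ∧ Function.Periodic u 1) ∧
      (∀ θ, a * deriv u θ + b * u θ = h θ - if b = 0 then ∫ t in (0 : ℝ)..1, h t else 0) ∧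
      ∀ ξ, 0 < ξ → ExtendsToStrip ξ h → ExtendsToStrip ξ u := by
  have hκ : Continuous (cohomologicalWeight (b / a)) := by
    unfold cohomologicalWeight
    split_ifs <;> fun_prop
  have hs : ContDiff ℝ ∞ (fun θ => a⁻¹ * h θ) := contDiff_const.mul hh
  have hp : Function.Periodic (fun θ => a⁻¹ * h θ) 1 := fun θ => by simp only [hper θ]
  refine ⟨weightedAverage (cohomologicalWeight (b / a)) (fun θ => a⁻¹ * h θ),
    ⟨contDiff_weightedAverage hκ hs, fun θ => ?_⟩, fun θ => ?_, fun ξ hξ hext => ?_⟩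
  · have : ∀ t : ℝ, h (θ + 1 + t) = h (θ + t) := fun t => by rw [add_right_comm, hper]
    simp [weightedAverage, this]
  · have := congrArg (a * ·) (deriv_weightedAverage_add (c := b / a) hs hp θ)
    simp only [mul_add, mul_sub] at this
    rw [← mul_assoc, mul_div_cancel₀ _ ha, ← mul_assoc, mul_inv_cancel₀ ha, one_mul] at this
    rw [this]
    congr 1
    by_cases hb : b = 0
    · simp [hb, ha]
    · simp [hb, ha]
  · refine ExtendsToStrip.weightedAverage hκ ?_
    obtain ⟨H, hH, hHh⟩ := hext
    exact ⟨fun z => (a⁻¹ : ℝ) * H z, hH.const_mul _, fun θ => by simp [hHh]⟩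

end Cohomological

/-! ### Division by the frame and existence of the correction. -/

section Frame

/-- The determinant of the frame `(∂_θ W, ∂_s W)` on the cycle. -/
noncomputable def frameDet (w : ℕ → ℝ → Plane) (θ : ℝ) : ℝ :=
  deriv (w 0) θ 0 * w 1 θ 1 - deriv (w 0) θ 1 * w 1 θ 0

/-- The coefficients of `(DW)⁻¹ E`. -/
noncomputable def frameInv (w E : ℕ → ℝ → Plane) : ℕ → (ℝ → ℝ) × (ℝ → ℝ)
  | p =>
    -- The sum is over `Fin p`, so that each index carries the bound used for termination.
    let R : ℝ → Plane := fun θ => E p θ - ∑ i : Fin p,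
      ((frameInv w E (p - (i + 1))).1 θ • deriv (w (i + 1)) θ
        + ((((i : ℕ) + 1 : ℕ) + 1 : ℝ) * (frameInv w E (p - (i + 1))).2 θ) • w (i + 1 + 1) θ)
    (fun θ => (R θ 0 * w 1 θ 1 - R θ 1 * w 1 θ 0) * (frameDet w θ)⁻¹,
      fun θ => (deriv (w 0) θ 0 * R θ 1 - deriv (w 0) θ 1 * R θ 0) * (frameDet w θ)⁻¹)
termination_by p => p
decreasing_by all_goals (have := i.2; omega)

/-- In the coefficient of order `p` only the term `i = 0` contains the unknowns of order `p`; the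
others involve lower orders and are moved to the right-hand side `R`. Cramer's rule in the basis
`deriv (w 0) θ`, `w 1 θ` does the rest. -/
theorem frameMul_frameInv {w : ℕ → ℝ → Plane} (hw : ∀ θ, frameDet w θ ≠ 0) (E : ℕ → ℝ → Plane)
    (p : ℕ) (θ : ℝ) :
    frameMul w (fun p => (frameInv w E p).1) (fun p => (frameInv w E p).2) p θ = E p θ := by
  set R : Plane := E p θ - ∑ i ∈ Finset.range p,
      ((frameInv w E (p - (i + 1))).1 θ • deriv (w (i + 1)) θ
        + ((((i : ℕ) + 1 : ℕ) + 1 : ℝ) * (frameInv w E (p - (i + 1))).2 θ) • w (i + 1 + 1) θ)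
    with hR
  have h1 : (frameInv w E p).1 θ = (R 0 * w 1 θ 1 - R 1 * w 1 θ 0) * (frameDet w θ)⁻¹ := by
    rw [frameInv, hR, Finset.sum_range]
  have h2 : (frameInv w E p).2 θ =
      (deriv (w 0) θ 0 * R 1 - deriv (w 0) θ 1 * R 0) * (frameDet w θ)⁻¹ := by
    rw [frameInv, hR, Finset.sum_range]
  have h3 : (frameInv w E p).1 θ • deriv (w 0) θ + (frameInv w E p).2 θ • w 1 θ = R := by
    have hd : (deriv (w 0) θ 0 * w 1 θ 1 - deriv (w 0) θ 1 * w 1 θ 0) * (frameDet w θ)⁻¹ = 1 :=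
      mul_inv_cancel₀ (hw θ)
    rw [h1, h2]
    generalize (frameDet w θ)⁻¹ = d at hd
    ext i
    fin_cases i
    · simp only [PiLp.add_apply, PiLp.smul_apply, smul_eq_mul, Fin.zero_eta]
      linear_combination R 0 * hd
    · simp only [PiLp.add_apply, PiLp.smul_apply, smul_eq_mul, Fin.mk_one]
      linear_combination R 1 * hd
  rw [frameMul, Finset.sum_range_succ']
  simp only [Nat.sub_zero, Nat.cast_zero, zero_add, one_mul]
  rw [h3, hR, add_sub_cancel]

/-- The coordinates of `V` belong to the class `𝒞`. -/
def CoordsIn (𝒞 : (ℝ → ℝ) → Prop) (V : ℝ → Plane) : Prop := ∀ i, 𝒞 fun θ => V θ i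

theorem deriv_coord {V : ℝ → Plane} (hV : Differentiable ℝ V) (i : Fin 2) :
    deriv (fun θ => V θ i) = fun θ => deriv V θ i := by
  ext θ
  have := (EuclideanSpace.proj i : EuclideanSpace ℝ (Fin 2) →L[ℝ] ℝ).hasFDerivAt.comp_hasDerivAt θ
    (hV θ).hasDerivAt
  exact this.deriv

theorem IsDifferentialClass.coordsIn_deriv {𝒞 : (ℝ → ℝ) → Prop} (h𝒞 : IsDifferentialClass 𝒞)
    {V : ℝ → Plane} (hV : Differentiable ℝ V) (h : CoordsIn 𝒞 V) : CoordsIn 𝒞 (deriv V) :=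
  fun i => by
    have := h𝒞.deriv_mem (h i)
    rwa [deriv_coord hV] at this

theorem IsDifferentialClass.frameDet {𝒞 : (ℝ → ℝ) → Prop} (h𝒞 : IsDifferentialClass 𝒞)
    {w : ℕ → ℝ → Plane} (hd : ∀ p, Differentiable ℝ (w p)) (hw : ∀ p, CoordsIn 𝒞 (w p)) :
    𝒞 (frameDet w) :=
  h𝒞.sub (h𝒞.mul (h𝒞.coordsIn_deriv (hd 0) (hw 0) 0) (hw 1 1))
    (h𝒞.mul (h𝒞.coordsIn_deriv (hd 0) (hw 0) 1) (hw 1 0))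

theorem IsDifferentialClass.frameMul {𝒞 : (ℝ → ℝ) → Prop} (h𝒞 : IsDifferentialClass 𝒞)
    {w : ℕ → ℝ → Plane} (hd : ∀ p, Differentiable ℝ (w p)) (hw : ∀ p, CoordsIn 𝒞 (w p))
    {A₁ A₂ : ℕ → ℝ → ℝ} (h₁ : ∀ p, 𝒞 (A₁ p)) (h₂ : ∀ p, 𝒞 (A₂ p)) (p : ℕ) :
    CoordsIn 𝒞 (frameMul w A₁ A₂ p) := by
  intro j
  have : (fun θ => _root_.frameMul w A₁ A₂ p θ j) = fun θ => ∑ i ∈ Finset.range (p + 1),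
      (A₁ (p - i) θ * deriv (w i) θ j + (((i : ℝ) + 1) * A₂ (p - i) θ) * w (i + 1) θ j) := by
    ext θ
    simp [_root_.frameMul]
  rw [this]
  exact h𝒞.sum _ fun i _ => h𝒞.add (h𝒞.mul (h₁ _) (h𝒞.coordsIn_deriv (hd i) (hw i) j))
    (h𝒞.mul (h𝒞.mul (h𝒞.const _) (h₂ _)) (hw (i + 1) j))

theorem IsDifferentialClass.frameInv {𝒞 : (ℝ → ℝ) → Prop} (h𝒞 : IsDifferentialClass 𝒞)
    {w E : ℕ → ℝ → Plane} (hd : ∀ p, Differentiable ℝ (w p)) (hw : ∀ p, CoordsIn 𝒞 (w p))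
    (hE : ∀ p, CoordsIn 𝒞 (E p)) (hdet : 𝒞 fun θ => (_root_.frameDet w θ)⁻¹) (p : ℕ) :
    𝒞 (frameInv w E p).1 ∧ 𝒞 (frameInv w E p).2 := by
  induction p using Nat.strong_induction_on with
  | _ p ih =>
    set R : ℝ → Plane := fun θ => E p θ - ∑ i ∈ Finset.range p,
      ((_root_.frameInv w E (p - (i + 1))).1 θ • deriv (w (i + 1)) θ
        + ((((i : ℕ) + 1 : ℕ) + 1 : ℝ) * (_root_.frameInv w E (p - (i + 1))).2 θ) •
          w (i + 1 + 1) θ) with hR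
    have hRc : CoordsIn 𝒞 R := by
      intro j
      have : (fun θ => R θ j) = fun θ => E p θ j - ∑ i ∈ Finset.range p,
          ((_root_.frameInv w E (p - (i + 1))).1 θ * deriv (w (i + 1)) θ j
          + ((((i : ℕ) + 1 : ℕ) + 1 : ℝ) * (_root_.frameInv w E (p - (i + 1))).2 θ) *
            w (i + 1 + 1) θ j) := by
        ext θ
        simp [hR]
      rw [this]
      refine h𝒞.sub (hE p j) (h𝒞.sum _ fun i hi => ?_)
      have hlt : p - (i + 1) < p := by
        have := Finset.mem_range.1 hi
        omega
      exact h𝒞.add (h𝒞.mul (ih _ hlt).1 (h𝒞.coordsIn_deriv (hd _) (hw _) j))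
        (h𝒞.mul (h𝒞.mul (h𝒞.const _) (ih _ hlt).2) (hw _ j))
    have h1 : (_root_.frameInv w E p).1 =
        fun θ => (R θ 0 * w 1 θ 1 - R θ 1 * w 1 θ 0) * (_root_.frameDet w θ)⁻¹ := by
      rw [_root_.frameInv]
      simp only [hR, Finset.sum_range]
    have h2 : (_root_.frameInv w E p).2 = fun θ =>
        (deriv (w 0) θ 0 * R θ 1 - deriv (w 0) θ 1 * R θ 0) * (_root_.frameDet w θ)⁻¹ := by
      rw [_root_.frameInv]
      simp only [hR, Finset.sum_range]
    have hw0 := h𝒞.coordsIn_deriv (hd 0) (hw 0)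
    rw [h1, h2]
    exact ⟨h𝒞.mul (h𝒞.sub (h𝒞.mul (hRc 0) (hw 1 1)) (h𝒞.mul (hRc 1) (hw 1 0))) hdet,
      h𝒞.mul (h𝒞.sub (h𝒞.mul (hw0 0) (hRc 1)) (h𝒞.mul (hw0 1) (hRc 0))) hdet⟩

/-- `V` extends analytically to the strip of half width `ξ`. -/
def PlaneExtends (ξ : ℝ) (V : ℝ → Plane) : Prop := CoordsIn (ExtendsToStrip ξ) V

theorem coordsIn_smooth_iff {V : ℝ → Plane} :
    CoordsIn (fun g => ContDiff ℝ ∞ g ∧ Function.Periodic g 1) V ↔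
      ContDiff ℝ ∞ V ∧ Function.Periodic V 1 := by
  constructor
  · intro h
    refine ⟨contDiff_euclidean.2 fun i => (h i).1, fun θ => ?_⟩
    ext i
    exact (h i).2 θ
  · exact fun h i => ⟨contDiff_euclidean.1 h.1 i, fun θ => by simp only [h.2 θ]⟩

/-- Existence of the correction, with smooth periodic coefficients, analytic in each strip where
the data are. -/
theorem exists_correction {om₀ lam₀ : ℝ} (hom : om₀ ≠ 0) (hlam : lam₀ ≠ 0) {w E : ℕ → ℝ → Plane}
    (hw : ∀ p, ContDiff ℝ ∞ (w p) ∧ Function.Periodic (w p) 1)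
    (hE : ∀ p, ContDiff ℝ ∞ (E p) ∧ Function.Periodic (E p) 1) (hdet : ∀ θ, frameDet w θ ≠ 0) :
    ∃ (V : ℕ → ℝ → Plane) (α β : ℝ), IsCorrection om₀ lam₀ w E V α β ∧
      (∀ p, ContDiff ℝ ∞ (V p) ∧ Function.Periodic (V p) 1) ∧
      ∀ ξ, 0 < ξ → (∀ p, PlaneExtends ξ (w p)) → ExtendsToStrip ξ (fun θ => (frameDet w θ)⁻¹) →
        (∀ p, PlaneExtends ξ (E p)) → ∀ p, PlaneExtends ξ (V p) := by
  have hwd : ∀ p, Differentiable ℝ (w p) := fun p => (hw p).1.differentiable (by simp)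
  have hEd : ∀ p, Differentiable ℝ (E p) := fun p => (hE p).1.differentiable (by simp)
  have hws := fun p => coordsIn_smooth_iff.2 (hw p)
  have hdets := isDifferentialClass_smooth.frameDet hwd hws
  have hdetinv : ContDiff ℝ ∞ (fun θ => (frameDet w θ)⁻¹) ∧
      Function.Periodic (fun θ => (frameDet w θ)⁻¹) 1 :=
    ⟨hdets.1.inv hdet, fun θ => by simp only [hdets.2 θ]⟩
  have hinv := isDifferentialClass_smooth.frameInv hwd hws
    (fun p => coordsIn_smooth_iff.2 (hE p)) hdetinv
  have hneg : ∀ {g : ℝ → ℝ}, ContDiff ℝ ∞ g ∧ Function.Periodic g 1 →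
      ContDiff ℝ ∞ (fun θ => -g θ) ∧ Function.Periodic (fun θ => -g θ) 1 :=
    fun hg => isDifferentialClass_smooth.neg hg
  choose A₁ hA₁ hA₁' hA₁'' using fun p : ℕ => exists_cohomological_solution hom (lam₀ * p)
    (hneg (hinv p).1).1 (hneg (hinv p).1).2
  choose A₂ hA₂ hA₂' hA₂'' using fun p : ℕ => exists_cohomological_solution hom
    (lam₀ * ((p : ℝ) - 1)) (hneg (hinv p).2).1 (hneg (hinv p).2).2
  -- The scalar equations are resonant only for `p = 0` in the first component and `p = 1` in the
  -- second, since `lam₀ ≠ 0`. The two constants are the mean values that obstruct solvability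
  -- there.
  refine ⟨frameMul w A₁ A₂, ∫ t in (0 : ℝ)..1, -(frameInv w E 0).1 t,
    ∫ t in (0 : ℝ)..1, -(frameInv w E 1).2 t,
    ⟨A₁, A₂, fun p => (frameInv w E p).1, fun p => (frameInv w E p).2, hA₁, hA₂, fun _ _ => rfl,
      fun p θ => (frameMul_frameInv hdet E p θ).symm, fun p θ => ?_, fun p θ => ?_⟩,
    fun p => coordsIn_smooth_iff.1 (isDifferentialClass_smooth.frameMul hwd hws hA₁ hA₂ p),
    fun ξ hξ hwξ hdξ hEξ => ?_⟩
  · rw [hA₁']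
    rcases eq_or_ne p 0 with rfl | hp
    · simp
    · simp [hp, hlam]
  · rw [hA₂']
    rcases eq_or_ne p 1 with rfl | hp
    · simp
    · have : (p : ℝ) - 1 ≠ 0 := by
        rw [sub_ne_zero]
        exact_mod_cast hp
      simp [hp, hlam, this]
  · have h𝒞 := isDifferentialClass_extendsToStrip hξ
    have hcoord : ∀ {V : ℝ → Plane}, Differentiable ℝ V → PlaneExtends ξ V →
        CoordsIn (fun g => Differentiable ℝ g ∧ ExtendsToStrip ξ g) V :=
      fun hV h i => ⟨differentiable_euclidean.1 hV i, h i⟩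
    have hwξ' := fun p => hcoord (hwd p) (hwξ p)
    have hinvξ := h𝒞.frameInv hwd hwξ' (fun p => hcoord (hEd p) (hEξ p))
      ⟨hdetinv.1.differentiable (by simp), hdξ⟩
    have h1 : ∀ p, Differentiable ℝ (A₁ p) ∧ ExtendsToStrip ξ (A₁ p) := fun p =>
      ⟨(hA₁ p).1.differentiable (by simp), hA₁'' p ξ hξ (h𝒞.neg (hinvξ p).1).2⟩
    have h2 : ∀ p, Differentiable ℝ (A₂ p) ∧ ExtendsToStrip ξ (A₂ p) := fun p =>
      ⟨(hA₂ p).1.differentiable (by simp), hA₂'' p ξ hξ (h𝒞.neg (hinvξ p).2).2⟩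
    exact fun p i => (h𝒞.frameMul hwd hwξ' h1 h2 p i).2

end Frame

/-! ### Periodicity of jets and of the leading error. -/

section Periodicity

theorem iterate_dirDeriv_comp_add {𝕜 X E : Type*} [NontriviallyNormedField 𝕜]
    [NormedAddCommGroup X] [NormedSpace 𝕜 X] [NormedAddCommGroup E] [NormedSpace 𝕜 E]
    (g : X → E) (e a : X) (m : ℕ) :
    (dirDeriv 𝕜 e)^[m] (fun v => g (v + a)) = fun v => (dirDeriv 𝕜 e)^[m] g (v + a) := by
  induction m generalizing g with
  | zero => rfl
  | succ m ih =>
    rw [Function.iterate_succ_apply, Function.iterate_succ_apply, ← ih]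
    congr 1
    ext v
    simp [dirDeriv, fderiv_comp_add_right]

theorem periodic_jetCoeff {E : Type*} [NormedAddCommGroup E] [NormedSpace ℝ E]
    {g : ℝ × ℝ × ℝ → E} (hg : ∀ ε θ s, g (ε, θ + 1, s) = g (ε, θ, s)) (m p : ℕ) :
    Function.Periodic (jetCoeff m p g) 1 := by
  intro θ
  have h1 : (fun v => g (v + (0, 1, 0))) = g := by
    ext v
    have : v + ((0 : ℝ), (1 : ℝ), (0 : ℝ)) = (v.1, v.2.1 + 1, v.2.2) := by ext <;> simp
    rw [this, hg]
  have h2 : ∀ v, jetDeriv ℝ m p g (v + (0, 1, 0)) = jetDeriv ℝ m p g v := by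
    intro v
    conv_rhs => rw [← h1]
    rw [jetDeriv, jetDeriv, iterate_dirDeriv_comp_add, iterate_dirDeriv_comp_add]
  have h3 := h2 (0, θ, 0)
  simp only [Prod.mk_add_mk, add_zero] at h3
  rw [jetCoeff, jetCoeff, h3]

theorem periodic_leadingError {k : DelayKind} {f : ℝ × Plane × Plane → Plane} {r : Plane → ℝ}
    {om lam : ℕ → ℝ} {W : ℕ → ℕ → ℝ → Plane} {n : ℕ}
    (hW : ∀ m ≤ n, ∀ p, Function.Periodic (W m p) 1) (p : ℕ) :
    Function.Periodic (leadingError k f r om lam W n p) 1 :=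
  periodic_jetCoeff (fun ε θ s => truncError_periodic hW p ε θ s) _ _

end Periodicity

/-! ### Complex derivatives of complexified functions. -/

section Complexification

variable {X Y E F : Type*} [NormedAddCommGroup X] [NormedSpace ℝ X] [NormedAddCommGroup Y]
  [NormedSpace ℂ Y] [NormedSpace ℝ Y] [IsScalarTower ℝ ℂ Y] [NormedAddCommGroup E]
  [NormedSpace ℝ E] [NormedAddCommGroup F] [NormedSpace ℂ F] [NormedSpace ℝ F]
  [IsScalarTower ℝ ℂ F]

/-- `G ∘ i` and `j ∘ g` are the same germ of a real-differentiable map, and its derivative can be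
computed by the chain rule in both ways. -/
theorem fderiv_of_complexification (i : X →L[ℝ] Y) (j : E →L[ℝ] F) {g : X → E} {G : Y → F} {v : X}
    (hg : DifferentiableAt ℝ g v) (hG : DifferentiableAt ℂ G (i v))
    (h : ∀ᶠ x in 𝓝 v, G (i x) = j (g x)) (e : X) :
    fderiv ℂ G (i v) (i e) = j (fderiv ℝ g v e) := by
  have h1 := (hG.hasFDerivAt.restrictScalars ℝ).comp v i.hasFDerivAt
  have h2 := j.hasFDerivAt.comp v hg.hasFDerivAt
  exact DFunLike.congr_fun ((h2.congr_of_eventuallyEq h).unique h1).symm e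

theorem AnalyticAt.dirDeriv {𝕜 Y F : Type*} [NontriviallyNormedField 𝕜] [NormedAddCommGroup Y]
    [NormedSpace 𝕜 Y] [NormedAddCommGroup F] [NormedSpace 𝕜 F] [CompleteSpace F] {G : Y → F} {y : Y}
    (hG : AnalyticAt 𝕜 G y) (e : Y) : AnalyticAt 𝕜 (dirDeriv 𝕜 e G) y :=
  ((ContinuousLinearMap.apply 𝕜 F e).analyticAt _).comp hG.fderiv

theorem AnalyticAt.iterate_dirDeriv {𝕜 Y F : Type*} [NontriviallyNormedField 𝕜]
    [NormedAddCommGroup Y] [NormedSpace 𝕜 Y] [NormedAddCommGroup F] [NormedSpace 𝕜 F]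
    [CompleteSpace F] {G : Y → F} {y : Y} (hG : AnalyticAt 𝕜 G y) (e : Y) (m : ℕ) :
    AnalyticAt 𝕜 ((_root_.dirDeriv 𝕜 e)^[m] G) y := by
  induction m with
  | zero => exact hG
  | succ m ih =>
    rw [Function.iterate_succ_apply']
    exact ih.dirDeriv e

theorem iterate_dirDeriv_of_complexification [CompleteSpace F] (i : X →L[ℝ] Y) (j : E →L[ℝ] F)
    {g : X → E} {G : Y → F} {v : X} (hg : ContDiffAt ℝ ∞ g v) (hG : AnalyticAt ℂ G (i v))
    (h : ∀ᶠ x in 𝓝 v, G (i x) = j (g x)) (e : X) (m : ℕ) :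
    ∀ᶠ x in 𝓝 v, (dirDeriv ℂ (i e))^[m] G (i x) = j ((dirDeriv ℝ e)^[m] g x) := by
  induction m with
  | zero => exact h
  | succ m ih =>
    simp only [Function.iterate_succ_apply']
    have h1 : ContDiffAt ℝ 1 ((dirDeriv ℝ e)^[m] g) v := by
      simpa using contDiffAt_infty.1 (hg.iterate_dirDeriv_infty e m) 1
    filter_upwards [ih.eventually_nhds, h1.eventually (by simp),
      i.continuous.continuousAt.eventually (hG.iterate_dirDeriv (i e) m).eventually_analyticAt]
      with x hx hx1 hx2
    exact fderiv_of_complexification i j (hx1.differentiableAt (by simp)) hx2.differentiableAt hx e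

/-- The inclusion of `ℝ³` in `ℂ³`. -/
noncomputable def inclusion₃ : ℝ × ℝ × ℝ →L[ℝ] ℂ × ℂ × ℂ :=
  Complex.ofRealCLM.prodMap (Complex.ofRealCLM.prodMap Complex.ofRealCLM)

@[simp] theorem inclusion₃_apply (v : ℝ × ℝ × ℝ) :
    inclusion₃ v = ((v.1 : ℂ), (v.2.1 : ℂ), (v.2.2 : ℂ)) := rfl

/-- `complexify` as a continuous linear map. -/
noncomputable def complexifyCLM : Plane →L[ℝ] CPlane :=
  LinearMap.toContinuousLinearMap
    { toFun := complexify
      map_add' := fun x y => by ext i; simp [complexify]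
      map_smul' := fun c x => by ext i; simp [complexify] }

@[simp] theorem complexifyCLM_apply (x : Plane) : complexifyCLM x = complexify x := rfl

@[simp] theorem complexify_apply (x : Plane) (i : Fin 2) : complexify x i = (x i : ℂ) := rfl

/-- The coefficient of `ε^m s^p` in the expansion of a function of three complex variables. -/
noncomputable def complexJetCoeff (m p : ℕ) (G : ℂ × ℂ × ℂ → CPlane) (z : ℂ) : CPlane :=
  ((m.factorial : ℂ) * p.factorial)⁻¹ • jetDeriv ℂ m p G (0, z, 0)

theorem differentiableAt_complexJetCoeff {m p : ℕ} {G : ℂ × ℂ × ℂ → CPlane} {z : ℂ}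
    (hG : AnalyticAt ℂ G (0, z, 0)) : DifferentiableAt ℂ (complexJetCoeff m p G) z := by
  have h1 : DifferentiableAt ℂ (jetDeriv ℂ m p G) (0, z, 0) :=
    ((hG.iterate_dirDeriv _ m).iterate_dirDeriv _ p).differentiableAt
  have h2 : DifferentiableAt ℂ (fun z : ℂ => ((0 : ℂ), z, (0 : ℂ))) z := by fun_prop
  exact (DifferentiableAt.comp z h1 h2).const_smul ((m.factorial : ℂ) * p.factorial)⁻¹

theorem complexJetCoeff_ofReal {m p : ℕ} {G : ℂ × ℂ × ℂ → CPlane} {g : ℝ × ℝ × ℝ → Plane} {θ : ℝ}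
    (hG : AnalyticAt ℂ G (0, θ, 0)) (hg : ContDiffAt ℝ ∞ g (0, θ, 0))
    (h : ∀ᶠ v in 𝓝 ((0 : ℝ), θ, (0 : ℝ)), G (inclusion₃ v) = complexify (g v)) :
    complexJetCoeff m p G θ = complexify (jetCoeff m p g θ) := by
  have hG' : AnalyticAt ℂ G (inclusion₃ (0, θ, 0)) := by simpa using hG
  have h1 := iterate_dirDeriv_of_complexification inclusion₃ complexifyCLM hg hG' h (1, 0, 0) m
  have h2 := (iterate_dirDeriv_of_complexification inclusion₃ complexifyCLM
    (hg.iterate_dirDeriv_infty (1, 0, 0) m) (hG'.iterate_dirDeriv _ m) h1 (0, 0, 1) p).self_of_nhds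
  simp only [inclusion₃_apply, Complex.ofReal_zero, Complex.ofReal_one, complexifyCLM_apply] at h2
  rw [complexJetCoeff, jetCoeff, jetDeriv, h2]
  ext i
  simp [jetDeriv]

end Complexification

/-! ### Strips and the identity theorem. -/

section Strip

theorem planeExtends_iff {ξ : ℝ} {V : ℝ → Plane} :
    PlaneExtends ξ V ↔ ∃ G : ℂ → CPlane, DifferentiableOn ℂ G (strip ξ) ∧
      ∀ θ : ℝ, G θ = complexify (V θ) := by
  constructor
  · intro h
    choose G hG hG' using h
    refine ⟨fun z => WithLp.toLp 2 fun i => G i z, differentiableOn_euclidean.2 hG, fun θ => ?_⟩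
    ext i
    exact hG' i θ
  · rintro ⟨G, hG, hG'⟩ i
    exact ⟨fun z => G z i, differentiableOn_euclidean.1 hG i, fun θ => by simp [hG' θ]⟩

theorem ExtendsToStrip.mono {ξ ξ' : ℝ} (hξ : ξ' ≤ ξ) {g : ℝ → ℝ} (h : ExtendsToStrip ξ g) :
    ExtendsToStrip ξ' g := by
  obtain ⟨G, hG, hG'⟩ := h
  exact ⟨G, hG.mono fun z hz => lt_of_lt_of_le hz hξ, hG'⟩

theorem PlaneExtends.mono {ξ ξ' : ℝ} (hξ : ξ' ≤ ξ) {V : ℝ → Plane} (h : PlaneExtends ξ V) :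
    PlaneExtends ξ' V := fun i => (h i).mono hξ

theorem convex_strip (ξ : ℝ) : Convex ℝ (strip ξ) := by
  have : strip ξ = Complex.imCLM ⁻¹' Metric.ball 0 ξ := by
    ext z
    simp [strip]
  rw [this]
  exact (convex_ball 0 ξ).is_linear_preimage Complex.imCLM.toLinearMap.isLinear

/-- Identity theorem for the real points of a convex open set. -/
theorem eqOn_of_eq_real {F : Type*} [NormedAddCommGroup F] [NormedSpace ℂ F] [CompleteSpace F]
    {U : Set ℂ} (hU : IsOpen U) (hconv : Convex ℝ U) {x₀ : ℝ} (hx₀ : (x₀ : ℂ) ∈ U) {g h : ℂ → F}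
    (hg : DifferentiableOn ℂ g U) (hh : DifferentiableOn ℂ h U)
    (heq : ∀ᶠ x : ℝ in 𝓝 x₀, g x = h x) : Set.EqOn g h U := by
  refine (hg.analyticOnNhd hU).eqOn_of_preconnected_of_frequently_eq (hh.analyticOnNhd hU)
    hconv.isPreconnected hx₀ ?_
  have h1 : Tendsto (fun x : ℝ => (x : ℂ)) (𝓝[≠] x₀) (𝓝[≠] (x₀ : ℂ)) := by
    refine tendsto_nhdsWithin_of_tendsto_nhds_of_eventually_within _
      (Complex.continuous_ofReal.continuousAt.mono_left nhdsWithin_le_nhds) ?_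
    filter_upwards [self_mem_nhdsWithin] with x hx
    simpa using hx
  exact h1.frequently (heq.filter_mono nhdsWithin_le_nhds).frequently

theorem eqOn_strip_of_eq_real {F : Type*} [NormedAddCommGroup F] [NormedSpace ℂ F] [CompleteSpace F]
    {ξ : ℝ} (hξ : 0 < ξ) {g h : ℂ → F} (hg : DifferentiableOn ℂ g (strip ξ))
    (hh : DifferentiableOn ℂ h (strip ξ)) (heq : ∀ x : ℝ, g x = h x) :
    Set.EqOn g h (strip ξ) :=
  eqOn_of_eq_real (isOpen_strip ξ) (convex_strip ξ) (ofReal_mem_strip hξ 0) hg hh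
    (Eventually.of_forall heq)

/-- Periodicity of the extension follows from that of `V` by the identity theorem. It can therefore
be ignored in the induction and restored at the end. -/
theorem PlaneExtends.analyticOnStrip {ξ : ℝ} (hξ : 0 < ξ) {V : ℝ → Plane} (h : PlaneExtends ξ V)
    (hV : Function.Periodic V 1) : AnalyticOnStrip ξ V := by
  obtain ⟨G, hG, hG'⟩ := planeExtends_iff.1 h
  refine ⟨G, hG, ?_, hG'⟩
  have hmem : ∀ z ∈ strip ξ, z + 1 ∈ strip ξ := fun z hz => by
    simpa using add_ofReal_mem_strip hz 1
  refine eqOn_strip_of_eq_real hξ (g := fun z => G (z + 1))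
    (hG.comp (by fun_prop) hmem) hG fun x => ?_
  have : ((x : ℂ) + 1) = ((x + 1 : ℝ) : ℂ) := by simp
  rw [this, hG', hG', hV]

end Strip

/-! ### The error in complex variables. -/

/-- `w'`, `F`, `R` are analytic extensions of the coefficients `w` over the strip of half width `ξ`,
and of `f` and `r` near the corresponding points. -/
structure ComplexData (k : DelayKind) (f : ℝ × Plane × Plane → Plane) (r : Plane → ℝ)
    (w : ℕ → ℝ → Plane) (ξ : ℝ) (w' : ℕ → ℂ → CPlane) (F : ℂ × CPlane × CPlane → CPlane)
    (R : CPlane → ℂ) : Prop where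
  pos : 0 < ξ
  differentiableOn : ∀ p, DifferentiableOn ℂ (w' p) (strip ξ)
  extends_real : ∀ p (θ : ℝ), w' p θ = complexify (w p θ)
  analyticAt_field : ∀ z ∈ strip ξ, AnalyticAt ℂ F (0, w' 0 z, k.weight (0 : ℂ) • w' 0 z)
  analyticAt_delay : ∀ z ∈ strip ξ, AnalyticAt ℂ R (w' 0 z)
  field_real : ∀ θ : ℝ, ∀ᶠ v : ℝ × Plane × Plane in 𝓝 (0, w 0 θ, k.base (w 0 θ)),
    F ((v.1 : ℂ), complexify v.2.1, complexify v.2.2) = complexify (f v)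
  delay_real : ∀ θ : ℝ, ∀ᶠ x in 𝓝 (w 0 θ), R (complexify x) = (r x : ℂ)

/-- `∑_{m ≤ n} ε^m a_m` for complex `ε`. -/
noncomputable def complexTruncScalar (a : ℕ → ℝ) (n : ℕ) (ε : ℂ) : ℂ :=
  ∑ m ∈ Finset.range (n + 1), ε ^ m * (a m : ℂ)

/-- `∑_{m ≤ n} ε^m ∑_{p ≤ P} s^p G_m^{(p)}(z)` at `(ε, z, s)`. -/
noncomputable def complexTruncSeries (G : ℕ → ℕ → ℂ → CPlane) (n P : ℕ) (v : ℂ × ℂ × ℂ) : CPlane :=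
  ∑ m ∈ Finset.range (n + 1), v.1 ^ m • ∑ p ∈ Finset.range (P + 1), v.2.2 ^ p • G m p v.2.1

/-- The point at which the truncated series is evaluated in the delayed argument. -/
noncomputable def complexDelayedPoint (k : DelayKind) (R : CPlane → ℂ) (om lam : ℕ → ℝ)
    (G : ℕ → ℕ → ℂ → CPlane) (n P : ℕ) (v : ℂ × ℂ × ℂ) : ℂ × ℂ × ℂ :=
  (v.1, v.2.1 - k.scale v.1 * complexTruncScalar om n v.1 * R (complexTruncSeries G n P v),
    v.2.2 * Complex.exp (-(k.scale v.1 * complexTruncScalar lam n v.1 *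
      R (complexTruncSeries G n P v))))

/-- The error of the truncated series in complex variables `(ε, z, s)`. -/
noncomputable def complexError (k : DelayKind) (F : ℂ × CPlane × CPlane → CPlane) (R : CPlane → ℂ)
    (om lam : ℕ → ℝ) (G : ℕ → ℕ → ℂ → CPlane) (n P : ℕ) (v : ℂ × ℂ × ℂ) : CPlane :=
  complexTruncScalar om n v.1 • dirDeriv ℂ (0, 1, 0) (complexTruncSeries G n P) v
    + (v.2.2 * complexTruncScalar lam n v.1) •
      dirDeriv ℂ (0, 0, 1) (complexTruncSeries G n P) v
    - F (v.1, complexTruncSeries G n P v, k.weight v.1 •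
      complexTruncSeries G n P (complexDelayedPoint k R om lam G n P v))

theorem complexTruncScalar_ofReal (a : ℕ → ℝ) (n : ℕ) (ε : ℝ) :
    complexTruncScalar a n ε = (truncScalar a n ε : ℂ) := by
  simp [complexTruncScalar, truncScalar]

@[simp] theorem complexTruncScalar_zero (a : ℕ → ℝ) (n : ℕ) :
    complexTruncScalar a n 0 = (a 0 : ℂ) := by
  simp [complexTruncScalar, Finset.sum_range_succ']

@[simp] theorem complexTruncSeries_zero (G : ℕ → ℕ → ℂ → CPlane) (n P : ℕ) (z : ℂ) :
    complexTruncSeries G n P (0, z, 0) = G 0 0 z := by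
  simp [complexTruncSeries, Finset.sum_range_succ']

theorem DelayKind.scale_ofReal (k : DelayKind) (ε : ℝ) : k.scale (ε : ℂ) = ((k.scale ε : ℝ) : ℂ) := by
  cases k <;> simp [DelayKind.scale]

theorem DelayKind.weight_ofReal (k : DelayKind) (ε : ℝ) : k.weight (ε : ℂ) = ((k.weight ε : ℝ) : ℂ) := by
  cases k <;> simp [DelayKind.weight]

theorem DelayKind.analyticAt_scale (k : DelayKind) (z : ℂ) : AnalyticAt ℂ k.scale z := by
  cases k
  · exact analyticAt_id
  · exact analyticAt_const

theorem DelayKind.analyticAt_weight (k : DelayKind) (z : ℂ) : AnalyticAt ℂ k.weight z := by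
  cases k
  · exact analyticAt_const
  · exact analyticAt_id

theorem analyticAt_complexTruncScalar (a : ℕ → ℝ) (n : ℕ) (ε : ℂ) :
    AnalyticAt ℂ (complexTruncScalar a n) ε :=
  Finset.analyticAt_fun_sum _ fun m _ => (analyticAt_id.pow m).mul analyticAt_const

theorem analyticAt_complexTruncSeries {G : ℕ → ℕ → ℂ → CPlane} {n : ℕ} {U : Set ℂ} (hU : IsOpen U)
    (hG : ∀ m ≤ n, ∀ p, DifferentiableOn ℂ (G m p) U) (P : ℕ) {v : ℂ × ℂ × ℂ} (hv : v.2.1 ∈ U) :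
    AnalyticAt ℂ (complexTruncSeries G n P) v := by
  refine Finset.analyticAt_fun_sum _ fun m hm => (analyticAt_fst.pow m).smul
    (Finset.analyticAt_fun_sum _ fun p _ => ?_)
  have h1 : AnalyticAt ℂ (G m p) v.2.1 :=
    (hG m (Nat.lt_succ_iff.1 (Finset.mem_range.1 hm)) p).analyticAt (hU.mem_nhds hv)
  have h2 : AnalyticAt ℂ (fun v : ℂ × ℂ × ℂ => v.2.1) v := analyticAt_fst.comp analyticAt_snd
  have h3 : AnalyticAt ℂ (fun v : ℂ × ℂ × ℂ => v.2.2) v := analyticAt_snd.comp analyticAt_snd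
  exact (h3.pow p).smul (AnalyticAt.comp (g := G m p) h1 h2)

theorem complexTruncSeries_inclusion {G : ℕ → ℕ → ℂ → CPlane} {W : ℕ → ℕ → ℝ → Plane} {n : ℕ}
    (hG : ∀ m ≤ n, ∀ p, ∀ θ : ℝ, G m p θ = complexify (W m p θ)) (P : ℕ) (v : ℝ × ℝ × ℝ) :
    complexTruncSeries G n P (inclusion₃ v) = complexify (truncSeries W n P v.1 v.2.1 v.2.2) := by
  ext i
  simp only [complexTruncSeries, truncSeries, inclusion₃_apply, complexify_apply,
    WithLp.ofLp_sum, WithLp.ofLp_smul, Finset.sum_apply, Pi.smul_apply, smul_eq_mul,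
    Complex.ofReal_sum, Complex.ofReal_mul, Complex.ofReal_pow]
  refine Finset.sum_congr rfl fun m hm => ?_
  congr 1
  refine Finset.sum_congr rfl fun p _ => ?_
  rw [hG m (Nat.lt_succ_iff.1 (Finset.mem_range.1 hm)) p]
  rfl

section Error

variable {k : DelayKind} {f : ℝ × Plane × Plane → Plane} {r : Plane → ℝ} {om lam : ℕ → ℝ}
  {W : ℕ → ℕ → ℝ → Plane} {w' : ℕ → ℂ → CPlane} {F : ℂ × CPlane × CPlane → CPlane}
  {R : CPlane → ℂ} {ξ ξ₁ ξ₂ : ℝ} {G : ℕ → ℕ → ℂ → CPlane} {n : ℕ}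

/-- At `ε = s = 0` the delayed point has the `z`-coordinate in `hshift`, so the coefficients must be
analytic there. This is needed in the second family as well, although the delayed argument has
weight `0` at `ε = 0`, because `ε`-derivatives see it. For `F` only the unshifted point matters:
either the shift or the weight is zero. -/
theorem analyticAt_complexError (hd : ComplexData k f r (W 0) ξ w' F R) (hξ : ξ₁ ≤ ξ)
    (hG0 : G 0 = w') (hG : ∀ m ≤ n, ∀ p, DifferentiableOn ℂ (G m p) (strip ξ₁)) (P : ℕ) {z : ℂ}
    (hz : z ∈ strip ξ₁) (hshift : z - k.scale (0 : ℂ) * om 0 * R (w' 0 z) ∈ strip ξ₁) :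
    AnalyticAt ℂ (complexError k F R om lam G n P) (0, z, 0) := by
  have hzξ : z ∈ strip ξ := lt_of_lt_of_le hz hξ
  have hT : ∀ v : ℂ × ℂ × ℂ, v.2.1 ∈ strip ξ₁ → AnalyticAt ℂ (complexTruncSeries G n P) v :=
    fun v hv => analyticAt_complexTruncSeries (isOpen_strip ξ₁) hG P hv
  have hT0 := hT (0, z, 0) hz
  have hv1 : AnalyticAt ℂ (fun v : ℂ × ℂ × ℂ => v.1) (0, z, 0) := analyticAt_fst
  have hv2 : AnalyticAt ℂ (fun v : ℂ × ℂ × ℂ => v.2.1) (0, z, 0) :=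
    analyticAt_fst.comp analyticAt_snd
  have hv3 : AnalyticAt ℂ (fun v : ℂ × ℂ × ℂ => v.2.2) (0, z, 0) :=
    analyticAt_snd.comp analyticAt_snd
  have hsc : AnalyticAt ℂ (fun v : ℂ × ℂ × ℂ => k.scale v.1) (0, z, 0) :=
    AnalyticAt.comp (g := k.scale) (k.analyticAt_scale _) hv1
  have hwt : AnalyticAt ℂ (fun v : ℂ × ℂ × ℂ => k.weight v.1) (0, z, 0) :=
    AnalyticAt.comp (g := k.weight) (k.analyticAt_weight _) hv1
  have hom : AnalyticAt ℂ (fun v : ℂ × ℂ × ℂ => complexTruncScalar om n v.1) (0, z, 0) :=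
    AnalyticAt.comp (g := complexTruncScalar om n) (analyticAt_complexTruncScalar _ _ _) hv1
  have hlam : AnalyticAt ℂ (fun v : ℂ × ℂ × ℂ => complexTruncScalar lam n v.1) (0, z, 0) :=
    AnalyticAt.comp (g := complexTruncScalar lam n) (analyticAt_complexTruncScalar _ _ _) hv1
  have hR : AnalyticAt ℂ (fun v => R (complexTruncSeries G n P v)) (0, z, 0) := by
    refine AnalyticAt.comp (g := R) ?_ hT0
    rw [complexTruncSeries_zero, hG0]
    exact hd.analyticAt_delay z hzξ
  have hpt : AnalyticAt ℂ (complexDelayedPoint k R om lam G n P) (0, z, 0) :=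
    hv1.prod ((hv2.sub ((hsc.mul hom).mul hR)).prod (hv3.mul ((hsc.mul hlam).mul hR).neg.cexp))
  have hpt0 : complexDelayedPoint k R om lam G n P (0, z, 0) =
      (0, z - k.scale (0 : ℂ) * om 0 * R (w' 0 z), 0) := by
    simp [complexDelayedPoint, hG0]
  have hTd : AnalyticAt ℂ (fun v => complexTruncSeries G n P
      (complexDelayedPoint k R om lam G n P v)) (0, z, 0) := by
    refine AnalyticAt.comp (g := complexTruncSeries G n P) (hT _ ?_) hpt
    rw [hpt0]
    exact hshift
  refine ((hom.smul (hT0.dirDeriv _)).add ((hv3.mul hlam).smul (hT0.dirDeriv _))).sub ?_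
  refine AnalyticAt.comp (g := F) ?_ (hv1.prod (hT0.prod (hwt.smul hTd)))
  have h0 : k.weight (0 : ℂ) • complexTruncSeries G n P
      (complexDelayedPoint k R om lam G n P (0, z, 0)) = k.weight (0 : ℂ) • w' 0 z := by
    rw [hpt0, complexTruncSeries_zero, hG0]
    cases k <;> simp [DelayKind.weight, DelayKind.scale]
  simp only [h0, complexTruncSeries_zero, hG0]
  exact hd.analyticAt_field z hzξ

theorem complexError_inclusion (hd : ComplexData k f r (W 0) ξ w' F R) (hξ₁ : 0 < ξ₁)
    (hW : ∀ m ≤ n, ∀ p, ContDiff ℝ ∞ (W m p)) (hr : ∀ θ, ContDiffAt ℝ ∞ r (W 0 0 θ))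
    (hG : ∀ m ≤ n, ∀ p, DifferentiableOn ℂ (G m p) (strip ξ₁))
    (hG' : ∀ m ≤ n, ∀ p, ∀ θ : ℝ, G m p θ = complexify (W m p θ)) (P : ℕ) (θ : ℝ) :
    ∀ᶠ v in 𝓝 ((0 : ℝ), θ, (0 : ℝ)), complexError k F R om lam G n P (inclusion₃ v) =
      complexify (errorFun k f r om lam W n P v) := by
  set T : ℝ × ℝ × ℝ → Plane := fun v => truncSeries W n P v.1 v.2.1 v.2.2 with hTdef
  have hT : ContDiff ℝ ∞ T := contDiff_truncSeries hW P
  have hTd : ∀ v, DifferentiableAt ℝ T v := hT.differentiable (by simp)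
  have hT' : ∀ v, complexTruncSeries G n P (inclusion₃ v) = complexify (T v) :=
    complexTruncSeries_inclusion hG' P
  have hTt : Tendsto T (𝓝 (0, θ, 0)) (𝓝 (W 0 0 θ)) := by
    simpa [hTdef] using hT.continuous.tendsto ((0 : ℝ), θ, (0 : ℝ))
  let D : ℝ × ℝ × ℝ → Plane := fun v => delayedArg k r v.1 (truncScalar om n v.1)
    (truncScalar lam n v.1) (truncSeries W n P v.1) v.2.1 v.2.2
  have hD : ContDiffAt ℝ ∞ D (0, θ, 0) :=
    contDiffAt_delayedArg k contDiff_id (contDiff_truncScalar om n) (contDiff_truncScalar lam n)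
      hT (by simpa using hr θ)
  have hDt : Tendsto D (𝓝 (0, θ, 0)) (𝓝 (k.base (W 0 0 θ))) := by
    have : D (0, θ, 0) = k.base (W 0 0 θ) := by simp [D, delayedArg_zero]
    rw [← this]
    exact hD.continuousAt
  have hFt : Tendsto (fun v : ℝ × ℝ × ℝ => (v.1, T v, D v)) (𝓝 (0, θ, 0))
      (𝓝 (0, W 0 0 θ, k.base (W 0 0 θ))) :=
    (continuous_fst.tendsto' _ _ rfl).prodMk_nhds (hTt.prodMk_nhds hDt)
  filter_upwards [hTt.eventually (hd.delay_real θ), hFt.eventually (hd.field_real θ)] with v hv1 hv2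
  have hder : ∀ e, dirDeriv ℂ (inclusion₃ e) (complexTruncSeries G n P) (inclusion₃ v) =
      complexify (dirDeriv ℝ e T v) := fun e =>
    fderiv_of_complexification inclusion₃ complexifyCLM (hTd v)
      (analyticAt_complexTruncSeries (isOpen_strip ξ₁) hG P
        (ofReal_mem_strip hξ₁ v.2.1)).differentiableAt (Eventually.of_forall hT') e
  have hd2 := hder (0, 1, 0)
  have hd3 := hder (0, 0, 1)
  simp only [inclusion₃_apply, Complex.ofReal_zero, Complex.ofReal_one] at hd2 hd3
  have hpt : complexDelayedPoint k R om lam G n P (inclusion₃ v) =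
      inclusion₃ (v.1, v.2.1 - k.scale v.1 * truncScalar om n v.1 * r (T v),
        v.2.2 * Real.exp (-(k.scale v.1 * truncScalar lam n v.1 * r (T v)))) := by
    rw [complexDelayedPoint, hT', hv1]
    simp [complexTruncScalar_ofReal, k.scale_ofReal]
  have harg : k.weight (v.1 : ℂ) • complexTruncSeries G n P
      (complexDelayedPoint k R om lam G n P (inclusion₃ v)) = complexify (D v) := by
    rw [hpt, hT', k.weight_ofReal]
    simp only [D, delayedArg_eq, hTdef]
    ext i
    simp
  have hval : errorFun k f r om lam W n P v = truncScalar om n v.1 • dirDeriv ℝ (0, 1, 0) T v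
      + (v.2.2 * truncScalar lam n v.1) • dirDeriv ℝ (0, 0, 1) T v - f (v.1, T v, D v) := by
    simp only [errorFun, truncError, invarianceError]
    rw [deriv_theta_eq_dirDeriv (hTd _), deriv_s_eq_dirDeriv (hTd _)]
  have hF : F (((inclusion₃ v).1, complexTruncSeries G n P (inclusion₃ v),
      k.weight (inclusion₃ v).1 • complexTruncSeries G n P
        (complexDelayedPoint k R om lam G n P (inclusion₃ v)))) =
      complexify (f (v.1, T v, D v)) := by
    rw [hT', show (inclusion₃ v).1 = (v.1 : ℂ) from rfl, harg]
    exact hv2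
  rw [hval, complexError, hF]
  have h2 : dirDeriv ℂ (0, 1, 0) (complexTruncSeries G n P) (inclusion₃ v) =
    complexify (dirDeriv ℝ (0, 1, 0) T v) := hd2
  have h3 : dirDeriv ℂ (0, 0, 1) (complexTruncSeries G n P) (inclusion₃ v) =
    complexify (dirDeriv ℝ (0, 0, 1) T v) := hd3
  rw [h2, h3]
  ext i
  simp [complexTruncScalar_ofReal]

/-- The leading error is analytic in a strip whose delayed points stay in the strip of
analyticity of the series. -/
theorem planeExtends_leadingError (hd : ComplexData k f r (W 0) ξ w' F R) (hξ₂ : 0 < ξ₂)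
    (h21 : ξ₂ ≤ ξ₁) (h1 : ξ₁ ≤ ξ)
    (hshift : ∀ z ∈ strip ξ₂, z - k.scale (0 : ℂ) * om 0 * R (w' 0 z) ∈ strip ξ₁)
    (hW : ∀ m ≤ n, ∀ p, ContDiff ℝ ∞ (W m p)) (hr : ∀ θ, ContDiffAt ℝ ∞ r (W 0 0 θ))
    (hf : ∀ θ, ContDiffAt ℝ ∞ f (0, W 0 0 θ, k.base (W 0 0 θ)))
    (hext : ∀ m ≤ n, ∀ p, PlaneExtends ξ₁ (W m p)) (p : ℕ) :
    PlaneExtends ξ₂ (leadingError k f r om lam W n p) := by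
  have hex : ∀ m p, ∃ g : ℂ → CPlane, m ≤ n → DifferentiableOn ℂ g (strip ξ₁) ∧
      ∀ θ : ℝ, g θ = complexify (W m p θ) := by
    intro m p
    by_cases hm : m ≤ n
    · obtain ⟨g, hg⟩ := planeExtends_iff.1 (hext m hm p)
      exact ⟨g, fun _ => hg⟩
    · exact ⟨0, fun h => absurd h hm⟩
  choose g hg using hex
  -- At order `0` the extension must be the given `w'`, at whose values `F` and `R` are known to be
  -- analytic; at higher orders any extension will do.
  let G : ℕ → ℕ → ℂ → CPlane := fun m => if m = 0 then w' else g m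
  have hG0 : G 0 = w' := rfl
  have hGd : ∀ m ≤ n, ∀ p, DifferentiableOn ℂ (G m p) (strip ξ₁) ∧
      ∀ θ : ℝ, G m p θ = complexify (W m p θ) := by
    intro m hm p
    rcases eq_or_ne m 0 with rfl | hm0
    · exact ⟨(hd.differentiableOn p).mono fun z hz => lt_of_lt_of_le hz h1, hd.extends_real p⟩
    · simpa [G, hm0] using hg m p hm
  have han : ∀ z ∈ strip ξ₂, AnalyticAt ℂ (complexError k F R om lam G n p) (0, z, 0) :=
    fun z hz => analyticAt_complexError hd h1 hG0 (fun m hm p => (hGd m hm p).1) p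
      (lt_of_lt_of_le hz h21) (hshift z hz)
  refine planeExtends_iff.2 ⟨complexJetCoeff (n + 1) p (complexError k F R om lam G n p),
    fun z hz => (differentiableAt_complexJetCoeff (han z hz)).differentiableWithinAt, fun θ => ?_⟩
  exact complexJetCoeff_ofReal (han θ (ofReal_mem_strip hξ₂ θ))
    (smoothAtCycle_truncError hW hr hf p θ)
    (complexError_inclusion hd (hξ₂.trans_le h21) hW hr (fun m hm p => (hGd m hm p).1)
      (fun m hm p => (hGd m hm p).2) p θ)

end Error

/-! ### Variational equations and nondegeneracy of the frame in the strip. -/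

section Variational

variable {X : Plane → Plane} {om₀ lam₀ : ℝ} {g : ℝ × ℝ × ℝ → Plane} {w : ℕ → ℝ → Plane}

theorem UnperturbedExpansion.dirDeriv_theta_eq (hg : UnperturbedExpansion X om₀ lam₀ g w) (θ : ℝ) :
    dirDeriv ℝ (0, 1, 0) g (0, θ, 0) = deriv (w 0) θ := by
  have h := (hg.taylor_theta 1 θ).eq_zero_imp.self_of_nhds (by simp)
  simpa [sPoly, sub_eq_zero] using h

theorem UnperturbedExpansion.dirDeriv_s_eq (hg : UnperturbedExpansion X om₀ lam₀ g w) (θ : ℝ) :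
    dirDeriv ℝ (0, 0, 1) g (0, θ, 0) = w 1 θ := by
  have h := (hg.taylor_s 1 θ).eq_zero_imp.self_of_nhds (by simp)
  simpa [sPoly, sub_eq_zero] using h

/-- The variational equation along the cycle for `∂_θ W` and `∂_s W`. -/
theorem UnperturbedExpansion.variational (hg : UnperturbedExpansion X om₀ lam₀ g w) (θ : ℝ) :
    om₀ • deriv (deriv (w 0)) θ = fderiv ℝ X (w 0 θ) (deriv (w 0) θ) ∧
    om₀ • deriv (w 1) θ + lam₀ • w 1 θ = fderiv ℝ X (w 0 θ) (w 1 θ) := by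
  have hline : ∀ {h : ℝ × ℝ × ℝ → Plane}, SmoothAtCycle h →
      deriv (fun t => h (0, t, 0)) θ = dirDeriv ℝ (0, 1, 0) h (0, θ, 0) := by
    intro h hh
    have h1 : HasDerivAt (fun t : ℝ => ((0 : ℝ), t, (0 : ℝ))) ((0 : ℝ), (1 : ℝ), (0 : ℝ)) θ :=
      (hasDerivAt_const θ _).prodMk ((hasDerivAt_id θ).prodMk (hasDerivAt_const θ _))
    exact (((hh θ).differentiableAt (by simp)).hasFDerivAt.comp_hasDerivAt θ h1).deriv
  have hconst : ∀ (c : ℝ) (e : ℝ × ℝ × ℝ),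
      dirDeriv ℝ e (fun _ : ℝ × ℝ × ℝ => c) (0, θ, 0) = 0 := by
    intro c e
    simp [dirDeriv]
  -- The two vectors of the frame are the combinations with constant coefficients `(1, 0)` and `(0,
  -- 1)`.
  have h1 := (hg.linearized_frame (a₁ := fun _ => 1) (a₂ := fun _ => 0) contDiff_const
    contDiff_const θ).self_of_nhds
  have h2 := (hg.linearized_frame (a₁ := fun _ => 0) (a₂ := fun _ => 1) contDiff_const
    contDiff_const θ).self_of_nhds
  simp only [one_smul, zero_smul, add_zero, zero_add, hconst, mul_zero, zero_mul, sub_zero,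
    mul_one, zero_sub, ← hline (hg.smooth.dirDeriv _), hg.dirDeriv_theta_eq, hg.dirDeriv_s_eq,
    hg.value, neg_smul] at h1 h2
  refine ⟨sub_eq_zero.1 h1, ?_⟩
  rw [sub_eq_iff_eq_add] at h2
  rw [h2]
  abel

end Variational

theorem deriv_of_complexification {V : ℝ → Plane} {G : ℂ → CPlane} {θ : ℝ}
    (hV : DifferentiableAt ℝ V θ) (hG : DifferentiableAt ℂ G θ)
    (h : ∀ t : ℝ, G t = complexify (V t)) : deriv G θ = complexify (deriv V θ) := by
  have := fderiv_of_complexification Complex.ofRealCLM complexifyCLM hV hG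
    (Eventually.of_forall h) 1
  simpa using this

/-- A solution of a scalar linear equation along a segment vanishes identically if it vanishes at
one end. -/
theorem eq_zero_of_deriv_eq_mul {φ ψ : ℝ → ℂ} (hφ : ∀ t ∈ Set.Icc (0 : ℝ) 1,
    HasDerivAt φ (ψ t * φ t) t) (hψ : ContinuousOn ψ (Set.Icc 0 1)) (h0 : φ 0 = 0) : φ 1 = 0 := by
  obtain ⟨K, hK⟩ := isCompact_Icc.exists_bound_of_continuousOn hψ
  have h := norm_le_gronwallBound_of_norm_deriv_right_le (f := φ) (f' := fun t => ψ t * φ t)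
    (δ := 0) (K := K) (ε := 0) (a := 0) (b := 1)
    (fun t ht => (hφ t ht).continuousAt.continuousWithinAt)
    (fun t ht => (hφ t ⟨ht.1, ht.2.le⟩).hasDerivWithinAt) (by simp [h0])
    (fun t ht => by
      rw [norm_mul, add_zero]
      exact mul_le_mul_of_nonneg_right (hK t ⟨ht.1, ht.2.le⟩) (norm_nonneg _)) 1 (by simp)
  simpa [gronwallBound_ε0] using h

/-- By convexity the segment from a zero `z` to `x` lies in `U`; along it `D` solves a scalar linear
equation with continuous coefficient, so vanishing at `z` would propagate to `x`. -/
theorem ne_zero_of_deriv_eq_mul {U : Set ℂ} (hU : Convex ℝ U) {D c : ℂ → ℂ}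
    (hD : ∀ z ∈ U, HasDerivAt D (c z * D z) z) (hc : ContinuousOn c U) {x z : ℂ} (hx : x ∈ U)
    (hz : z ∈ U) (hDx : D x ≠ 0) : D z ≠ 0 := by
  intro h0
  refine hDx ?_
  have hmem : ∀ t ∈ Set.Icc (0 : ℝ) 1, z + (t : ℂ) * (x - z) ∈ U := by
    intro t ht
    have := hU.add_smul_sub_mem hz hx ht
    simpa using this
  have hline : ∀ t : ℝ, HasDerivAt (fun t : ℝ => z + (t : ℂ) * (x - z)) (x - z) t := by
    intro t
    simpa using ((Complex.ofRealCLM.hasDerivAt (x := t)).mul_const (x - z)).const_add z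
  have := eq_zero_of_deriv_eq_mul (φ := fun t : ℝ => D (z + (t : ℂ) * (x - z)))
    (ψ := fun t : ℝ => (x - z) * c (z + (t : ℂ) * (x - z)))
    (fun t ht => ((hD _ (hmem t ht)).comp t (hline t)).congr_deriv (by ring))
    (continuousOn_const.mul (hc.comp (by fun_prop) hmem)) (by simpa using h0)
  simpa using this

/-- The trace of a linear map of the plane. -/
theorem det_apply_add_det_apply (A : CPlane →L[ℂ] CPlane) (a b : CPlane) :
    (A a 0 * b 1 - A a 1 * b 0) + (a 0 * A b 1 - a 1 * A b 0) =
      (A (EuclideanSpace.single 0 1) 0 + A (EuclideanSpace.single 1 1) 1) *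
        (a 0 * b 1 - a 1 * b 0) := by
  have hx : ∀ x : CPlane, A x = x 0 • A (EuclideanSpace.single 0 1) +
      x 1 • A (EuclideanSpace.single 1 1) := by
    intro x
    rw [← map_smul, ← map_smul, ← map_add]
    congr 1
    ext i
    fin_cases i <;> simp
  rw [hx a, hx b]
  simp only [PiLp.add_apply, PiLp.smul_apply, smul_eq_mul]
  ring

section FrameStrip

variable {k : DelayKind} {f : ℝ × Plane × Plane → Plane} {r : Plane → ℝ} {om₀ lam₀ : ℝ}
  {w : ℕ → ℝ → Plane} {g : ℝ × ℝ × ℝ → Plane} {w' : ℕ → ℂ → CPlane}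
  {F : ℂ × CPlane × CPlane → CPlane} {R : CPlane → ℂ} {ξ : ℝ}

/-- The frame of the unperturbed parameterization is nondegenerate in the whole strip. -/
theorem extendsToStrip_inv_frameDet (hd : ComplexData k f r w ξ w' F R) (hom : om₀ ≠ 0)
    (hg : UnperturbedExpansion (fun x => f (0, x, k.base x)) om₀ lam₀ g w)
    (hdet : ∀ θ, frameDet w θ ≠ 0) : ExtendsToStrip ξ (fun θ => (frameDet w θ)⁻¹) := by
  have hξ := hd.pos
  have hopen := isOpen_strip ξ
  have hreal := ofReal_mem_strip hξ
  have hwd : ∀ p, Differentiable ℝ (w p) := fun p => (hg.smooth_coeff p).differentiable (by simp)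
  have hdiffAt : ∀ {h : ℂ → CPlane}, DifferentiableOn ℂ h (strip ξ) → ∀ z ∈ strip ξ,
      DifferentiableAt ℂ h z := fun hh z hz => hh.differentiableAt (hopen.mem_nhds hz)
  have hder : ∀ p (θ : ℝ), deriv (w' p) θ = complexify (deriv (w p) θ) := fun p θ =>
    deriv_of_complexification (hwd p θ) (hdiffAt (hd.differentiableOn p) _ (hreal θ))
      (hd.extends_real p)
  set a : ℂ → CPlane := deriv (w' 0) with ha
  set b : ℂ → CPlane := w' 1 with hb
  have had : DifferentiableOn ℂ a (strip ξ) := (hd.differentiableOn 0).deriv hopen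
  have hbd : DifferentiableOn ℂ b (strip ξ) := hd.differentiableOn 1
  have hda : ∀ θ : ℝ, deriv a θ = complexify (deriv (deriv (w 0)) θ) := fun θ =>
    deriv_of_complexification
      ((contDiff_infty_iff_deriv.1 (hg.smooth_coeff 0)).2.differentiable (by simp) θ)
      (hdiffAt had _ (hreal θ)) (hder 0)
  -- the complexified vector field
  set X' : CPlane → CPlane := fun x => F (0, x, k.weight (0 : ℂ) • x) with hX'
  have hX'a : ∀ z ∈ strip ξ, AnalyticAt ℂ X' (w' 0 z) := fun z hz =>
    AnalyticAt.comp (g := F) (hd.analyticAt_field z hz)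
      (analyticAt_const.prod (analyticAt_id.prod ((k.weight (0 : ℂ) • ContinuousLinearMap.id ℂ CPlane).analyticAt _)))
  have hX'r : ∀ θ : ℝ, ∀ᶠ x in 𝓝 (w 0 θ), X' (complexifyCLM x) =
      complexifyCLM (f (0, x, k.base x)) := by
    intro θ
    have ht : Tendsto (fun x => ((0 : ℝ), x, k.base x)) (𝓝 (w 0 θ))
        (𝓝 (0, w 0 θ, k.base (w 0 θ))) :=
      tendsto_const_nhds.prodMk_nhds (tendsto_id.prodMk_nhds
        k.contDiff_base.continuous.continuousAt)
    filter_upwards [ht.eventually (hd.field_real θ)] with x hx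
    have hbase : complexify (k.base x) = k.weight (0 : ℂ) • complexify x := by
      ext i
      cases k <;> simp [DelayKind.base, DelayKind.weight]
    simpa [hX', hbase] using hx
  set A : ℂ → CPlane →L[ℂ] CPlane := fun z => fderiv ℂ X' (w' 0 z) with hA
  have hAd : DifferentiableOn ℂ A (strip ξ) := fun z hz =>
    (DifferentiableAt.comp z (hX'a z hz).fderiv.differentiableAt
      (hdiffAt (hd.differentiableOn 0) z hz)).differentiableWithinAt
  have hAr : ∀ (θ : ℝ) (x : Plane), A θ (complexify x) =
      complexify (fderiv ℝ (fun x => f (0, x, k.base x)) (w 0 θ) x) := by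
    intro θ x
    have h1 := hX'a θ (hreal θ)
    rw [hd.extends_real] at h1
    have := fderiv_of_complexification complexifyCLM complexifyCLM
      ((hg.field θ).differentiableAt (by simp)) h1.differentiableAt (hX'r θ) x
    simpa [hA, hd.extends_real] using this
  -- Both variational equations hold on the real line and extend to the strip by the identity
  -- theorem.
  have eq1 : Set.EqOn (fun z => (om₀ : ℂ) • deriv a z) (fun z => A z (a z)) (strip ξ) := by
    refine eqOn_strip_of_eq_real hξ ((had.deriv hopen).fun_const_smul _) (hAd.clm_apply had) fun θ => ?_
    have ha' : a θ = complexify (deriv (w 0) θ) := hder 0 θ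
    simp only [hda, ha', hAr, ← (hg.variational θ).1]
    ext i
    simp
  have eq2 : Set.EqOn (fun z => (om₀ : ℂ) • deriv b z + (lam₀ : ℂ) • b z) (fun z => A z (b z))
      (strip ξ) := by
    refine eqOn_strip_of_eq_real hξ (((hbd.deriv hopen).fun_const_smul _).fun_add (hbd.fun_const_smul _))
      (hAd.clm_apply hbd) fun θ => ?_
    simp only [hb, hder, hd.extends_real, hAr, ← (hg.variational θ).2]
    ext i
    simp
  -- Liouville's formula: the determinant satisfies `D' = c D`, with `ω₀ c` the trace of the
  -- linearized field minus `λ₀`; the term `-λ₀` comes from the equation of the second vector `b`.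
  set c : ℂ → ℂ := fun z => (A z (EuclideanSpace.single 0 1) 0
    + A z (EuclideanSpace.single 1 1) 1 - lam₀) / om₀ with hc
  have hcoord : ∀ {h : ℂ → CPlane}, DifferentiableOn ℂ h (strip ξ) → ∀ i,
      DifferentiableOn ℂ (fun z => h z i) (strip ξ) := fun hh i => differentiableOn_euclidean.1 hh i
  have hcc : ContinuousOn c (strip ξ) := by
    have h1 : ∀ e : CPlane, DifferentiableOn ℂ (fun z => A z e) (strip ξ) := fun e =>
      hAd.clm_apply (differentiableOn_const e)
    exact ((((hcoord (h1 _) 0).add (hcoord (h1 _) 1)).sub_const _).div_const _).continuousOn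
  set D : ℂ → ℂ := fun z => a z 0 * b z 1 - a z 1 * b z 0 with hDdef
  have hom' : (om₀ : ℂ) ≠ 0 := by exact_mod_cast hom
  have hDd : ∀ z ∈ strip ξ, HasDerivAt D (c z * D z) z := by
    intro z hz
    have hproj : ∀ {h : ℂ → CPlane}, DifferentiableOn ℂ h (strip ξ) → ∀ i,
        HasDerivAt (fun z => h z i) (deriv h z i) z := fun {h} hh i =>
      (EuclideanSpace.proj i : EuclideanSpace ℂ (Fin 2) →L[ℂ] ℂ).hasFDerivAt.comp_hasDerivAt z
        (hdiffAt hh z hz).hasDerivAt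
    have h1 := ((hproj had 0).fun_mul (hproj hbd 1)).fun_sub ((hproj had 1).fun_mul (hproj hbd 0))
    refine h1.congr_deriv ?_
    have e1 : ∀ i, om₀ * deriv a z i = A z (a z) i := fun i => by
      have := congrArg (fun x : CPlane => x i) (eq1 hz)
      simpa using this
    have e2 : ∀ i, om₀ * deriv b z i + lam₀ * b z i = A z (b z) i := fun i => by
      have := congrArg (fun x : CPlane => x i) (eq2 hz)
      simpa using this
    have h2 := det_apply_add_det_apply (A z) (a z) (b z)
    rw [← e1, ← e1, ← e2, ← e2] at h2
    simp only [hc, hDdef]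
    rw [div_mul_eq_mul_div, eq_div_iff hom']
    linear_combination h2
  have hDr : ∀ θ : ℝ, D θ = (frameDet w θ : ℂ) := by
    intro θ
    simp [hDdef, ha, hb, hder, hd.extends_real, frameDet]
  refine ⟨fun z => (D z)⁻¹, fun z hz => ?_, fun θ => by simp [hDr]⟩
  refine ((hDd z hz).differentiableAt.inv ?_).differentiableWithinAt
  refine ne_zero_of_deriv_eq_mul (convex_strip ξ) hDd hcc (hreal 0) hz ?_
  rw [hDr]
  exact_mod_cast hdet 0

end FrameStrip

theorem IsLimitCycleParam.frameDet_ne_zero {k : DelayKind} {f : ℝ × Plane × Plane → Plane}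
    {δ om₀ lam₀ : ℝ} {W₀ : ℝ → ℝ → Plane} (h : IsLimitCycleParam k f δ om₀ lam₀ W₀) (θ : ℝ) :
    frameDet (sCoeff W₀) θ ≠ 0 := by
  have h1 := h.immersion θ 0 (by simpa using h.delta_pos)
  have h2 : (fun t => W₀ t 0) = sCoeff W₀ 0 := by
    ext1 t
    rw [sCoeff_zero]
  have h3 : deriv (fun u => W₀ θ u) 0 = sCoeff W₀ 1 θ := by
    simp [sCoeff, iteratedDeriv_one]
  rw [h2, h3] at h1
  intro h0
  rw [LinearIndependent.pair_iff] at h1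
  unfold frameDet at h0
  -- With zero determinant, the cofactors of either row give a linear relation between the two
  -- vectors. Independence makes all the cofactors vanish, so the first vector is zero, which is
  -- again a relation.
  have h4 := h1 (sCoeff W₀ 1 θ 1) (-deriv (sCoeff W₀ 0) θ 1) (by
    ext i
    fin_cases i
    · simp
      linear_combination h0
    · simp
      ring)
  have h5 := h1 (sCoeff W₀ 1 θ 0) (-deriv (sCoeff W₀ 0) θ 0) (by
    ext i
    fin_cases i
    · simp
      ring
    · simp
      linear_combination -h0)
  have h6 := h1 1 0 (by
    ext i
    fin_cases i
    · simpa using h5.2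
    · simpa using h4.2)
  exact one_ne_zero h6.1

/-! ### Complex extension of real-analytic functions of several variables. -/

section LocalExtension

variable {m : ℕ} {E F : Type*} [NormedAddCommGroup E] [NormedSpace ℝ E] [NormedAddCommGroup F]
  [NormedSpace ℂ F] [NormedSpace ℝ F]

/-- The complexification of a formal multilinear series on `ℝᵐ`. -/
noncomputable def complexifySeries (j : E →L[ℝ] F)
    (p : FormalMultilinearSeries ℝ (Fin m → ℝ) E) : FormalMultilinearSeries ℂ (Fin m → ℂ) F :=
  fun n => ∑ a : Fin n → Fin m,
    ((ContinuousMultilinearMap.mkPiAlgebra ℂ (Fin n) ℂ).compContinuousLinearMap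
      (fun i => (ContinuousLinearMap.proj (a i) : (Fin m → ℂ) →L[ℂ] ℂ))).smulRight
      (j (p n fun i => Pi.single (a i) 1))

/-- On a real vector the coordinate monomials are real, and the sum is the expansion of `p n` in the
standard basis. -/
theorem complexifySeries_ofReal [IsScalarTower ℝ ℂ F] (j : E →L[ℝ] F) (p : FormalMultilinearSeries ℝ (Fin m → ℝ) E)
    (n : ℕ) (y : Fin m → ℝ) :
    complexifySeries j p n (fun _ i => (y i : ℂ)) = j (p n fun _ => y) := by
  have hy : y = ∑ l : Fin m, y l • (Pi.single l (1 : ℝ) : Fin m → ℝ) := by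
    ext i
    simp [Finset.sum_apply, Pi.single_apply]
  have h1 : p n (fun _ => y) = ∑ a : Fin n → Fin m, (∏ i, y (a i)) •
      p n fun i => Pi.single (a i) 1 := by
    conv_lhs => rw [hy]
    rw [ContinuousMultilinearMap.map_sum]
    exact Finset.sum_congr rfl fun a _ => (p n).map_smul_univ _ _
  rw [h1, map_sum, complexifySeries]
  simp only [sum_apply]
  refine Finset.sum_congr rfl fun a _ => ?_
  rw [map_smul]
  simp only [ContinuousMultilinearMap.smulRight_apply,
    ContinuousMultilinearMap.compContinuousLinearMap_apply,
    ContinuousMultilinearMap.mkPiAlgebra_apply, ContinuousLinearMap.proj_apply]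
  rw [← Complex.ofReal_prod]
  exact algebraMap_smul ℂ (∏ i, y (a i)) _

/-- Each of the `m ^ n` terms of the expansion is bounded by `‖j‖ * ‖p n‖`. The geometric factor
only shrinks the radius of convergence. -/
theorem norm_complexifySeries_le (j : E →L[ℝ] F) (p : FormalMultilinearSeries ℝ (Fin m → ℝ) E)
    (n : ℕ) : ‖complexifySeries j p n‖ ≤ (m : ℝ) ^ n * (‖j‖ * ‖p n‖) := by
  have h : ∀ a : Fin n → Fin m,
      ‖((ContinuousMultilinearMap.mkPiAlgebra ℂ (Fin n) ℂ).compContinuousLinearMap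
        (fun i => (ContinuousLinearMap.proj (a i) : (Fin m → ℂ) →L[ℂ] ℂ))).smulRight
        (j (p n fun i => Pi.single (a i) 1))‖ ≤ ‖j‖ * ‖p n‖ := by
    intro a
    refine ContinuousMultilinearMap.opNorm_le_bound (by positivity) fun v => ?_
    simp only [ContinuousMultilinearMap.smulRight_apply,
      ContinuousMultilinearMap.compContinuousLinearMap_apply,
      ContinuousMultilinearMap.mkPiAlgebra_apply, ContinuousLinearMap.proj_apply]
    rw [norm_smul, mul_comm, norm_prod]
    have h1 : ‖p n fun i => Pi.single (a i) (1 : ℝ)‖ ≤ ‖p n‖ := by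
      refine ((p n).le_opNorm _).trans ?_
      refine mul_le_of_le_one_right (norm_nonneg _) (Finset.prod_le_one (fun _ _ => norm_nonneg _)
        fun i _ => ?_)
      rw [pi_norm_le_iff_of_nonneg zero_le_one]
      intro l
      rw [Pi.single_apply]
      split_ifs <;> simp
    have h2 : ∏ i, ‖v i (a i)‖ ≤ ∏ i, ‖v i‖ :=
      Finset.prod_le_prod (fun _ _ => norm_nonneg _) fun i _ => norm_le_pi_norm (v i) (a i)
    refine mul_le_mul ((j.le_opNorm _).trans ?_) h2 (Finset.prod_nonneg fun _ _ => norm_nonneg _)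
      (by positivity)
    exact mul_le_mul_of_nonneg_left h1 (norm_nonneg _)
  refine (norm_sum_le _ _).trans ((Finset.sum_le_sum fun a _ => h a).trans ?_)
  simp

/-- Local analytic extension to complex variables. -/
theorem AnalyticAt.exists_local_complex_extension [IsScalarTower ℝ ℂ F] [CompleteSpace F]
    (j : E →L[ℝ] F)
    {g : (Fin m → ℝ) → E} {x : Fin m → ℝ} (hg : AnalyticAt ℝ g x) :
    ∃ ρ : ℝ, 0 < ρ ∧ ∃ H : (Fin m → ℂ) → F,
      AnalyticOnNhd ℂ H (Metric.ball (fun i => (x i : ℂ)) ρ) ∧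
      ∀ y ∈ Metric.ball x ρ, H (fun i => (y i : ℂ)) = j (g y) := by
  obtain ⟨p, R, hp⟩ := hg
  obtain ⟨s, hs0, hsR⟩ := ENNReal.lt_iff_exists_nnreal_btwn.1 hp.r_pos
  obtain ⟨C, hC, hbound⟩ := p.norm_mul_pow_le_of_lt_radius (hsR.trans_le hp.r_le)
  have hs : 0 < s := by exact_mod_cast hs0
  -- Dividing by `m + 1` compensates the factor `m ^ n`; `m` itself could be zero.
  set t : NNReal := s / (m + 1) with ht
  have htpos : 0 < t := by positivity
  have hts : t ≤ s := div_le_self hs.le (by simp)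
  set q := complexifySeries j p with hq
  have hrad : (t : ENNReal) ≤ q.radius := by
    refine q.le_radius_of_bound (‖j‖ * C) fun n => ?_
    have h1 : (t : ℝ) ^ n * (m : ℝ) ^ n ≤ (s : ℝ) ^ n := by
      rw [← mul_pow]
      refine pow_le_pow_left₀ (by positivity) ?_ n
      rw [ht]
      push_cast
      rw [div_mul_eq_mul_div, div_le_iff₀ (by positivity)]
      have : (0 : ℝ) ≤ s := s.2
      nlinarith
    calc ‖q n‖ * (t : ℝ) ^ n ≤ ((m : ℝ) ^ n * (‖j‖ * ‖p n‖)) * (t : ℝ) ^ n :=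
          mul_le_mul_of_nonneg_right (norm_complexifySeries_le j p n) (by positivity)
      _ = ‖j‖ * ‖p n‖ * ((t : ℝ) ^ n * (m : ℝ) ^ n) := by ring
      _ ≤ ‖j‖ * ‖p n‖ * (s : ℝ) ^ n := mul_le_mul_of_nonneg_left h1 (by positivity)
      _ = ‖j‖ * (‖p n‖ * (s : ℝ) ^ n) := by ring
      _ ≤ ‖j‖ * C := mul_le_mul_of_nonneg_left (hbound n) (norm_nonneg _)
  have htE : (0 : ENNReal) < t := by exact_mod_cast htpos
  have hqb := q.hasFPowerSeriesOnBall (htE.trans_le hrad)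
  refine ⟨t, htpos, fun y => q.sum (y - fun i => (x i : ℂ)), ?_, ?_⟩
  · intro y hy
    have h1 : y - (fun i => (x i : ℂ)) ∈ Metric.eball (0 : Fin m → ℂ) q.radius := by
      rw [Metric.mem_eball, edist_zero_right, ← ofReal_norm]
      refine lt_of_lt_of_le ?_ hrad
      rw [← ENNReal.ofReal_coe_nnreal, ENNReal.ofReal_lt_ofReal_iff (by exact_mod_cast htpos),
        ← dist_eq_norm]
      exact hy
    exact AnalyticAt.comp (g := q.sum) (hqb.analyticAt_of_mem h1) (analyticAt_id.sub analyticAt_const)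
  · intro y hy
    have hyt : ‖y - x‖ < t := by rwa [← dist_eq_norm]
    have h1 : y - x ∈ Metric.eball (0 : Fin m → ℝ) R := by
      rw [Metric.mem_eball, edist_zero_right, ← ofReal_norm]
      refine lt_of_le_of_lt ?_ hsR
      rw [← ENNReal.ofReal_coe_nnreal]
      exact ENNReal.ofReal_le_ofReal (hyt.le.trans (by exact_mod_cast hts))
    have h2 : (fun i => ((y - x) i : ℂ)) ∈ Metric.eball (0 : Fin m → ℂ) q.radius := by
      rw [Metric.mem_eball, edist_zero_right, ← ofReal_norm]
      refine lt_of_lt_of_le ?_ hrad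
      rw [← ENNReal.ofReal_coe_nnreal, ENNReal.ofReal_lt_ofReal_iff (by exact_mod_cast htpos)]
      refine (pi_norm_lt_iff (by exact_mod_cast htpos)).2 fun i => ?_
      rw [Complex.norm_real]
      exact (norm_le_pi_norm (y - x) i).trans_lt hyt
    have h3 := (hp.hasSum h1).mapL j
    have h4 := q.hasSum h2
    simp only [hq, complexifySeries_ofReal] at h4
    have h5 := h4.unique h3
    rw [add_sub_cancel] at h5
    refine Eq.trans (congrArg q.sum ?_) h5
    ext i
    simp

theorem convex_preimage_line {V : Type*} [NormedAddCommGroup V] [NormedSpace ℝ V] [NormedSpace ℂ V]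
    [IsScalarTower ℝ ℂ V] {S : Set V} (hS : Convex ℝ S) (c d : V) :
    Convex ℝ {z : ℂ | c + z • d ∈ S} := by
  have h1 : IsLinearMap ℝ fun z : ℂ => z • d :=
    ⟨fun x y => add_smul x y d, fun a x => smul_assoc a x d⟩
  exact (hS.translate_preimage_right c).is_linear_preimage h1

/-- Two local extensions agree on the intersection of their balls. -/
theorem local_complex_extension_unique [CompleteSpace F] {j : E →L[ℝ] F} {g : (Fin m → ℝ) → E}
    {x₀ x₁ : Fin m → ℝ} {ρ₀ ρ₁ : ℝ} {H₀ H₁ : (Fin m → ℂ) → F}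
    (h₀ : AnalyticOnNhd ℂ H₀ (Metric.ball (fun i => (x₀ i : ℂ)) ρ₀))
    (h₁ : AnalyticOnNhd ℂ H₁ (Metric.ball (fun i => (x₁ i : ℂ)) ρ₁))
    (e₀ : ∀ y ∈ Metric.ball x₀ ρ₀, H₀ (fun i => (y i : ℂ)) = j (g y))
    (e₁ : ∀ y ∈ Metric.ball x₁ ρ₁, H₁ (fun i => (y i : ℂ)) = j (g y)) {y : Fin m → ℂ}
    (hy₀ : y ∈ Metric.ball (fun i => (x₀ i : ℂ)) ρ₀)
    (hy₁ : y ∈ Metric.ball (fun i => (x₁ i : ℂ)) ρ₁) : H₀ y = H₁ y := by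
  -- The point `y = c + I • d` lies on the complex line `c + z • d` with `c`, `d` real. Real `z`
  -- give real points, where both extensions are prescribed, and the part `U` of the line in both
  -- balls is convex and contains `0` and `I`. The one-variable identity theorem therefore suffices.
  set c : Fin m → ℂ := fun i => ((y i).re : ℂ) with hc
  set d : Fin m → ℂ := fun i => ((y i).im : ℂ) with hd
  set B := Metric.ball (fun i => (x₀ i : ℂ)) ρ₀ ∩ Metric.ball (fun i => (x₁ i : ℂ)) ρ₁ with hB
  set U : Set ℂ := {z | c + z • d ∈ B} with hU
  have hcont : Continuous fun z : ℂ => c + z • d := by fun_prop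
  have hUo : IsOpen U := (Metric.isOpen_ball.inter Metric.isOpen_ball).preimage hcont
  have hUc : Convex ℝ U :=
    convex_preimage_line ((convex_ball _ _).inter (convex_ball _ _)) c d
  have hre : ∀ {x : Fin m → ℝ} {ρ : ℝ}, y ∈ Metric.ball (fun i => (x i : ℂ)) ρ →
      c ∈ Metric.ball (fun i => (x i : ℂ)) ρ := by
    intro x ρ hy
    have hρ : 0 < ρ := dist_nonneg.trans_lt hy
    rw [Metric.mem_ball, dist_pi_lt_iff hρ] at hy ⊢
    intro i
    refine lt_of_le_of_lt ?_ (hy i)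
    rw [dist_eq_norm, dist_eq_norm, hc, ← Complex.ofReal_sub, Complex.norm_real]
    have := Complex.abs_re_le_norm (y i - x i)
    simpa using this
  have h0U : ((0 : ℝ) : ℂ) ∈ U := by
    simp only [hU, Set.mem_ofPred_eq, Complex.ofReal_zero, zero_smul, add_zero]
    exact ⟨hre hy₀, hre hy₁⟩
  have hyI : c + Complex.I • d = y := by
    ext i
    simp only [hc, hd, Pi.add_apply, Pi.smul_apply, smul_eq_mul]
    rw [mul_comm]
    exact Complex.re_add_im (y i)
  have hIU : Complex.I ∈ U := by
    simp only [hU, Set.mem_ofPred_eq, hyI]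
    exact ⟨hy₀, hy₁⟩
  have hanal : ∀ {H : (Fin m → ℂ) → F}, AnalyticOnNhd ℂ H B →
      DifferentiableOn ℂ (fun z => H (c + z • d)) U := fun hH z hz =>
    (DifferentiableAt.comp z (hH _ hz).differentiableAt (by fun_prop)).differentiableWithinAt
  have hreal : ∀ {x : Fin m → ℝ} {ρ : ℝ} {v : Fin m → ℝ},
      (fun i => (v i : ℂ)) ∈ Metric.ball (fun i => (x i : ℂ)) ρ → v ∈ Metric.ball x ρ := by
    intro x ρ v hv
    have hρ : 0 < ρ := dist_nonneg.trans_lt hv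
    rw [Metric.mem_ball, dist_pi_lt_iff hρ] at hv ⊢
    intro i
    have := hv i
    rwa [dist_eq_norm, ← Complex.ofReal_sub, Complex.norm_real, ← dist_eq_norm] at this
  have heq := eqOn_of_eq_real hUo hUc h0U (hanal fun z hz => h₀ z hz.1)
    (hanal fun z hz => h₁ z hz.2) (by
      filter_upwards [Complex.continuous_ofReal.continuousAt.eventually (hUo.mem_nhds h0U)]
        with t ht
      have hv : c + (t : ℂ) • d = fun i => (((y i).re + t * (y i).im : ℝ) : ℂ) := by
        ext i
        simp [hc, hd]
      have ht' : c + (t : ℂ) • d ∈ B := ht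
      rw [hv] at ht' ⊢
      rw [e₀ _ (hreal ht'.1), e₁ _ (hreal ht'.2)])
  have := heq hIU
  simpa only [hyI] using this

/-- A function which is real-analytic at the points of a set extends analytically to complex
variables near these points. -/
theorem exists_complex_extension [IsScalarTower ℝ ℂ F] [CompleteSpace F] (j : E →L[ℝ] F)
    {g : (Fin m → ℝ) → E}
    {S : Set (Fin m → ℝ)} (hg : ∀ x ∈ S, AnalyticAt ℝ g x) :
    ∃ G : (Fin m → ℂ) → F, ∀ x ∈ S, AnalyticAt ℂ G (fun i => (x i : ℂ)) ∧
      ∀ᶠ y in 𝓝 x, G (fun i => (y i : ℂ)) = j (g y) := by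
  classical
  choose! ρ hρ H hH hHg using fun x (hx : x ∈ S) => (hg x hx).exists_local_complex_extension j
  -- Gluing: the ball is selected by choice, and uniqueness on intersections makes the selection
  -- immaterial.
  let G : (Fin m → ℂ) → F := fun y =>
    if h : ∃ x ∈ S, y ∈ Metric.ball (fun i => (x i : ℂ)) (ρ x) then H h.choose y else 0
  have hG : ∀ x ∈ S, ∀ y ∈ Metric.ball (fun i => (x i : ℂ)) (ρ x), G y = H x y := by
    intro x hx y hy
    have h : ∃ x ∈ S, y ∈ Metric.ball (fun i => (x i : ℂ)) (ρ x) := ⟨x, hx, hy⟩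
    simp only [G, dif_pos h]
    exact local_complex_extension_unique (hH _ h.choose_spec.1) (hH x hx)
      (hHg _ h.choose_spec.1) (hHg x hx) h.choose_spec.2 hy
  refine ⟨G, fun x hx => ⟨?_, ?_⟩⟩
  · refine (hH x hx _ (Metric.mem_ball_self (hρ x hx))).congr ?_
    filter_upwards [Metric.ball_mem_nhds (fun i => (x i : ℂ)) (hρ x hx)] with y hy
    exact (hG x hx y hy).symm
  · have hc : Continuous fun y : Fin m → ℝ => fun i => (y i : ℂ) := by fun_prop
    filter_upwards [Metric.ball_mem_nhds x (hρ x hx),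
      hc.continuousAt.eventually (Metric.ball_mem_nhds (fun i => (x i : ℂ)) (hρ x hx))] with y hy hy'
    rw [hG x hx _ hy', hHg x hx y hy]

/-- The same in a space with coordinates. -/
theorem exists_complex_extension_of_coordinates [IsScalarTower ℝ ℂ F] [CompleteSpace F] {X Y : Type*}
    [NormedAddCommGroup X] [NormedSpace ℝ X] [NormedAddCommGroup Y] [NormedSpace ℂ Y]
    (j : E →L[ℝ] F) (A : X →L[ℝ] (Fin m → ℝ)) (B : (Fin m → ℝ) →L[ℝ] X) (hBA : ∀ x, B (A x) = x)
    (A' : Y →L[ℂ] (Fin m → ℂ)) (i : X → Y) (hA' : ∀ x, A' (i x) = fun l => (A x l : ℂ))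
    {g : X → E} {S : Set X} (hg : ∀ x ∈ S, AnalyticAt ℝ g x) :
    ∃ G : Y → F, ∀ x ∈ S, AnalyticAt ℂ G (i x) ∧ ∀ᶠ y in 𝓝 x, G (i y) = j (g y) := by
  obtain ⟨G, hG⟩ := exists_complex_extension j (g := g ∘ B) (S := A '' S) (by
    rintro _ ⟨x, hx, rfl⟩
    refine AnalyticAt.comp ?_ (B.analyticAt _)
    rw [hBA]
    exact hg x hx)
  refine ⟨G ∘ A', fun x hx => ⟨?_, ?_⟩⟩
  · refine AnalyticAt.comp ?_ (A'.analyticAt _)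
    rw [hA']
    exact (hG _ ⟨x, hx, rfl⟩).1
  · filter_upwards [A.continuous.continuousAt.eventually (hG _ ⟨x, hx, rfl⟩).2] with y hy
    simp only [Function.comp_apply, hA', hy, hBA]

end LocalExtension

/-! ### Extension of the field, the delay and the parameterization. -/

section DataExtension

theorem exists_complex_extension_field {f : ℝ × Plane × Plane → Plane}
    {S : Set (ℝ × Plane × Plane)} (hf : ∀ v ∈ S, AnalyticAt ℝ f v) :
    ∃ F : ℂ × CPlane × CPlane → CPlane, ∀ v ∈ S,
      AnalyticAt ℂ F ((v.1 : ℂ), complexify v.2.1, complexify v.2.2) ∧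
      ∀ᶠ u : ℝ × Plane × Plane in 𝓝 v,
        F ((u.1 : ℂ), complexify u.2.1, complexify u.2.2) = complexify (f u) := by
  let A : ℝ × Plane × Plane →L[ℝ] (Fin 5 → ℝ) := LinearMap.toContinuousLinearMap
    { toFun := fun v => ![v.1, v.2.1 0, v.2.1 1, v.2.2 0, v.2.2 1]
      map_add' := fun x y => by ext i; fin_cases i <;> simp
      map_smul' := fun c x => by ext i; fin_cases i <;> simp }
  let B : (Fin 5 → ℝ) →L[ℝ] ℝ × Plane × Plane := LinearMap.toContinuousLinearMap
    { toFun := fun u => (u 0, !₂[u 1, u 2], !₂[u 3, u 4])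
      map_add' := fun x y => by
        ext i
        · simp
        · fin_cases i <;> simp
        · fin_cases i <;> simp
      map_smul' := fun c x => by
        ext i
        · simp
        · fin_cases i <;> simp
        · fin_cases i <;> simp }
  let A' : ℂ × CPlane × CPlane →L[ℂ] (Fin 5 → ℂ) := LinearMap.toContinuousLinearMap
    { toFun := fun v => ![v.1, v.2.1 0, v.2.1 1, v.2.2 0, v.2.2 1]
      map_add' := fun x y => by ext i; fin_cases i <;> simp
      map_smul' := fun c x => by ext i; fin_cases i <;> simp }
  have hBA : ∀ x, B (A x) = x := by
    intro x
    ext i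
    · simp [A, B]
    · fin_cases i <;> simp [A, B]
    · fin_cases i <;> simp [A, B]
  have hA' : ∀ x : ℝ × Plane × Plane, A' ((x.1 : ℂ), complexify x.2.1, complexify x.2.2) =
      fun l => (A x l : ℂ) := by
    intro x
    ext l
    fin_cases l <;> simp [A, A']
  exact exists_complex_extension_of_coordinates complexifyCLM A B hBA A'
    (fun x : ℝ × Plane × Plane => ((x.1 : ℂ), complexify x.2.1, complexify x.2.2)) hA' hf

theorem exists_complex_extension_delay {r : Plane → ℝ} {S : Set Plane}
    (hr : ∀ x ∈ S, AnalyticAt ℝ r x) :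
    ∃ R : CPlane → ℂ, ∀ x ∈ S, AnalyticAt ℂ R (complexify x) ∧
      ∀ᶠ y in 𝓝 x, R (complexify y) = (r y : ℂ) :=
  exists_complex_extension_of_coordinates Complex.ofRealCLM
    (EuclideanSpace.equiv (Fin 2) ℝ).toContinuousLinearMap
    (EuclideanSpace.equiv (Fin 2) ℝ).symm.toContinuousLinearMap (fun x => by simp)
    (EuclideanSpace.equiv (Fin 2) ℂ).toContinuousLinearMap complexify (fun x => rfl) hr

theorem exists_complex_extension_three {g : ℝ × ℝ × ℝ → Plane} {S : Set (ℝ × ℝ × ℝ)}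
    (hg : ∀ v ∈ S, AnalyticAt ℝ g v) :
    ∃ G : ℂ × ℂ × ℂ → CPlane, ∀ v ∈ S, AnalyticAt ℂ G (inclusion₃ v) ∧
      ∀ᶠ u in 𝓝 v, G (inclusion₃ u) = complexify (g u) := by
  let A : ℝ × ℝ × ℝ →L[ℝ] (Fin 3 → ℝ) := LinearMap.toContinuousLinearMap
    { toFun := fun v => ![v.1, v.2.1, v.2.2]
      map_add' := fun x y => by ext i; fin_cases i <;> simp
      map_smul' := fun c x => by ext i; fin_cases i <;> simp }
  let B : (Fin 3 → ℝ) →L[ℝ] ℝ × ℝ × ℝ := LinearMap.toContinuousLinearMap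
    { toFun := fun u => (u 0, u 1, u 2)
      map_add' := fun x y => by ext <;> simp
      map_smul' := fun c x => by ext <;> simp }
  let A' : ℂ × ℂ × ℂ →L[ℂ] (Fin 3 → ℂ) := LinearMap.toContinuousLinearMap
    { toFun := fun v => ![v.1, v.2.1, v.2.2]
      map_add' := fun x y => by ext i; fin_cases i <;> simp
      map_smul' := fun c x => by ext i; fin_cases i <;> simp }
  refine exists_complex_extension_of_coordinates complexifyCLM A B (fun x => ?_) A' inclusion₃
    (fun x => ?_) hg
  · ext <;> simp [A, B]
  · ext l
    fin_cases l <;> simp [A, A']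

end DataExtension

/-! ### Uniform strips and periodic extensions. -/

section UniformStrip

/-- A property which holds near the points of a compact real interval holds in a strip. -/
theorem exists_uniform_strip {P : ℂ → Prop} {a b : ℝ}
    (h : ∀ θ ∈ Set.Icc a b, ∀ᶠ z in 𝓝 (θ : ℂ), P z) :
    ∃ ξ : ℝ, 0 < ξ ∧ ∀ z ∈ strip ξ, z.re ∈ Set.Icc a b → P z := by
  have h1 : ∀ᶠ y : ℝ in 𝓝 0, ∀ x ∈ Set.Icc a b, P ((x : ℂ) + y * Complex.I) := by
    refine isCompact_Icc.eventually_forall_of_forall_eventually fun x hx => ?_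
    have hc : Continuous fun y : ℝ × ℝ => (y.2 : ℂ) + y.1 * Complex.I := by fun_prop
    exact (hc.tendsto' (0, x) (x : ℂ) (by simp)).eventually (h x hx)
  obtain ⟨ξ, hξ, hball⟩ := Metric.eventually_nhds_iff.1 h1
  refine ⟨ξ, hξ, fun z hz hre => ?_⟩
  have := hball (y := z.im) (by simpa [strip] using hz) z.re hre
  rwa [Complex.re_add_im] at this

theorem strip_mono {ξ ξ' : ℝ} (h : ξ ≤ ξ') : strip ξ ⊆ strip ξ' := fun _ hz => lt_of_lt_of_le hz h

theorem sub_intCast_mem_strip {ξ : ℝ} {z : ℂ} (hz : z ∈ strip ξ) (n : ℤ) : z - n ∈ strip ξ := by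
  simpa [strip] using hz

theorem re_sub_floor_mem (z : ℂ) : (z - (⌊z.re⌋ : ℤ)).re ∈ Set.Icc (0 : ℝ) 1 := by
  simp only [Complex.sub_re, Complex.intCast_re]
  exact ⟨Int.fract_nonneg z.re, (Int.fract_lt_one z.re).le⟩

/-- Extensions of periodic functions near the real points yield periodic extensions in a strip. -/
theorem exists_periodic_strip_extension {w : ℕ → ℝ → Plane}
    (hper : ∀ p, Function.Periodic (w p) 1) {H : ℕ → ℂ → CPlane}
    (hH : ∀ θ : ℝ, ∀ᶠ z in 𝓝 (θ : ℂ), ∀ p, DifferentiableAt ℂ (H p) z)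
    (hHr : ∀ p (θ : ℝ), H p θ = complexify (w p θ)) :
    ∃ ξ : ℝ, 0 < ξ ∧ ∃ w' : ℕ → ℂ → CPlane, (∀ p, Function.Periodic (w' p) 1) ∧
      (∀ p, DifferentiableOn ℂ (w' p) (strip ξ)) ∧
      ∀ p (θ : ℝ), w' p θ = complexify (w p θ) := by
  -- The interval exceeds the period `[0, 1]` by one on each side, so that both `H p z` and `H p (z
  -- + 1)` are controlled for `-1 < Re z < 1`.
  obtain ⟨ξ, hξ, hξH⟩ := exists_uniform_strip (a := -1) (b := 2) fun θ _ => hH θ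
  refine ⟨ξ, hξ, fun p z => H p (z - (⌊z.re⌋ : ℤ)), fun p z => ?_, fun p z hz => ?_,
    fun p θ => ?_⟩
  · simp
  · have hU : IsOpen (strip ξ ∩ Complex.re ⁻¹' Set.Ioo (-1) 1) :=
      (isOpen_strip ξ).inter (isOpen_Ioo.preimage Complex.continuous_re)
    have hUc : Convex ℝ (strip ξ ∩ Complex.re ⁻¹' Set.Ioo (-1) 1) :=
      (convex_strip ξ).inter ((convex_Ioo (-1 : ℝ) 1).is_linear_preimage
        Complex.reCLM.toLinearMap.isLinear)
    have hshift : Set.EqOn (fun z => H p (z + 1)) (H p)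
        (strip ξ ∩ Complex.re ⁻¹' Set.Ioo (-1) 1) := by
      refine eqOn_of_eq_real hU hUc (x₀ := 0) ⟨ofReal_mem_strip hξ 0, by simp⟩ (fun z hz => ?_)
        (fun z hz => ?_) (Eventually.of_forall fun x => ?_)
      · have h1 : DifferentiableAt ℂ (H p) (z + 1) := by
          refine hξH (z + 1) (by simpa using add_ofReal_mem_strip hz.1 1) ?_ p
          have := hz.2
          simp only [Set.mem_preimage, Set.mem_Ioo] at this
          simp only [Complex.add_re, Complex.one_re]
          exact ⟨by linarith, by linarith⟩
        exact (DifferentiableAt.comp z h1 (by fun_prop)).differentiableWithinAt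
      · refine (hξH z hz.1 ?_ p).differentiableWithinAt
        have := hz.2
        simp only [Set.mem_preimage, Set.mem_Ioo] at this
        exact ⟨by linarith, by linarith⟩
      · have : ((x : ℂ) + 1) = ((x + 1 : ℝ) : ℂ) := by simp
        simp only [this, hHr, hper p x]
    set n : ℤ := ⌊z.re⌋ with hn
    -- The translation by the integer part jumps where the real part is an integer. There the two
    -- branches agree by `hshift`, so near `z` the integer may be frozen at `n`.
    have h1 : (fun z => H p (z - (⌊z.re⌋ : ℤ))) =ᶠ[𝓝 z] fun z => H p (z - n) := by
      have hre : ∀ᶠ y : ℂ in 𝓝 z, y.re ∈ Set.Ioo ((n : ℝ) - 1) (n + 1) := by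
        refine Complex.continuous_re.continuousAt.eventually (isOpen_Ioo.mem_nhds ⟨?_, ?_⟩)
        · have := Int.floor_le z.re
          linarith
        · exact Int.lt_floor_add_one z.re
      filter_upwards [hre, (isOpen_strip ξ).mem_nhds hz] with y hy hys
      rcases lt_or_ge y.re n with hlt | hge
      · have hfl : ⌊y.re⌋ = n - 1 := by
          rw [Int.floor_eq_iff]
          push_cast
          exact ⟨by linarith [hy.1], by linarith⟩
        rw [hfl]
        have : y - ((n - 1 : ℤ) : ℂ) = (y - n) + 1 := by
          push_cast
          ring
        rw [this]
        refine hshift ⟨sub_intCast_mem_strip hys n, ?_⟩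
        simp only [Set.mem_preimage, Complex.sub_re, Complex.intCast_re, Set.mem_Ioo]
        exact ⟨by linarith [hy.1], by linarith⟩
      · have hfl : ⌊y.re⌋ = n := by
          rw [Int.floor_eq_iff]
          exact ⟨hge, hy.2⟩
        rw [hfl]
    have h2 : DifferentiableAt ℂ (H p) (z - n) := by
      have := re_sub_floor_mem z
      exact hξH _ (sub_intCast_mem_strip hz n) ⟨by linarith [this.1], by linarith [this.2]⟩ p
    have h3 : DifferentiableAt ℂ (fun z => H p (z - n)) z :=
      DifferentiableAt.comp z h2 (by fun_prop)
    exact (h3.congr_of_eventuallyEq h1).differentiableWithinAt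
  · have h1 : ((θ : ℂ) - ((⌊(θ : ℂ).re⌋ : ℤ) : ℂ)) = ((θ - ⌊θ⌋ : ℝ) : ℂ) := by
      rw [Complex.ofReal_sub, Complex.ofReal_intCast, Complex.ofReal_re]
    change H p ((θ : ℂ) - ((⌊(θ : ℂ).re⌋ : ℤ) : ℂ)) = complexify (w p θ)
    rw [h1, hHr]
    have h2 := (hper p).sub_int_mul_eq (x := θ) ⌊θ⌋
    rw [mul_one] at h2
    rw [h2]

end UniformStrip

/-! ### Complex data for the problem and control of the delayed points. -/

section Data

variable {k : DelayKind} {f : ℝ × Plane × Plane → Plane} {r : Plane → ℝ} {δ om₀ lam₀ : ℝ}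
  {W₀ : ℝ → ℝ → Plane} {w : ℕ → ℝ → Plane} {w' : ℕ → ℂ → CPlane}
  {F : ℂ × CPlane × CPlane → CPlane} {R : CPlane → ℂ} {ξ : ℝ}

theorem DelayKind.complexify_base (k : DelayKind) (x : Plane) :
    complexify (k.base x) = k.weight (0 : ℂ) • complexify x := by
  ext i
  cases k <;> simp [DelayKind.base, DelayKind.weight]

/-- Real-analytic data extend analytically to complex variables. -/
theorem IsLimitCycleParam.exists_complexData (h : IsLimitCycleParam k f δ om₀ lam₀ W₀)
    (hf : ∀ θ, AnalyticAt ℝ f (0, W₀ θ 0, k.base (W₀ θ 0)))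
    (hr : ∀ θ, AnalyticAt ℝ r (W₀ θ 0))
    (hW : AnalyticOnNhd ℝ (Function.uncurry W₀) (Set.univ ×ˢ Set.Ioo (-δ) δ)) :
    ∃ (ξ : ℝ) (w' : ℕ → ℂ → CPlane) (F : ℂ × CPlane × CPlane → CPlane) (R : CPlane → ℂ),
      ComplexData k f r (sCoeff W₀) ξ w' F R ∧ ∀ p, Function.Periodic (w' p) 1 := by
  obtain ⟨G, hG⟩ := exists_complex_extension_three (g := fun v => W₀ v.2.1 v.2.2)
    (S := Set.range fun θ : ℝ => (0, θ, 0)) (by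
      rintro _ ⟨θ, rfl⟩
      have h1 := hW (θ, 0) ⟨trivial, by simpa using h.delta_pos⟩
      exact AnalyticAt.comp (g := Function.uncurry W₀) h1 analyticAt_snd)
  have hGθ : ∀ θ : ℝ, AnalyticAt ℂ G (0, θ, 0) := fun θ => by simpa using (hG _ ⟨θ, rfl⟩).1
  -- All coefficients are `s`-jets of the single extension `G`, so they are analytic wherever `G`
  -- is, and one strip serves every `p`.
  obtain ⟨ξ₀, hξ₀, w', hper, hdiff, hreal⟩ := exists_periodic_strip_extension h.periodic_sCoeff
    (H := fun p => complexJetCoeff 0 p G)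
    (fun θ => by
      have hc : Continuous fun z : ℂ => ((0 : ℂ), z, (0 : ℂ)) := by fun_prop
      filter_upwards [hc.continuousAt.eventually (hGθ θ).eventually_analyticAt] with z hz p
      exact differentiableAt_complexJetCoeff hz)
    (fun p θ => by
      rw [h.sCoeff_eq]
      exact complexJetCoeff_ofReal (hGθ θ) (h.smoothAtCycle θ) (hG _ ⟨θ, rfl⟩).2)
  obtain ⟨F, hF⟩ := exists_complex_extension_field
    (S := Set.range fun θ => (0, W₀ θ 0, k.base (W₀ θ 0))) (by rintro _ ⟨θ, rfl⟩; exact hf θ)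
  obtain ⟨R, hR⟩ := exists_complex_extension_delay
    (S := Set.range fun θ => W₀ θ 0) (by rintro _ ⟨θ, rfl⟩; exact hr θ)
  have hw0 : ∀ θ : ℝ, w' 0 θ = complexify (W₀ θ 0) := fun θ => by rw [hreal, sCoeff_zero]
  obtain ⟨ξ₁, hξ₁, hP⟩ := exists_uniform_strip (a := 0) (b := 1)
    (P := fun z => AnalyticAt ℂ F (0, w' 0 z, k.weight (0 : ℂ) • w' 0 z) ∧
      AnalyticAt ℂ R (w' 0 z)) (fun θ _ => by
      have hc : ContinuousAt (w' 0) θ := ((hdiff 0).differentiableAt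
        ((isOpen_strip ξ₀).mem_nhds (ofReal_mem_strip hξ₀ θ))).continuousAt
      have h1 : ContinuousAt (fun z => ((0 : ℂ), w' 0 z, k.weight (0 : ℂ) • w' 0 z)) θ :=
        continuousAt_const.prodMk (hc.prodMk (hc.fun_const_smul _))
      have h2 : AnalyticAt ℂ F (0, w' 0 θ, k.weight (0 : ℂ) • w' 0 θ) := by
        rw [hw0, ← k.complexify_base]
        simpa using (hF _ ⟨θ, rfl⟩).1
      have h3 : AnalyticAt ℂ R (w' 0 θ) := by
        rw [hw0]
        exact (hR _ ⟨θ, rfl⟩).1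
      exact (h1.eventually h2.eventually_analyticAt).and (hc.eventually h3.eventually_analyticAt))
  have hP' : ∀ z ∈ strip (min ξ₀ ξ₁),
      AnalyticAt ℂ F (0, w' 0 z, k.weight (0 : ℂ) • w' 0 z) ∧ AnalyticAt ℂ R (w' 0 z) := by
    intro z hz
    have h1 := hP _ (sub_intCast_mem_strip (strip_mono (min_le_right _ _) hz) ⌊z.re⌋)
      (re_sub_floor_mem z)
    have h2 := (hper 0).sub_int_mul_eq (x := z) ⌊z.re⌋
    rw [mul_one] at h2
    rwa [h2] at h1
  refine ⟨min ξ₀ ξ₁, w', F, R, ⟨lt_min hξ₀ hξ₁, fun p => (hdiff p).mono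
    (strip_mono (min_le_left _ _)), hreal, fun z hz => (hP' z hz).1, fun z hz => (hP' z hz).2,
    fun θ => ?_, fun θ => ?_⟩, hper⟩
  · rw [sCoeff_zero]
    exact (hF _ ⟨θ, rfl⟩).2
  · rw [sCoeff_zero]
    exact (hR _ ⟨θ, rfl⟩).2

/-- The delayed points of a narrow strip stay in a given strip. -/
theorem ComplexData.exists_shift (hd : ComplexData k f r w ξ w' F R)
    (hper : Function.Periodic (w' 0) 1) (c : ℝ) {ξ₁ : ℝ} (hξ₁ : 0 < ξ₁) :
    ∃ ξ₂ : ℝ, 0 < ξ₂ ∧ ξ₂ ≤ ξ₁ ∧ ∀ z ∈ strip ξ₂, z - c * R (w' 0 z) ∈ strip ξ₁ := by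
  obtain ⟨ξ₂, hξ₂, hP⟩ := exists_uniform_strip (a := 0) (b := 1)
    (P := fun z => z - c * R (w' 0 z) ∈ strip ξ₁) (fun θ _ => by
      have hθ := ofReal_mem_strip hd.pos θ
      have hc : ContinuousAt (w' 0) θ := ((hd.differentiableOn 0).differentiableAt
        ((isOpen_strip ξ).mem_nhds hθ)).continuousAt
      have h1 : ContinuousAt (fun z => z - c * R (w' 0 z)) (θ : ℂ) :=
        continuousAt_id.sub (continuousAt_const.mul
          (ContinuousAt.comp (g := R) (hd.analyticAt_delay _ hθ).continuousAt hc))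
      refine h1.eventually ((isOpen_strip ξ₁).mem_nhds ?_)
      change (θ : ℂ) - c * R (w' 0 θ) ∈ strip ξ₁
      -- Over the real line the delay is real, so the delayed point is real and lies in every strip;
      -- continuity gives a neighbourhood.
      rw [hd.extends_real, (hd.delay_real θ).self_of_nhds]
      simpa using ofReal_mem_strip hξ₁ (θ - c * r (w 0 θ)))
  refine ⟨min ξ₂ ξ₁, lt_min hξ₂ hξ₁, min_le_right _ _, fun z hz => ?_⟩
  have h1 := hP _ (sub_intCast_mem_strip (strip_mono (min_le_left _ _) hz) ⌊z.re⌋)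
    (re_sub_floor_mem z)
  have h2 := hper.sub_int_mul_eq (x := z) ⌊z.re⌋
  rw [mul_one] at h2
  rw [h2] at h1
  have h3 := sub_intCast_mem_strip h1 (-⌊z.re⌋)
  have h4 : z - ((⌊z.re⌋ : ℤ) : ℂ) - c * R (w' 0 z) - ((-⌊z.re⌋ : ℤ) : ℂ) =
      z - c * R (w' 0 z) := by
    push_cast
    ring
  rwa [h4] at h3

theorem DataAnalyticOnStrip.exists_complexData (h : DataAnalyticOnStrip f r w ξ) (hξ : 0 < ξ) :
    ∃ (w' : ℕ → ℂ → CPlane) (F : ℂ × CPlane × CPlane → CPlane) (R : CPlane → ℂ),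
      ComplexData .shortDelay f r w ξ w' F R := by
  obtain ⟨w', F, R, hw', han, hF, hR⟩ := h
  refine ⟨w', F, R, hξ, fun p => (hw' p).holomorphic, fun p => (hw' p).extends_real, fun z hz => ?_,
    fun z hz => (han z hz).2, hF, hR⟩
  simpa [DelayKind.weight] using (han z hz).1

theorem ComplexData.dataAnalyticOnStrip (hd : ComplexData .shortDelay f r w ξ w' F R)
    (hper : ∀ p, Function.Periodic (w' p) 1) : DataAnalyticOnStrip f r w ξ :=
  ⟨w', F, R, fun p => ⟨hd.differentiableOn p, fun z _ => hper p z, hd.extends_real p⟩,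
    fun z hz => ⟨by simpa [DelayKind.weight] using hd.analyticAt_field z hz,
      hd.analyticAt_delay z hz⟩, hd.field_real, hd.delay_real⟩

end Data

/-! ### Construction of the series. -/

/-- Recursion in which each term depends on all the previous ones. -/
theorem exists_seq_of_step {T : Type*} (t₀ : T) (step : ℕ → (ℕ → T) → T)
    (hloc : ∀ n s s', (∀ m ≤ n, s m = s' m) → step n s = step n s') :
    ∃ S : ℕ → T, S 0 = t₀ ∧ ∀ n, S (n + 1) = step n S := by
  let hist : ℕ → ℕ → T :=
    Nat.rec (fun _ => t₀) fun n s => Function.update s (n + 1) (step n s)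
  have hsucc : ∀ n, hist (n + 1) = Function.update (hist n) (n + 1) (step n (hist n)) :=
    fun _ => rfl
  have hstable : ∀ n m, m ≤ n → hist n m = hist m m := by
    intro n
    induction n with
    | zero =>
      intro m hm
      rw [Nat.le_zero.1 hm]
    | succ n ih =>
      intro m hm
      rcases Nat.lt_or_ge n m with h | h
      · rw [le_antisymm hm h]
      · rw [hsucc, Function.update_of_ne (by omega), ih m h]
  refine ⟨fun n => hist n n, rfl, fun n => ?_⟩
  change hist (n + 1) (n + 1) = step n fun n => hist n n
  rw [hsucc, Function.update_self]
  exact hloc n _ _ (hstable n)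

section Locality

variable {k : DelayKind} {f : ℝ × Plane × Plane → Plane} {r : Plane → ℝ} {om om' lam lam' : ℕ → ℝ}
  {W W' : ℕ → ℕ → ℝ → Plane} {n : ℕ}

/-- The truncation at order `n` involves only the terms up to `n`; this is the locality required by
the recursion. -/
theorem leadingError_congr (hom : ∀ m ≤ n, om m = om' m) (hlam : ∀ m ≤ n, lam m = lam' m)
    (hW : ∀ m ≤ n, W m = W' m) :
    leadingError k f r om lam W n = leadingError k f r om' lam' W' n := by
  have hs : ∀ {a a' : ℕ → ℝ}, (∀ m ≤ n, a m = a' m) → truncScalar a n = truncScalar a' n := by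
    intro a a' h
    ext ε
    exact Finset.sum_congr rfl fun m hm => by
      rw [h m (Nat.lt_succ_iff.1 (Finset.mem_range.1 hm))]
  have hT : ∀ P, truncSeries W n P = truncSeries W' n P := by
    intro P
    ext1 ε; ext1 θ; ext1 s
    exact Finset.sum_congr rfl fun m hm => by
      rw [hW m (Nat.lt_succ_iff.1 (Finset.mem_range.1 hm))]
  ext1 p
  unfold leadingError
  congr 1
  ext1 v
  simp only [errorFun, truncError, hs hom, hs hlam, hT]

end Locality

section Construction

variable {k : DelayKind} {f : ℝ × Plane × Plane → Plane} {r : Plane → ℝ} {δ om₀ lam₀ : ℝ}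
  {W₀ : ℝ → ℝ → Plane}

/-- Existence of the Lindstedt series; the coefficients are analytic in a strip as soon as the
frame of the unperturbed parameterization and the errors are. -/
theorem IsLimitCycleParam.exists_lindstedtSeries (h : IsLimitCycleParam k f δ om₀ lam₀ W₀)
    (hf : ∀ θ, ContDiffAt ℝ ∞ f (0, W₀ θ 0, k.base (W₀ θ 0)))
    (hr : ∀ θ, ContDiffAt ℝ ∞ r (W₀ θ 0)) :
    ∃ (om lam : ℕ → ℝ) (W : ℕ → ℕ → ℝ → Plane),
      IsLindstedtSeries k f r om₀ lam₀ W₀ om lam W ∧ W 0 = sCoeff W₀ ∧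
      ∀ n ξ, 0 < ξ → (∀ p, PlaneExtends ξ (sCoeff W₀ p)) →
        ExtendsToStrip ξ (fun θ => (frameDet (sCoeff W₀) θ)⁻¹) →
        (∀ p, PlaneExtends ξ (leadingError k f r om lam W n p)) →
        ∀ p, PlaneExtends ξ (W (n + 1) p) := by
  -- The correction is made a total function of the error, so that the recursion runs on bare data;
  -- smoothness and periodicity are proved afterwards by strong induction.
  choose! V α β hcorr hgood hext using fun (E : ℕ → ℝ → Plane)
    (hE : ∀ p, ContDiff ℝ ∞ (E p) ∧ Function.Periodic (E p) 1) =>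
    exists_correction h.om_ne h.lam_ne (fun p => ⟨h.contDiff_sCoeff p, h.periodic_sCoeff p⟩) hE
      h.frameDet_ne_zero
  obtain ⟨S, hS0, hS⟩ := exists_seq_of_step (T := ℝ × ℝ × (ℕ → ℝ → Plane)) (om₀, lam₀, sCoeff W₀)
    (fun n s =>
      let E := leadingError k f r (fun m => (s m).1) (fun m => (s m).2.1) (fun m => (s m).2.2) n
      (α E, β E, V E)) (fun n s s' hss => by
        have := leadingError_congr (k := k) (f := f) (r := r) (om := fun m => (s m).1)
          (om' := fun m => (s' m).1) (lam := fun m => (s m).2.1) (lam' := fun m => (s' m).2.1)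
          (W := fun m => (s m).2.2) (W' := fun m => (s' m).2.2) (n := n)
          (fun m hm => by simp only [hss m hm]) (fun m hm => by simp only [hss m hm])
          (fun m hm => by simp only [hss m hm])
        simp only [this])
  set om : ℕ → ℝ := fun m => (S m).1 with hom
  set lam : ℕ → ℝ := fun m => (S m).2.1 with hlam
  set W : ℕ → ℕ → ℝ → Plane := fun m => (S m).2.2 with hW
  set E : ℕ → ℕ → ℝ → Plane := leadingError k f r om lam W with hE
  have om_zero : om 0 = om₀ := by simp [hom, hS0]
  have lam_zero : lam 0 = lam₀ := by simp [hlam, hS0]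
  have W_zero : W 0 = sCoeff W₀ := by simp [hW, hS0]
  have om_succ : ∀ n, om (n + 1) = α (E n) := fun n => by simp only [hom, hS]
  have lam_succ : ∀ n, lam (n + 1) = β (E n) := fun n => by simp only [hlam, hS]
  have W_succ : ∀ n, W (n + 1) = V (E n) := fun n => by simp only [hW, hS]
  have hr' : ∀ θ, ContDiffAt ℝ ∞ r (W 0 0 θ) := fun θ => by
    rw [W_zero, sCoeff_zero]
    exact hr θ
  have hf' : ∀ θ, ContDiffAt ℝ ∞ f (0, W 0 0 θ, k.base (W 0 0 θ)) := fun θ => by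
    rw [W_zero, sCoeff_zero]
    exact hf θ
  have hEgood : ∀ n, (∀ m ≤ n, ∀ p, ContDiff ℝ ∞ (W m p) ∧ Function.Periodic (W m p) 1) →
      ∀ p, ContDiff ℝ ∞ (E n p) ∧ Function.Periodic (E n p) 1 := fun n hn p =>
    ⟨contDiff_leadingError (fun m hm p => (hn m hm p).1) hr' hf' p,
      periodic_leadingError (fun m hm p => (hn m hm p).2) p⟩
  have hWgood : ∀ n p, ContDiff ℝ ∞ (W n p) ∧ Function.Periodic (W n p) 1 := by
    intro n
    induction n using Nat.strong_induction_on with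
    | _ n ih =>
      rcases n with _ | n
      · rw [W_zero]
        exact fun p => ⟨h.contDiff_sCoeff p, h.periodic_sCoeff p⟩
      · rw [W_succ]
        exact hgood _ (hEgood n fun m hm => ih m (by omega))
  have hEg : ∀ n p, ContDiff ℝ ∞ (E n p) ∧ Function.Periodic (E n p) 1 := fun n =>
    hEgood n fun m _ => hWgood m
  have hc : ∀ n, IsCorrection om₀ lam₀ (W 0) (E n) (W (n + 1)) (om (n + 1)) (lam (n + 1)) := by
    intro n
    rw [W_zero, W_succ, om_succ, lam_succ]
    exact hcorr _ (hEg n)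
  have hg : UnperturbedExpansion (fun x => f (0, x, k.base x)) (om 0) (lam 0)
      (fun v : ℝ × ℝ × ℝ => W₀ v.2.1 v.2.2) (W 0) := by
    rw [om_zero, lam_zero, W_zero]
    exact h.unperturbedExpansion hf
  have hsolves : ∀ n, SolvesToOrder k f r om lam W n := by
    intro n
    induction n with
    | zero => exact solvesToOrder_zero hg hr' hf'
    | succ n ih =>
      refine ih.succ hg (fun m _ p => (hWgood m p).1) hr' hf' ?_
      rw [om_zero, lam_zero]
      exact hc n
  have hsm : ∀ n p, ContDiff ℝ ∞ (W n p) := fun n p => (hWgood n p).1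
  have hpe : ∀ n p, Function.Periodic (W n p) 1 := fun n p => (hWgood n p).2
  refine ⟨om, lam, W, ⟨om_zero, lam_zero, fun p θ => by rw [W_zero], hsm, hpe,
    solvesToAllOrders_of_forall hsolves hsm hpe hr' hf', fun n => ⟨E n,
      (hsolves n).isLeadingError hsm hpe (fun p => (hEg n p).2) hr' hf', hc n⟩⟩, W_zero,
    fun n ξ hξ h1 h2 h3 => ?_⟩
  rw [W_succ]
  exact hext _ (hEg n) ξ hξ h1 h2 h3

end Construction

/-! ### Propagation of analyticity and conclusion. -/

section Analytic

variable {k : DelayKind} {f : ℝ × Plane × Plane → Plane} {r : Plane → ℝ} {om₀ lam₀ : ℝ}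
  {om lam : ℕ → ℝ} {W : ℕ → ℕ → ℝ → Plane} {g : ℝ × ℝ × ℝ → Plane} {w' : ℕ → ℂ → CPlane}
  {F : ℂ × CPlane × CPlane → CPlane} {R : CPlane → ℂ} {ξ ξ₁ ξ₂ : ℝ} {n : ℕ}

/-- Analyticity of the coefficients at the order `n + 1` in a strip whose delayed points stay in the
strip of analyticity of the coefficients up to the order `n`. -/
theorem planeExtends_succ (hd : ComplexData k f r (W 0) ξ w' F R) (hom : om 0 ≠ 0)
    (hg : UnperturbedExpansion (fun x => f (0, x, k.base x)) (om 0) (lam 0) g (W 0))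
    (hdet : ∀ θ, frameDet (W 0) θ ≠ 0) (hW : ∀ m p, ContDiff ℝ ∞ (W m p))
    (hr : ∀ θ, ContDiffAt ℝ ∞ r (W 0 0 θ))
    (hf : ∀ θ, ContDiffAt ℝ ∞ f (0, W 0 0 θ, k.base (W 0 0 θ)))
    (hext : ∀ ξ, 0 < ξ → (∀ p, PlaneExtends ξ (W 0 p)) →
      ExtendsToStrip ξ (fun θ => (frameDet (W 0) θ)⁻¹) →
      (∀ p, PlaneExtends ξ (leadingError k f r om lam W n p)) → ∀ p, PlaneExtends ξ (W (n + 1) p))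
    (hξ₂ : 0 < ξ₂) (h21 : ξ₂ ≤ ξ₁) (h1 : ξ₁ ≤ ξ)
    (hshift : ∀ z ∈ strip ξ₂, z - k.scale (0 : ℂ) * om 0 * R (w' 0 z) ∈ strip ξ₁)
    (hn : ∀ m ≤ n, ∀ p, PlaneExtends ξ₁ (W m p)) :
    ∀ m ≤ n + 1, ∀ p, PlaneExtends ξ₂ (W m p) := by
  intro m hm p
  rcases Nat.lt_or_ge n m with hlt | hge
  · obtain rfl : m = n + 1 := by omega
    exact hext ξ₂ hξ₂ (fun p => (hn 0 (Nat.zero_le n) p).mono h21)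
      ((extendsToStrip_inv_frameDet hd hom hg hdet).mono (h21.trans h1))
      (planeExtends_leadingError hd hξ₂ h21 h1 hshift (fun m _ => hW m) hr hf hn) p
  · exact (hn m hge p).mono h21

end Analytic

theorem mainTheorem4 (k : DelayKind) (f : ℝ × Plane × Plane → Plane) (r : Plane → ℝ)
    (δ om₀ lam₀ : ℝ) (W₀ : ℝ → ℝ → Plane)
    (hW₀ : IsLimitCycleParam k f δ om₀ lam₀ W₀) :
    ((∀ θ, ContDiffAt ℝ ∞ f (0, W₀ θ 0, k.base (W₀ θ 0))) →
      (∀ θ, ContDiffAt ℝ ∞ r (W₀ θ 0)) →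
      ∃ (om lam : ℕ → ℝ) (W : ℕ → ℕ → ℝ → Plane),
        IsLindstedtSeries k f r om₀ lam₀ W₀ om lam W) ∧
    ((∀ θ, AnalyticAt ℝ f (0, W₀ θ 0, k.base (W₀ θ 0))) →
      (∀ θ, AnalyticAt ℝ r (W₀ θ 0)) →
      AnalyticOnNhd ℝ (Function.uncurry W₀) (Set.univ ×ˢ Set.Ioo (-δ) δ) →
      ∃ (om lam : ℕ → ℝ) (W : ℕ → ℕ → ℝ → Plane),
        IsLindstedtSeries k f r om₀ lam₀ W₀ om lam W ∧
        AnalyticCoefficients k f r W) := by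
  refine ⟨fun hf hr => ?_, fun hf hr hW => ?_⟩
  · obtain ⟨om, lam, W, hL, -⟩ := hW₀.exists_lindstedtSeries hf hr
    exact ⟨om, lam, W, hL⟩
  have hf' : ∀ θ, ContDiffAt ℝ ∞ f (0, W₀ θ 0, k.base (W₀ θ 0)) := fun θ => (hf θ).contDiffAt
  have hr' : ∀ θ, ContDiffAt ℝ ∞ r (W₀ θ 0) := fun θ => (hr θ).contDiffAt
  obtain ⟨om, lam, W, hL, hW0, hext⟩ := hW₀.exists_lindstedtSeries hf' hr'
  refine ⟨om, lam, W, hL, ?_⟩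
  have hg : UnperturbedExpansion (fun x => f (0, x, k.base x)) (om 0) (lam 0)
      (fun v : ℝ × ℝ × ℝ => W₀ v.2.1 v.2.2) (W 0) := by
    rw [hL.om_zero, hL.lam_zero, hW0]
    exact hW₀.unperturbedExpansion hf'
  have hom : om 0 ≠ 0 := by
    rw [hL.om_zero]
    exact hW₀.om_ne
  have hdet : ∀ θ, frameDet (W 0) θ ≠ 0 := by
    rw [hW0]
    exact hW₀.frameDet_ne_zero
  have hrW : ∀ θ, ContDiffAt ℝ ∞ r (W 0 0 θ) := fun θ => by
    rw [hW0, sCoeff_zero]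
    exact hr' θ
  have hfW : ∀ θ, ContDiffAt ℝ ∞ f (0, W 0 0 θ, k.base (W 0 0 θ)) := fun θ => by
    rw [hW0, sCoeff_zero]
    exact hf' θ
  rw [← hW0] at hext
  obtain ⟨ξ₀, w', F, R, hd, hper⟩ := hW₀.exists_complexData hf hr hW
  rw [← hW0] at hd
  have hzero : ∀ {ξ : ℝ} {w' : ℕ → ℂ → CPlane} {F : ℂ × CPlane × CPlane → CPlane}
      {R : CPlane → ℂ}, ComplexData k f r (W 0) ξ w' F R → ∀ p, PlaneExtends ξ (W 0 p) :=
    fun hd p => planeExtends_iff.2 ⟨_, hd.differentiableOn p, hd.extends_real p⟩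
  cases k with
  | shortDelay =>
    -- Here `ξ` is any admissible width, with its own extensions of the data. The local extensions
    -- obtained above only serve to show that some width is admissible.
    have hall : ∀ ξ : ℝ, 0 < ξ → DataAnalyticOnStrip f r (W 0) ξ →
        ∀ n p, AnalyticOnStrip ξ (W n p) := by
      intro ξ hξ hdata
      obtain ⟨w', F, R, hd⟩ := hdata.exists_complexData hξ
      have hind : ∀ n, ∀ m ≤ n, ∀ p, PlaneExtends ξ (W m p) := by
        intro n
        induction n with
        | zero =>
          intro m hm
          rw [Nat.le_zero.1 hm]
          exact hzero hd
        | succ n ih =>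
          exact planeExtends_succ hd hom hg hdet hL.smooth hrW hfW (hext n) hξ le_rfl le_rfl
            -- The scale is `0` at `ε = 0`: no point is shifted, and the same strip works at every
            -- order.
            (fun z hz => by simpa [DelayKind.scale] using hz) ih
      exact fun n p => (hind n n le_rfl p).analyticOnStrip hξ (hL.periodic n p)
    exact ⟨⟨ξ₀, hd.pos, hall ξ₀ hd.pos (hd.dataAnalyticOnStrip hper)⟩, hall⟩
  | weakDelay =>
    have hind : ∀ n, ∃ ξ : ℝ, 0 < ξ ∧ ξ ≤ ξ₀ ∧ ∀ m ≤ n, ∀ p, PlaneExtends ξ (W m p) := by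
      intro n
      induction n with
      | zero =>
        refine ⟨ξ₀, hd.pos, le_rfl, fun m hm => ?_⟩
        rw [Nat.le_zero.1 hm]
        exact hzero hd
      | succ n ih =>
        obtain ⟨ξ₁, hξ₁, h10, h1⟩ := ih
        -- Each order in `ε` requires a narrower strip whose delayed points fall into the previous
        -- one, so the width depends on `n` but not on `p`.
        obtain ⟨ξ₂, hξ₂, h21, hshift⟩ := hd.exists_shift (hper 0) (om 0) hξ₁
        exact ⟨ξ₂, hξ₂, h21.trans h10, planeExtends_succ hd hom hg hdet hL.smooth hrW hfW (hext n)
          hξ₂ h21 h10 (fun z hz => by simpa [DelayKind.scale] using hshift z hz) h1⟩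
    intro n
    obtain ⟨ξ, hξ, -, h1⟩ := hind n
    exact ⟨ξ, hξ, fun p => (h1 n le_rfl p).analyticOnStrip hξ (hL.periodic n p)⟩
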